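/- \textbf{Model.} There are $N$ decision makers DM$^1,\dots,$DM$^N$, an environment state $x^0_t$ and environment variables $y_t\in\mathbb{R}^{n_y}$, $t\in\mathbb{N}_0$. For $i\in[1,N]$, $$x^i_{t+1}=A^ix^i_t+B^iu^i_t+C^iy_t+w^i_t,\qquad x^0_{t+1}=A^0x^0_t+\sum_j(B^{1,j}u^j_t+B^{2,j}x^j_t)+w^0_t,$$ $$y_t=Dx^0_t+\sum_j(E^{1,j}u^j_t+E^{2,j}x^j_t)+\xi_t .$$ A pure strategy $s^i$ of DM$^i$ consists of measurable maps $s^i_t$ with $u^i_t=s^i_t(I^i_t,Y_{t-1})$, where $I^i_t=(x^i_0,\dots,x^i_t,u^i_0,\dots,u^i_{t-1})$ and $Y_{t-1}=(y_0,\dots,y_{t-1})$. With discount factor $\beta^i\in[0,1)$ and $Q^i,R^i\succ0$, for a deterministic sequence $\bar Z=(\bar z_t)_t$ let $$J^i(s^i,\bar Z)=E\Big[\sum_{t\ge0}(\beta^i)^t\big(x_t^{i\prime}Q^ix^i_t+u_t^{i\prime}R^iu^i_t+2\bar z_t'(K^iu^i_t+L^ix^i_t)\big)\Big],$$ where $y$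 is replaced by $\bar Z$ in the dynamics of $x^i$ and in $u_t^i$. A joint strategy $s$ is a subjective equilibrium under beliefs of exogenous uncertainty (SEBEU) if there are probability measures $\zeta^1,\dots,\zeta^N$ on $(\mathbb{R}^{n_y})^{\mathbb{N}_0}$ such that, for every $i$, $s^i$ minimizes $E^{\zeta^i}[J^i(\cdot,\cdot)]$ over all pure strategies of DM$^i$, and $\zeta^i$ is the law of $(y_t)_t$ generated by $s$. \textbf{Constants.} Let $M^i\succeq0$ solve $M^i=Q^i+\beta^iA^{i\prime}\big(M^i-\beta^iM^iB^i(S^i)^{-1}B^{i\prime}M^i\big)A^i$ with $S^i=R^i+\beta^iB^{i\prime}M^iB^i$. Put $X_t=(x^0_t,\dots,x^N_t)$, $W_t=(w^0_t,\dots,w^N_t)$, $\hat W_0=E[W_0]$, $\hat\xi_0=E[\xi_0]$, $\hat w^i_0=E[w^i_0]$, and $$F^i=-\beta^i(S^i)^{-1}B^{i\prime}M^iA^i,\qquad \Phi^i=\beta^i(A^i+B^iF^i)',\qquad G^i_0=-(S^i)^{-1}(K^{i\prime}+\beta^iB^{i\prime}M^iC^i),$$ $$G^i_n=-\beta^i(S^i)^{-1}B^{i\prime}(\Phi^i)^{n-1}(F^{i\prime}K^{i\prime}+L^{i\prime}+\Phi^iM^iC^i)\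 (n\ge1),\qquad H^i=-\beta^i(S^i)^{-1}B^{i\prime}(I-\Phi^i)^{-1}M^i\hat w^i_0 .$$ Substituting $u^i_t=F^ix^i_t+\sum_nG^i_nv_{t,n}+H^i$ into the dynamics and collecting terms defines the constants in $$y_t=\mathcal{D}X_t+\sum_n\mathcal{G}^p_nv_{t,n}+\mathcal{H}^p+\xi_t,\qquad X_{t+1}=\mathcal{A}X_t+\sum_n\mathcal{G}^X_nv_{t,n}+\mathcal{H}^X+\mathcal{C}y_t+W_t .$$ \textbf{Assumptions.} (1) $A^0$ is stable and every $(A^i,B^i)$ is stabilizable; $X_0,W_0,W_1,\dots,\xi_0,\xi_1,\dots$ are mutually independent with finite second moments; $(W_t)$ and $(\xi_t)$ are each i.i.d. (2) There are uniformly bounded $(a_t),(b_t)$ such that, for every $\hat X_0$, $\hat y_t=a_t\hat X_0+b_t$ is the unique bounded solution of $$\hat y_t=\mathcal{D}\hat X_t+\sum_n\mathcal{G}^p_n\hat y_{t+n}+\mathcal{H}^p+\hat\xi_0,\qquad \hat X_{t+1}=\mathcal{A}\hat X_t+\sum_n\mathcal{G}^X_n\hat y_{t+n}+\mathcal{H}^X+\mathcal{C}\hat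 y_t+\hat W_0 .$$ Set $G^i=\sum_nG^i_na_n$, $\check H^i=\sum_nG^i_nb_n+H^i$, $\mathcal{G}^p=\sum_n\mathcal{G}^p_na_n$, $\check{\mathcal{H}}^p=\sum_n\mathcal{G}^p_nb_n+\mathcal{H}^p$, $\mathcal{G}^X=\sum_n\mathcal{G}^X_na_n$, $\check{\mathcal{H}}^X=\sum_n\mathcal{G}^X_nb_n+\mathcal{H}^X$. (3) The process generated by $$\bar y_t=\mathcal{D}\bar X_t+\mathcal{G}^pE[\bar X_t|\bar Y_{t-1}]+\check{\mathcal{H}}^p+\bar\xi_t,\qquad \bar X_{t+1}=\mathcal{A}\bar X_t+\mathcal{G}^XE[\bar X_t|\bar Y_{t-1}]+\check{\mathcal{H}}^X+\mathcal{C}\bar y_t+\bar W_t,$$ where $\bar Y_{t-1}=(\bar y_0,\dots,\bar y_{t-1})$ and $(\bar X_0,(\bar\xi_t),(\bar W_t))$ has the law of $(X_0,(\xi_t),(W_t))$, satisfies $\sup_tE[|\bar y_t|^2]<\infty$. (4) $(X_0,(\xi_t)_t,(W_t)_t)$ is Gaussian. (5) $\mathcal{D}\Sigma\mathcal{D}'+\mathrm{cov}[\xi_0]$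 is invertible and $\mathrm{cov}[X_0]=\Sigma$, where $$\Sigma=\mathcal{A}\big(\Sigma-\Sigma\mathcal{D}'(\mathcal{D}\Sigma\mathcal{D}'+\mathrm{cov}[\xi_0])^{-1}\mathcal{D}\Sigma\big)\mathcal{A}'+\mathrm{cov}[W_0].$$ \textbf{Conclusion.} Let $\hat X_t(\cdot)$ be the map $(y_0,\dots,y_{t-1})\mapsto\hat X_t$ defined by the linear time-invariant recursion $\hat X_0=E[X_0]$, $$\hat X_{t+1}=\mathcal{A}\hat X_t+\mathcal{G}^X\hat X_t+\check{\mathcal{H}}^X+\mathcal{C}y_t+\hat W_0+\mathcal{A}\Sigma\mathcal{D}'(\mathcal{D}\Sigma\mathcal{D}'+\mathrm{cov}[\xi_0])^{-1}\big(y_t-(\mathcal{D}+\mathcal{G}^p)\hat X_t-\check{\mathcal{H}}^p-\hat\xi_0\big).$$ Then $\hat X_t(\bar Y_{t-1})=E[\bar X_t|\bar Y_{t-1}]$ almost surely for all $t$, and the joint strategy $s^i_t(I^i_t,Y_{t-1})=F^ix^i_t+G^i\hat X_t(Y_{t-1})+\check H^i$ is an SEBEU. Moreover, for all measurable maps $e_t$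 with $e_t(\bar Y_{t-1})=E[\bar X_t|\bar Y_{t-1}]$ almost surely for all $t$, the joint strategy $u^i_t=F^ix^i_t+G^ie_t(Y_{t-1})+\check H^i$ is an SEBEU, and the decisions that it generates satisfy, almost surely, $u^i_t=F^ix^i_t+G^i\hat X_t(Y_{t-1})+\check H^i$ for all $i$ and $t$. -/

import Mathlib

open MeasureTheory ProbabilityTheory Filter Topology
open scoped ENNReal NNReal Matrix

noncomputable section

/-! ### Linear-algebraic notions -/

/-- Asymptotic stability of `x (t+1) = A x t`. -/
def IsStableMatrix {n : Type} [Fintype n] [DecidableEq n] (A : Matrix n n ℝ) : Prop :=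
  Tendsto (fun k : ℕ => A ^ k) atTop (𝓝 0)

/-- `(A, B)` is stabilizable: some linear state feedback makes the closed loop stable. -/
def IsStabilizable {n m : Type} [Fintype n] [DecidableEq n] [Fintype m]
    (A : Matrix n n ℝ) (B : Matrix n m ℝ) : Prop :=
  ∃ F : Matrix m n ℝ, IsStableMatrix (A + B * F)

/-- The discounted algebraic Riccati equation
`M = Q + β A' (M - β M B S⁻¹ B' M) A` with `S = R + β B' M B`. -/
def IsRiccatiSolution {n m : Type} [Fintype n] [DecidableEq n] [Fintype m] [DecidableEq m]
    (β : ℝ) (A : Matrix n n ℝ) (B : Matrix n m ℝ) (Q : Matrix n n ℝ) (R : Matrix m m ℝ)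
    (M : Matrix n n ℝ) : Prop :=
  M = Q + β • (Aᵀ * (M - β • (M * B * (R + β • (Bᵀ * M * B))⁻¹ * Bᵀ * M)) * A)

/-- The positive semidefinite solution of the discounted algebraic Riccati equation
(it exists and is unique when `(A, B)` is stabilizable, `0 ≤ β < 1` and `Q`, `R` are positive
definite). -/
def riccatiSol {n m : Type} [Fintype n] [DecidableEq n] [Fintype m] [DecidableEq m]
    (β : ℝ) (A : Matrix n n ℝ) (B : Matrix n m ℝ) (Q : Matrix n n ℝ) (R : Matrix m m ℝ) :
    Matrix n n ℝ :=
  Classical.epsilon fun M => M.PosSemidef ∧ IsRiccatiSolution β A B Q R M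

/-! ### Expectations -/

/-- Mean vector of a random vector. -/
def meanVec {Ω : Type*} [MeasurableSpace Ω] (P : Measure Ω) {ι : Type}
    (V : Ω → ι → ℝ) : ι → ℝ := fun j => ∫ ω, V ω j ∂P

/-- Covariance matrix of a random vector. -/
def covMat {Ω : Type*} [MeasurableSpace Ω] (P : Measure Ω) {ι : Type}
    (V : Ω → ι → ℝ) : Matrix ι ι ℝ :=
  Matrix.of fun j k => cov[fun ω => V ω j, fun ω => V ω k; P]

/-- `p - q` for a total positive part `p` and a total negative part `q`; the indeterminate form
`∞ - ∞` is read as the cost `+∞`. -/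
def posMinusNeg (p q : ℝ≥0∞) : EReal := -((q : EReal) - (p : EReal))

/-- Extended-real expectation `E[f] = E[f⁺] - E[f⁻]`. -/
def extExp {Ω : Type*} [MeasurableSpace Ω] (P : Measure Ω) (f : Ω → EReal) : EReal :=
  posMinusNeg (∫⁻ ω, (f ω).toENNReal ∂P) (∫⁻ ω, (-(f ω)).toENNReal ∂P)

/-- Extended-real sum of a series, the sum of the positive parts minus that of the negative
parts. -/
def extSum (c : ℕ → ℝ) : EReal :=
  posMinusNeg (∑' t, ENNReal.ofReal (c t)) (∑' t, ENNReal.ofReal (-(c t)))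

/-! ### The linear-quadratic game -/

/-- Data of the time-invariant infinite-horizon linear-quadratic game with `N` decision makers.
`n0`, `ny` are the dimensions of the environment state and of the environment variables; `nx i`,
`nu i` those of the state and of the control of decision maker `i`. -/
structure LQGame where
  N : ℕ
  n0 : ℕ
  ny : ℕ
  nx : Fin N → ℕ
  nu : Fin N → ℕ
  A : ∀ i, Matrix (Fin (nx i)) (Fin (nx i)) ℝ
  B : ∀ i, Matrix (Fin (nx i)) (Fin (nu i)) ℝ
  C : ∀ i, Matrix (Fin (nx i)) (Fin ny) ℝ
  Q : ∀ i, Matrix (Fin (nx i)) (Fin (nx i)) ℝ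
  R : ∀ i, Matrix (Fin (nu i)) (Fin (nu i)) ℝ
  K : ∀ i, Matrix (Fin ny) (Fin (nu i)) ℝ
  L : ∀ i, Matrix (Fin ny) (Fin (nx i)) ℝ
  β : Fin N → ℝ
  A0 : Matrix (Fin n0) (Fin n0) ℝ
  B1 : ∀ i, Matrix (Fin n0) (Fin (nu i)) ℝ
  B2 : ∀ i, Matrix (Fin n0) (Fin (nx i)) ℝ
  D : Matrix (Fin ny) (Fin n0) ℝ
  E1 : ∀ i, Matrix (Fin ny) (Fin (nu i)) ℝ
  E2 : ∀ i, Matrix (Fin ny) (Fin (nx i)) ℝ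
  Q_posDef : ∀ i, (Q i).PosDef
  R_posDef : ∀ i, (R i).PosDef
  β_nonneg : ∀ i, 0 ≤ β i
  β_lt_one : ∀ i, β i < 1

namespace LQGame

variable (g : LQGame)

/-- Environment variables. -/
abbrev Y : Type := Fin g.ny → ℝ

/-- Coordinates of the system state `X = (x⁰, x¹, …, x^N)`. -/
abbrev SIdx : Type := Fin g.n0 ⊕ (Σ i : Fin g.N, Fin (g.nx i))

/-- System states. -/
abbrev X : Type := g.SIdx → ℝ

/-- The environment component of a system vector. -/
def envPart (v : g.X) : Fin g.n0 → ℝ := fun j => v (Sum.inl j)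

/-- The component of decision maker `i` of a system vector. -/
def ownPart (i : Fin g.N) (v : g.X) : Fin (g.nx i) → ℝ := fun j => v (Sum.inr ⟨i, j⟩)

/-! #### Strategies, trajectories, costs -/

/-- Pure strategies of decision maker `i`: at time `t`, a measurable function of the own states up
to time `t`, the own controls before `t` and the environment variables before `t`. -/
structure Strategy (i : Fin g.N) where
  act : ∀ t : ℕ, (Fin (t + 1) → Fin (g.nx i) → ℝ) → (Fin t → Fin (g.nu i) → ℝ) →
    (Fin t → g.Y) → (Fin (g.nu i) → ℝ)
  measurable_act : ∀ t, Measurable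
    fun p : (Fin (t + 1) → Fin (g.nx i) → ℝ) × (Fin t → Fin (g.nu i) → ℝ) × (Fin t → g.Y) =>
      act t p.1 p.2.1 p.2.2

/-- What has been realized up to time `t`, before the controls of time `t` are chosen. -/
structure History (t : ℕ) where
  env : Fin g.n0 → ℝ
  x : ∀ i : Fin g.N, Fin (t + 1) → Fin (g.nx i) → ℝ
  u : ∀ i : Fin g.N, Fin t → Fin (g.nu i) → ℝ
  y : Fin t → g.Y

variable {g}

/-- The control chosen by decision maker `i` at a history. -/
def control (s : ∀ i, g.Strategy i) {t : ℕ} (h : g.History t) (i : Fin g.N) :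
    Fin (g.nu i) → ℝ :=
  (s i).act t (h.x i) (h.u i) h.y

/-- The environment variable generated at a history. -/
def output (s : ∀ i, g.Strategy i) {t : ℕ} (h : g.History t) (ξt : g.Y) : g.Y :=
  g.D *ᵥ h.env
    + ∑ i, (g.E1 i *ᵥ control s h i + g.E2 i *ᵥ h.x i (Fin.last t)) + ξt

/-- The history generated by a joint strategy from the realization `(X₀, ξ, W)` of the primitive
random variables. -/
def hist (s : ∀ i, g.Strategy i) (X₀ : g.X) (ξ : ℕ → g.Y) (W : ℕ → g.X) :
    (t : ℕ) → g.History t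
  | 0 =>
    { env := g.envPart X₀
      x := fun i _ => g.ownPart i X₀
      u := fun _ k => k.elim0
      y := fun k => k.elim0 }
  | t + 1 =>
    let h := hist s X₀ ξ W t
    { env := g.A0 *ᵥ h.env
        + ∑ i, (g.B1 i *ᵥ control s h i + g.B2 i *ᵥ h.x i (Fin.last t)) + g.envPart (W t)
      x := fun i => Fin.snoc (α := fun _ => Fin (g.nx i) → ℝ) (h.x i)
        (g.A i *ᵥ h.x i (Fin.last t) + g.B i *ᵥ control s h i + g.C i *ᵥ output s h (ξ t)
          + g.ownPart i (W t))
      u := fun i => Fin.snoc (α := fun _ => Fin (g.nu i) → ℝ) (h.u i) (control s h i)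
      y := Fin.snoc (α := fun _ => g.Y) h.y (output s h (ξ t)) }

/-- The sequence of environment variables generated by a joint strategy. -/
def envVar (s : ∀ i, g.Strategy i) (X₀ : g.X) (ξ : ℕ → g.Y) (W : ℕ → g.X) (t : ℕ) : g.Y :=
  output s (hist s X₀ ξ W t) (ξ t)

/-- The objective distribution of the environment variables under a joint strategy. -/
def envLaw {Ω : Type*} [MeasurableSpace Ω] (P : Measure Ω) (X₀ : Ω → g.X) (ξ : ℕ → Ω → g.Y)
    (W : ℕ → Ω → g.X) (s : ∀ i, g.Strategy i) : Measure (ℕ → g.Y) :=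
  P.map fun ω => envVar s (X₀ ω) (fun t => ξ t ω) (fun t => W t ω)

/-- State and control history of decision maker `i` when the environment variables are the fixed
exogenous sequence `z`. -/
def ownHist {i : Fin g.N} (s : g.Strategy i) (x₀ : Fin (g.nx i) → ℝ)
    (w : ℕ → Fin (g.nx i) → ℝ) (z : ℕ → g.Y) :
    (t : ℕ) → (Fin (t + 1) → Fin (g.nx i) → ℝ) × (Fin t → Fin (g.nu i) → ℝ)
  | 0 => (fun _ => x₀, fun k => k.elim0)
  | t + 1 =>
    let h := ownHist s x₀ w z t
    let ut := s.act t h.1 h.2 (fun k => z k)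
    (Fin.snoc (α := fun _ => Fin (g.nx i) → ℝ) h.1
        (g.A i *ᵥ h.1 (Fin.last t) + g.B i *ᵥ ut + g.C i *ᵥ z t + w t),
      Fin.snoc (α := fun _ => Fin (g.nu i) → ℝ) h.2 ut)

variable (g) in
/-- Stage cost `|x|²_Q + |u|²_R + 2 y' (K u + L x)`. -/
def stageCost (i : Fin g.N) (x : Fin (g.nx i) → ℝ) (u : Fin (g.nu i) → ℝ) (y : g.Y) : ℝ :=
  x ⬝ᵥ (g.Q i *ᵥ x) + u ⬝ᵥ (g.R i *ᵥ u) + 2 * (y ⬝ᵥ (g.K i *ᵥ u + g.L i *ᵥ x))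

/-- The discounted cost of decision maker `i` along one realization. -/
def pathCost {i : Fin g.N} (s : g.Strategy i) (x₀ : Fin (g.nx i) → ℝ)
    (w : ℕ → Fin (g.nx i) → ℝ) (z : ℕ → g.Y) : EReal :=
  extSum fun t => g.β i ^ t *
    g.stageCost i ((ownHist s x₀ w z t).1 (Fin.last t))
      (s.act t (ownHist s x₀ w z t).1 (ownHist s x₀ w z t).2 (fun k => z k)) (z t)

/-- `Jⁱ(sⁱ, z)`: expected discounted cost against the deterministic sequence `z`. -/
def costJ {Ω : Type*} [MeasurableSpace Ω] (P : Measure Ω) (X₀ : Ω → g.X) (W : ℕ → Ω → g.X)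
    {i : Fin g.N} (s : g.Strategy i) (z : ℕ → g.Y) : EReal :=
  extExp P fun ω => pathCost s (g.ownPart i (X₀ ω)) (fun t => g.ownPart i (W t ω)) z

/-- Subjective equilibrium under beliefs of exogenous uncertainty, in pure strategies: there are
beliefs `ζ i` such that each `s i` is optimal for `E^{ζ i}[Jⁱ(·, ·)]`, and each belief is the
objective distribution of the environment variables. -/
def IsSEBEU {Ω : Type*} [MeasurableSpace Ω] (P : Measure Ω) (X₀ : Ω → g.X) (ξ : ℕ → Ω → g.Y)
    (W : ℕ → Ω → g.X) (s : ∀ i, g.Strategy i) : Prop :=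
  ∃ ζ : Fin g.N → ProbabilityMeasure (ℕ → g.Y),
    (∀ i, ∀ s' : g.Strategy i,
      extExp (ζ i : Measure (ℕ → g.Y)) (costJ P X₀ W (s i))
        ≤ extExp (ζ i : Measure (ℕ → g.Y)) (costJ P X₀ W s')) ∧
    ∀ i, (ζ i : Measure (ℕ → g.Y)) = envLaw P X₀ ξ W s

variable (g)

/-! #### Best-response coefficients -/

/-- `M`: the positive semidefinite solution of the Riccati equation of decision maker `i`. -/
def M (i : Fin g.N) : Matrix (Fin (g.nx i)) (Fin (g.nx i)) ℝ :=
  riccatiSol (g.β i) (g.A i) (g.B i) (g.Q i) (g.R i)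

/-- `S = R + β B' M B`. -/
def S (i : Fin g.N) : Matrix (Fin (g.nu i)) (Fin (g.nu i)) ℝ :=
  g.R i + g.β i • ((g.B i)ᵀ * g.M i * g.B i)

/-- `F = -β S⁻¹ B' M A`. -/
def F (i : Fin g.N) : Matrix (Fin (g.nu i)) (Fin (g.nx i)) ℝ :=
  -(g.β i • ((g.S i)⁻¹ * (g.B i)ᵀ * g.M i * g.A i))

/-- `Φ = β (A + B F)'`. -/
def Φ (i : Fin g.N) : Matrix (Fin (g.nx i)) (Fin (g.nx i)) ℝ :=
  g.β i • (g.A i + g.B i * g.F i)ᵀ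

/-- `G₀ = -S⁻¹ (K' + β B' M C)`, and for `n ≥ 1`,
`Gₙ = -β S⁻¹ B' Φⁿ⁻¹ (F' K' + L' + Φ M C)`. -/
def Gn (i : Fin g.N) : ℕ → Matrix (Fin (g.nu i)) (Fin g.ny) ℝ
  | 0 => -((g.S i)⁻¹ * ((g.K i)ᵀ + g.β i • ((g.B i)ᵀ * g.M i * g.C i)))
  | n + 1 => -(g.β i • ((g.S i)⁻¹ * (g.B i)ᵀ * g.Φ i ^ n *
      ((g.F i)ᵀ * (g.K i)ᵀ + (g.L i)ᵀ + g.Φ i * g.M i * g.C i)))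

/-- `H = -β S⁻¹ B' (I - Φ)⁻¹ M ŵ`, where `Ŵ` is the mean of the system disturbance. -/
def H (Ŵ : g.X) (i : Fin g.N) : Fin (g.nu i) → ℝ :=
  -(g.β i • (((g.S i)⁻¹ * (g.B i)ᵀ * (1 - g.Φ i)⁻¹ * g.M i) *ᵥ g.ownPart i Ŵ))

/-! #### Vector form of the closed loop -/

/-- `𝒟`. -/
def Dc : Matrix (Fin g.ny) g.SIdx ℝ :=
  Matrix.fromCols g.D (Matrix.of fun r p => (g.E1 p.1 * g.F p.1 + g.E2 p.1) r p.2)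

/-- `𝒜`. -/
def Ac : Matrix g.SIdx g.SIdx ℝ :=
  Matrix.fromBlocks g.A0 (Matrix.of fun r p => (g.B1 p.1 * g.F p.1 + g.B2 p.1) r p.2)
    0 (Matrix.blockDiagonal' fun i => g.A i + g.B i * g.F i)

/-- `𝒞`. -/
def Cc : Matrix g.SIdx (Fin g.ny) ℝ :=
  Matrix.fromRows 0 (Matrix.of fun p r => g.C p.1 p.2 r)

/-- `𝒢ᵖₙ`. -/
def Gpn (n : ℕ) : Matrix (Fin g.ny) (Fin g.ny) ℝ := ∑ i, g.E1 i * g.Gn i n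

/-- `𝒢ˣₙ`. -/
def GXn (n : ℕ) : Matrix g.SIdx (Fin g.ny) ℝ :=
  Matrix.fromRows (∑ i, g.B1 i * g.Gn i n)
    (Matrix.of fun p r => (g.B p.1 * g.Gn p.1 n) p.2 r)

/-- `ℋᵖ`. -/
def Hp (Ŵ : g.X) : g.Y := ∑ i, g.E1 i *ᵥ g.H Ŵ i

/-- `ℋˣ`. -/
def HX (Ŵ : g.X) : g.X :=
  Sum.elim (∑ i, g.B1 i *ᵥ g.H Ŵ i) (fun p => (g.B p.1 *ᵥ g.H Ŵ p.1) p.2)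

/-- `ŷ` solves the infinite linear system
`ŷₜ = 𝒟 X̂ₜ + ∑ₙ 𝒢ᵖₙ ŷₜ₊ₙ + ℋᵖ + ξ̂`, `X̂ₜ₊₁ = 𝒜 X̂ₜ + ∑ₙ 𝒢ˣₙ ŷₜ₊ₙ + ℋˣ + 𝒞 ŷₜ + Ŵ`
with initial state `X̂₀`. -/
def SolvesMeanSystem (ξhat : g.Y) (Ŵ : g.X) (Xhat₀ : g.X) (yhat : ℕ → g.Y) : Prop :=
  (∀ t, Summable fun n => g.Gpn n *ᵥ yhat (t + n)) ∧
  (∀ t, Summable fun n => g.GXn n *ᵥ yhat (t + n)) ∧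
  ∃ Xhat : ℕ → g.X, Xhat 0 = Xhat₀ ∧
    (∀ t, yhat t = g.Dc *ᵥ Xhat t + ∑' n, g.Gpn n *ᵥ yhat (t + n) + g.Hp Ŵ + ξhat) ∧
    ∀ t, Xhat (t + 1) = g.Ac *ᵥ Xhat t + ∑' n, g.GXn n *ᵥ yhat (t + n) + g.HX Ŵ
      + g.Cc *ᵥ yhat t + Ŵ

/-- For every initial state the infinite linear system has a unique (bounded) solution, namely
`ŷₜ = aₜ X̂₀ + bₜ`, with `a` and `b` uniformly bounded. -/
structure UniquelySolvable (ξhat : g.Y) (Ŵ : g.X)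
    (a : ℕ → Matrix (Fin g.ny) g.SIdx ℝ) (b : ℕ → g.Y) : Prop where
  bounded_a : ∃ c : ℝ, ∀ t j k, |a t j k| ≤ c
  bounded_b : ∃ c : ℝ, ∀ t j, |b t j| ≤ c
  solves : ∀ Xhat₀, g.SolvesMeanSystem ξhat Ŵ Xhat₀ (fun t => a t *ᵥ Xhat₀ + b t)
  unique : ∀ Xhat₀ yhat, (∃ c : ℝ, ∀ t j, |yhat t j| ≤ c) →
    g.SolvesMeanSystem ξhat Ŵ Xhat₀ yhat → yhat = fun t => a t *ᵥ Xhat₀ + b t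

section Coefficients

variable (Ŵ : g.X) (a : ℕ → Matrix (Fin g.ny) g.SIdx ℝ) (b : ℕ → g.Y)

/-- `Gⁱ = ∑ₙ Gⁱₙ aₙ`. -/
def Gi (i : Fin g.N) : Matrix (Fin (g.nu i)) g.SIdx ℝ := ∑' n, g.Gn i n * a n

/-- `Ȟⁱ = ∑ₙ Gⁱₙ bₙ + Hⁱ`. -/
def Hi (i : Fin g.N) : Fin (g.nu i) → ℝ := ∑' n, g.Gn i n *ᵥ b n + g.H Ŵ i

/-- `𝒢ᵖ = ∑ₙ 𝒢ᵖₙ aₙ`. -/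
def Gp : Matrix (Fin g.ny) g.SIdx ℝ := ∑' n, g.Gpn n * a n

/-- `ℋ̌ᵖ = ∑ₙ 𝒢ᵖₙ bₙ + ℋᵖ`. -/
def Hpc : g.Y := ∑' n, g.Gpn n *ᵥ b n + g.Hp Ŵ

/-- `𝒢ˣ = ∑ₙ 𝒢ˣₙ aₙ`. -/
def GX : Matrix g.SIdx g.SIdx ℝ := ∑' n, g.GXn n * a n

/-- `ℋ̌ˣ = ∑ₙ 𝒢ˣₙ bₙ + ℋˣ`. -/
def HXc : g.X := ∑' n, g.GXn n *ᵥ b n + g.HX Ŵ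

end Coefficients

/-! #### The exogenous replica and the estimator -/

/-- The σ-algebra generated by `ȳ₀, …, ȳₜ₋₁`. -/
abbrev pastSigma {Ω : Type*} (ybar : ℕ → Ω → g.Y) (t : ℕ) : MeasurableSpace Ω :=
  MeasurableSpace.comap (fun ω (k : Fin t) => ybar k ω) inferInstance

/-- `(X̄, ȳ)` is generated from `(X̄₀, ξ̄, W̄)` by
`ȳₜ = 𝒟 X̄ₜ + 𝒢ᵖ E[X̄ₜ | Ȳₜ₋₁] + ℋ̌ᵖ + ξ̄ₜ` and
`X̄ₜ₊₁ = 𝒜 X̄ₜ + 𝒢ˣ E[X̄ₜ | Ȳₜ₋₁] + ℋ̌ˣ + 𝒞 ȳₜ + W̄ₜ`. -/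
structure IsReplica {Ω : Type*} [MeasurableSpace Ω] (P : Measure Ω)
    (Ŵ : g.X) (a : ℕ → Matrix (Fin g.ny) g.SIdx ℝ) (b : ℕ → g.Y)
    (X₀ : Ω → g.X) (ξ : ℕ → Ω → g.Y) (W : ℕ → Ω → g.X)
    (Xbar : ℕ → Ω → g.X) (ybar : ℕ → Ω → g.Y) : Prop where
  measurable_X : ∀ t, Measurable (Xbar t)
  measurable_y : ∀ t, Measurable (ybar t)
  init : Xbar 0 =ᵐ[P] X₀
  output : ∀ t, ∀ᵐ ω ∂P, ybar t ω = g.Dc *ᵥ Xbar t ω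
    + g.Gp a *ᵥ (P[Xbar t | g.pastSigma ybar t]) ω + g.Hpc Ŵ b + ξ t ω
  step : ∀ t, ∀ᵐ ω ∂P, Xbar (t + 1) ω = g.Ac *ᵥ Xbar t ω
    + g.GX a *ᵥ (P[Xbar t | g.pastSigma ybar t]) ω + g.HXc Ŵ b + g.Cc *ᵥ ybar t ω + W t ω

/-- Measurable mappings `(y₀, …, yₜ₋₁) ↦ X̂ₜ`. -/
structure EstimatorMap where
  map : ∀ t : ℕ, (Fin t → g.Y) → g.X
  measurable_map : ∀ t, Measurable (map t)

/-- `e` is (a version of) the state estimator mapping `Ȳₜ₋₁ ↦ E[X̄ₜ | Ȳₜ₋₁]`. -/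
def IsStateEstimator {Ω : Type*} [MeasurableSpace Ω] (P : Measure Ω)
    (Xbar : ℕ → Ω → g.X) (ybar : ℕ → Ω → g.Y) (e : g.EstimatorMap) : Prop :=
  ∀ t, (fun ω => e.map t fun k => ybar k ω) =ᵐ[P] P[Xbar t | g.pastSigma ybar t]

/-- The joint strategy `uⁱₜ = Fⁱ xⁱₜ + Gⁱ eₜ(Yₜ₋₁) + Ȟⁱ`. -/
def affineStrategy (Ŵ : g.X) (a : ℕ → Matrix (Fin g.ny) g.SIdx ℝ) (b : ℕ → g.Y)
    (e : g.EstimatorMap) (i : Fin g.N) : g.Strategy i where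
  act t x _ y := g.F i *ᵥ x (Fin.last t) + g.Gi a i *ᵥ e.map t y + g.Hi Ŵ b i
  measurable_act t := by
    have h1 : Measurable fun p : (Fin (t + 1) → Fin (g.nx i) → ℝ) ×
        (Fin t → Fin (g.nu i) → ℝ) × (Fin t → g.Y) => g.F i *ᵥ p.1 (Fin.last t) :=
      (Continuous.matrix_mulVec continuous_const continuous_id).measurable.comp
        ((measurable_pi_apply _).comp measurable_fst)
    have h2 : Measurable fun p : (Fin (t + 1) → Fin (g.nx i) → ℝ) ×
        (Fin t → Fin (g.nu i) → ℝ) × (Fin t → g.Y) => g.Gi a i *ᵥ e.map t p.2.2 :=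
      (Continuous.matrix_mulVec continuous_const continuous_id).measurable.comp
        ((e.measurable_map t).comp (measurable_snd.comp measurable_snd))
    exact (h1.add h2).add_const _

/-- Steady-state Kalman gain `𝒜 Σ 𝒟' (𝒟 Σ 𝒟' + V)⁻¹`, with `V` the covariance of `ξ₀`. -/
def kalmanGain (Sig : Matrix g.SIdx g.SIdx ℝ) (V : Matrix (Fin g.ny) (Fin g.ny) ℝ) :
    Matrix g.SIdx (Fin g.ny) ℝ :=
  g.Ac * Sig * g.Dcᵀ * (g.Dc * Sig * g.Dcᵀ + V)⁻¹

/-- One step of the time-invariant filter: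
`X̂⁺ = 𝒜 X̂ + 𝒢ˣ X̂ + ℋ̌ˣ + 𝒞 y + Ŵ + gain (y - (𝒟 + 𝒢ᵖ) X̂ - ℋ̌ᵖ - ξ̂)`. -/
def filterStep (ξhat : g.Y) (Ŵ : g.X) (a : ℕ → Matrix (Fin g.ny) g.SIdx ℝ) (b : ℕ → g.Y)
    (gain : Matrix g.SIdx (Fin g.ny) ℝ) (Xh : g.X) (y : g.Y) : g.X :=
  g.Ac *ᵥ Xh + g.GX a *ᵥ Xh + g.HXc Ŵ b + g.Cc *ᵥ y + Ŵ
    + gain *ᵥ (y - (g.Dc + g.Gp a) *ᵥ Xh - g.Hpc Ŵ b - ξhat)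

/-- The state of the time-invariant filter at time `t`, started at `m₀` and driven by
`y₀, …, yₜ₋₁`. -/
def filterState (m₀ : g.X) (ξhat : g.Y) (Ŵ : g.X) (a : ℕ → Matrix (Fin g.ny) g.SIdx ℝ)
    (b : ℕ → g.Y) (gain : Matrix g.SIdx (Fin g.ny) ℝ) : (t : ℕ) → (Fin t → g.Y) → g.X
  | 0, _ => m₀
  | t + 1, y => g.filterStep ξhat Ŵ a b gain
      (filterState m₀ ξhat Ŵ a b gain t (fun k => y k.castSucc)) (y (Fin.last t))

theorem continuous_filterState (m₀ : g.X) (ξhat : g.Y) (Ŵ : g.X)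
    (a : ℕ → Matrix (Fin g.ny) g.SIdx ℝ) (b : ℕ → g.Y)
    (gain : Matrix g.SIdx (Fin g.ny) ℝ) (t : ℕ) :
    Continuous (g.filterState m₀ ξhat Ŵ a b gain t) := by
  induction t with
  | zero => exact continuous_const
  | succ t ih =>
    have h1 : Continuous fun y : Fin (t + 1) → g.Y =>
        g.filterState m₀ ξhat Ŵ a b gain t (fun k => y k.castSucc) :=
      ih.comp (continuous_pi fun k => continuous_apply _)
    have h2 : Continuous fun y : Fin (t + 1) → g.Y => y (Fin.last t) := continuous_apply _
    have e1 := Continuous.matrix_mulVec (continuous_const (y := g.Ac)) h1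
    have e2 := Continuous.matrix_mulVec (continuous_const (y := g.GX a)) h1
    have e3 := Continuous.matrix_mulVec (continuous_const (y := g.Cc)) h2
    have e4 := Continuous.matrix_mulVec (continuous_const (y := g.Dc + g.Gp a)) h1
    have e5 := Continuous.matrix_mulVec (continuous_const (y := gain))
      (((h2.sub e4).sub (continuous_const (y := g.Hpc Ŵ b))).sub
        (continuous_const (y := ξhat)))
    exact ((((e1.add e2).add continuous_const).add e3).add continuous_const).add e5

/-- The estimator mapping realized by the time-invariant filter. -/
def filterMap (m₀ : g.X) (ξhat : g.Y) (Ŵ : g.X) (a : ℕ → Matrix (Fin g.ny) g.SIdx ℝ)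
    (b : ℕ → g.Y) (gain : Matrix g.SIdx (Fin g.ny) ℝ) : g.EstimatorMap where
  map := g.filterState m₀ ξhat Ŵ a b gain
  measurable_map t := (g.continuous_filterState m₀ ξhat Ŵ a b gain t).measurable

/-! #### Assumptions on the primitive random variables -/

/-- `A⁰` is stable, the `(Aⁱ, Bⁱ)` are stabilizable; `X₀, W₀, W₁, …, ξ₀, ξ₁, …` are mutually
independent with finite second moments; the `Wₜ` are identically distributed, and so are the
`ξₜ`. -/
structure StandingAssumptions {Ω : Type*} [MeasurableSpace Ω] (P : Measure Ω)
    (X₀ : Ω → g.X) (ξ : ℕ → Ω → g.Y) (W : ℕ → Ω → g.X) : Prop where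
  stable_A0 : IsStableMatrix g.A0
  stabilizable : ∀ i, IsStabilizable (g.A i) (g.B i)
  measurable_X₀ : Measurable X₀
  measurable_ξ : ∀ t, Measurable (ξ t)
  measurable_W : ∀ t, Measurable (W t)
  indep : iIndep (Sum.elim (fun _ : Unit => MeasurableSpace.comap X₀ inferInstance)
    (Sum.elim (fun t : ℕ => MeasurableSpace.comap (W t) inferInstance)
      (fun t : ℕ => MeasurableSpace.comap (ξ t) inferInstance))) P
  memLp_X₀ : MemLp X₀ 2 P
  memLp_ξ : ∀ t, MemLp (ξ t) 2 P
  memLp_W : ∀ t, MemLp (W t) 2 P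
  identDistrib_ξ : ∀ t, IdentDistrib (ξ t) (ξ 0) P P
  identDistrib_W : ∀ t, IdentDistrib (W t) (W 0) P P

/-- `(X₀, (ξₜ), (Wₜ))` is Gaussian: all its coordinates together form a Gaussian family. -/
def IsJointlyGaussian {Ω : Type*} [MeasurableSpace Ω] (P : Measure Ω)
    (X₀ : Ω → g.X) (ξ : ℕ → Ω → g.Y) (W : ℕ → Ω → g.X) : Prop :=
  IsGaussianProcess (Sum.elim (fun (j : g.SIdx) ω => X₀ ω j)
    (Sum.elim (fun (q : ℕ × Fin g.ny) ω => ξ q.1 ω q.2)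
      (fun (q : ℕ × g.SIdx) ω => W q.1 ω q.2))) P

/-- The steady-state filtering Riccati equation
`Σ = 𝒜 (Σ - Σ 𝒟' (𝒟 Σ 𝒟' + cov[ξ₀])⁻¹ 𝒟 Σ) 𝒜' + cov[W₀]`. -/
def IsSteadyState (V : Matrix (Fin g.ny) (Fin g.ny) ℝ) (U : Matrix g.SIdx g.SIdx ℝ)
    (Sig : Matrix g.SIdx g.SIdx ℝ) : Prop :=
  Sig = g.Ac * (Sig - Sig * g.Dcᵀ * (g.Dc * Sig * g.Dcᵀ + V)⁻¹ * g.Dc * Sig) * g.Acᵀ + U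

end LQGame

end

set_option linter.unusedSectionVars false

noncomputable section

/-! ### Quadratic forms -/

section QuadraticForms

variable {n m : Type} [Fintype n] [Fintype m]

/-! All decision makers hold the same belief: the law ζ of the replica process ȳ. Two facts are
needed. The affine strategies built on an estimator mapping generate exactly this law, and each
affine decision is optimal against it.

Consistency. Evaluated on the replica's own past, an estimator mapping returns E[X̄ₜ | Ȳₜ₋₁], so the
replica obeys the closed-loop recursion path by path, with its own primitives. Equality in law of
the primitives then gives equality in law of the outputs (`IsReplica.map_eq_envLaw`).

Filtering. The feedback terms are known functions of past outputs, so the estimation error follows a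
linear recursion in the primitives alone (`errState`). With cov[X₀] = Σ and the steady-state gain,
its covariance remains Σ and it is uncorrelated with earlier innovations; Gaussianity turns this
into independence. Past outputs are functions of past innovations, so the filter state is the
conditional expectation (`isStateEstimator_filterMap`) and each innovation is centred and
independent of the past (`innovation_indepFun`). Because the replica feeds back its own conditional
expectation, these facts are established by a joint induction (`replica_filter_invariant`).

Optimality. Unique solvability of the mean system makes aₙ x + bₙ a time-consistent n-step
prediction (`SolvesMeanSystem.eq_pred`). The value function is x'Mx + 2p'x up to a term that is
independent of the own state, where the costate p is a Φ-weighted sum of predicted environment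
variables plus a constant. The costate recursion (`costate_step`) and the first-order condition
(`S_mulVec_decision`) allow the square to be completed: stage cost plus discounted next value equals
current value, plus the S-weighted square of the deviation from the affine decision, plus an
exogenous term, plus products of the own state and control with innovations and centred disturbances
(`stageCost_add_value`). Since decisions do not anticipate, these products vanish in expectation
(`IsResponse.integral_step`).

Infinite horizon. A competitor may be assumed to have a cost other than +∞. The negative parts of
the stage costs are dominated by discounted multiples of |z|², so the competitor's cost converges
absolutely; coercivity then makes its discounted second moments vanish. The costate has bounded
second moments because predictions do (`InnovationModel.exists_costate_bound`), so the terminal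
terms disappear in the limit and the affine cost is both finite and minimal
(`IsResponse.tsum_integral_le`).

Finally, two versions of the estimator agree ζ-almost everywhere, and ζ is also the law of the
generated outputs, so both optimality and the generated decisions carry over from the filter to
every version. -/

theorem transpose_mulVec_dotProduct (A : Matrix m n ℝ) (x : m → ℝ) (y : n → ℝ) :
    (Aᵀ *ᵥ x) ⬝ᵥ y = x ⬝ᵥ (A *ᵥ y) := by
  rw [Matrix.mulVec_transpose, Matrix.dotProduct_mulVec]

theorem Matrix.IsHermitian.transpose_eq {M : Matrix n n ℝ} (hM : M.IsHermitian) : Mᵀ = M := by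
  rw [← Matrix.conjTranspose_eq_transpose_of_trivial]
  exact hM

theorem dotProduct_mulVec_comm {M : Matrix n n ℝ} (hM : M.IsHermitian) (x y : n → ℝ) :
    x ⬝ᵥ (M *ᵥ y) = y ⬝ᵥ (M *ᵥ x) := by
  have h := hM.transpose_eq
  rw [← transpose_mulVec_dotProduct, h, dotProduct_comm]

theorem Matrix.PosSemidef.quadForm_nonneg {M : Matrix n n ℝ} (hM : M.PosSemidef) (x : n → ℝ) :
    0 ≤ x ⬝ᵥ (M *ᵥ x) := by
  simpa using hM.dotProduct_mulVec_nonneg x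

/-- A crude bound is enough: only the existence of some constant depending on `M` matters. -/
theorem abs_dotProduct_mulVec_le (M : Matrix n m ℝ) (x : n → ℝ) (y : m → ℝ) :
    |x ⬝ᵥ (M *ᵥ y)| ≤ (∑ i, ∑ j, |M i j|) * (x ⬝ᵥ x + y ⬝ᵥ y) := by
  simp only [dotProduct, Matrix.mulVec, Finset.mul_sum, Finset.sum_mul]
  refine (Finset.abs_sum_le_sum_abs _ _).trans (Finset.sum_le_sum fun i _ =>
    (Finset.abs_sum_le_sum_abs _ _).trans (Finset.sum_le_sum fun j _ => ?_))
  have h1 : x i * x i ≤ ∑ i, x i * x i :=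
    Finset.single_le_sum (f := fun i => x i * x i) (fun i _ => mul_self_nonneg _)
      (Finset.mem_univ i)
  have h2 : y j * y j ≤ ∑ j, y j * y j :=
    Finset.single_le_sum (f := fun j => y j * y j) (fun i _ => mul_self_nonneg _)
      (Finset.mem_univ j)
  rw [show x i * (M i j * y j) = M i j * (x i * y j) by ring, abs_mul]
  refine mul_le_mul_of_nonneg_left ?_ (abs_nonneg _)
  rw [abs_le]
  constructor <;> nlinarith [sq_nonneg (x i + y j), sq_nonneg (x i - y j), mul_self_nonneg (x i),
    mul_self_nonneg (y j)]

theorem dotProduct_self_le_card (x : n → ℝ) : x ⬝ᵥ x ≤ Fintype.card n * ‖x‖ ^ 2 := by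
  calc x ⬝ᵥ x ≤ ∑ _i : n, ‖x‖ ^ 2 := by
        refine Finset.sum_le_sum fun i _ => ?_
        rw [← sq, ← sq_abs]
        exact pow_le_pow_left₀ (abs_nonneg _) (norm_le_pi_norm x i) 2
    _ = _ := by simp

theorem dotProduct_self_nonneg' (x : n → ℝ) : 0 ≤ x ⬝ᵥ x :=
  Finset.sum_nonneg fun _ _ => mul_self_nonneg _

theorem sq_le_dotProduct_self (x : n → ℝ) (i : n) : x i ^ 2 ≤ x ⬝ᵥ x := by
  rw [sq]
  exact Finset.single_le_sum (f := fun i => x i * x i) (fun i _ => mul_self_nonneg _)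
    (Finset.mem_univ i)

/-- A positive continuous function has a positive minimum on the compact unit sphere, and
homogeneity extends the bound. The sphere is that of the sup norm, hence the final conversion. -/
theorem Matrix.PosDef.exists_pos_le_quadForm {Q : Matrix n n ℝ} (hQ : Q.PosDef) :
    ∃ l : ℝ, 0 < l ∧ ∀ x : n → ℝ, l * (x ⬝ᵥ x) ≤ x ⬝ᵥ (Q *ᵥ x) := by
  have key : ∃ l : ℝ, 0 < l ∧ ∀ x : n → ℝ, l * ‖x‖ ^ 2 ≤ x ⬝ᵥ (Q *ᵥ x) := by
    have hcont : Continuous fun x : n → ℝ => x ⬝ᵥ (Q *ᵥ x) := by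
      unfold dotProduct Matrix.mulVec dotProduct
      fun_prop
    rcases isEmpty_or_nonempty n with h | h
    · exact ⟨1, one_pos, fun x => by simp [Subsingleton.elim x 0]⟩
    · obtain ⟨x₀, hx₀, hmin⟩ := (isCompact_sphere (0 : n → ℝ) 1).exists_isMinOn
        (NormedSpace.sphere_nonempty.2 zero_le_one) hcont.continuousOn
      have hx₀' : x₀ ≠ 0 := by
        rintro rfl
        simp at hx₀
      refine ⟨_, by simpa using hQ.dotProduct_mulVec_pos hx₀', fun x => ?_⟩
      rcases eq_or_ne x 0 with rfl | hx
      · simp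
      · have hn : ‖x‖ ≠ 0 := norm_ne_zero_iff.2 hx
        have h1 : ‖x‖⁻¹ • x ∈ Metric.sphere (0 : n → ℝ) 1 := by
          simp [norm_smul, hn]
        have h2 : x₀ ⬝ᵥ (Q *ᵥ x₀) ≤ (‖x‖⁻¹ • x) ⬝ᵥ (Q *ᵥ (‖x‖⁻¹ • x)) := hmin h1
        rw [Matrix.mulVec_smul, smul_dotProduct, dotProduct_smul, smul_eq_mul, smul_eq_mul] at h2
        have h3 := mul_le_mul_of_nonneg_right h2 (sq_nonneg ‖x‖)
        refine h3.trans (le_of_eq ?_)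
        field_simp
  obtain ⟨l, hl, h⟩ := key
  -- `card n` converts the squared sup norm into `x ⬝ᵥ x`; the `+ 1` keeps the denominator positive
  -- in dimension zero.
  refine ⟨l / (Fintype.card n + 1), by positivity, fun x => le_trans ?_ (h x)⟩
  rw [div_mul_eq_mul_div, div_le_iff₀ (by positivity), mul_assoc]
  refine mul_le_mul_of_nonneg_left ?_ hl.le
  nlinarith [dotProduct_self_le_card x, sq_nonneg ‖x‖]

theorem IsStableMatrix.tendsto_mulVec [DecidableEq n] {A : Matrix n n ℝ} (h : IsStableMatrix A)
    (x : n → ℝ) : Tendsto (fun k : ℕ => A ^ k *ᵥ x) atTop (𝓝 0) := by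
  have h1 : Continuous fun M : Matrix n n ℝ => M *ᵥ x :=
    Continuous.matrix_mulVec continuous_id continuous_const
  simpa [Function.comp_def] using (h1.tendsto 0).comp h

end QuadraticForms

/-! ### The discounted Riccati equation -/

section Riccati

variable {n m : Type} [Fintype n] [DecidableEq n] [Fintype m] [DecidableEq m]
  (β : ℝ) (A : Matrix n n ℝ) (B : Matrix n m ℝ) (Q : Matrix n n ℝ) (R : Matrix m m ℝ)

/-- Right-hand side of the discounted Riccati equation. -/
def riccatiMap (M : Matrix n n ℝ) : Matrix n n ℝ :=
  Q + β • (Aᵀ * (M - β • (M * B * (R + β • (Bᵀ * M * B))⁻¹ * Bᵀ * M)) * A)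

/-- The optimal one-step feedback gain for the terminal cost `M`. -/
def riccatiGain (M : Matrix n n ℝ) : Matrix m n ℝ :=
  -(β • ((R + β • (Bᵀ * M * B))⁻¹ * Bᵀ * M * A))

/-- Cost after one step of the feedback `F` followed by the terminal cost `M`. -/
def policyMap (F : Matrix m n ℝ) (M : Matrix n n ℝ) : Matrix n n ℝ :=
  Q + Fᵀ * R * F + β • ((A + B * F)ᵀ * M * (A + B * F))

variable {β A B Q R}

theorem posDef_riccatiWeight (hβ : 0 ≤ β) (hR : R.PosDef) {M : Matrix n n ℝ}
    (hM : M.PosSemidef) : (R + β • (Bᵀ * M * B)).PosDef :=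
  hR.add_posSemidef ((by simpa using hM.conjTranspose_mul_mul_same B :
    (Bᵀ * M * B).PosSemidef).smul hβ)

theorem riccatiWeight_mul_gain (hβ : 0 ≤ β) (hR : R.PosDef) {M : Matrix n n ℝ}
    (hM : M.PosSemidef) :
    (R + β • (Bᵀ * M * B)) * riccatiGain β A B R M = -(β • (Bᵀ * M * A)) := by
  have hu := (Matrix.isUnit_iff_isUnit_det _).1 (posDef_riccatiWeight (B := B) hβ hR hM).isUnit
  rw [riccatiGain, Matrix.mul_neg, Matrix.mul_smul]
  generalize R + β • (Bᵀ * M * B) = T at hu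
  simp only [Matrix.mul_assoc]
  rw [Matrix.mul_nonsing_inv_cancel_left _ _ hu]

/-- Completing the square in the feedback: any `F` costs more than the optimal gain by a square
weighted with a positive definite matrix. The Riccati map is therefore the pointwise minimum of the
policy maps, which is the source of its monotonicity and of the upper bounds on value iteration. -/
theorem policyMap_eq (hβ : 0 ≤ β) (hR : R.PosDef) {M : Matrix n n ℝ} (hM : M.PosSemidef)
    (F : Matrix m n ℝ) :
    policyMap β A B Q R F M = riccatiMap β A B Q R M +
      (F - riccatiGain β A B R M)ᵀ * (R + β • (Bᵀ * M * B)) * (F - riccatiGain β A B R M) := by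
  have hS := posDef_riccatiWeight (B := B) hβ hR hM
  have h1 := riccatiWeight_mul_gain (A := A) (B := B) hβ hR hM
  have hST : (R + β • (Bᵀ * M * B))ᵀ = R + β • (Bᵀ * M * B) := hS.1.transpose_eq
  have hMT : Mᵀ = M := hM.1.transpose_eq
  have h2 : (riccatiGain β A B R M)ᵀ * (R + β • (Bᵀ * M * B)) = -(β • (Aᵀ * M * B)) := by
    have := congrArg Matrix.transpose h1
    rw [Matrix.transpose_mul, hST] at this
    rw [this]
    simp [Matrix.transpose_mul, hMT, Matrix.mul_assoc]
  have h3 : (riccatiGain β A B R M)ᵀ * (R + β • (Bᵀ * M * B)) * riccatiGain β A B R M =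
      β • (β • (Aᵀ * (M * (B * ((R + β • (Bᵀ * M * B))⁻¹ * (Bᵀ * (M * A))))))) := by
    rw [h2]
    simp only [riccatiGain, Matrix.mul_assoc, Matrix.neg_mul, Matrix.mul_neg, Matrix.smul_mul,
      Matrix.mul_smul, smul_neg, neg_neg]
  have h4 : (F - riccatiGain β A B R M)ᵀ * (R + β • (Bᵀ * M * B)) * (F - riccatiGain β A B R M) =
      Fᵀ * (R + β • (Bᵀ * M * B)) * F + β • (Fᵀ * (Bᵀ * M * A)) + β • (Aᵀ * M * B * F)
        + β • (β • (Aᵀ * (M * (B * ((R + β • (Bᵀ * M * B))⁻¹ * (Bᵀ * (M * A))))))) := by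
    rw [Matrix.transpose_sub, Matrix.sub_mul, Matrix.mul_sub, Matrix.sub_mul, Matrix.sub_mul,
      h3, h2, Matrix.mul_assoc Fᵀ _ (riccatiGain β A B R M), h1]
    simp only [Matrix.mul_neg, Matrix.neg_mul, Matrix.mul_smul, Matrix.smul_mul]
    abel
  rw [h4, policyMap, riccatiMap]
  generalize (R + β • (Bᵀ * M * B))⁻¹ = T
  simp only [Matrix.transpose_add, Matrix.transpose_mul, Matrix.add_mul, Matrix.mul_add,
    Matrix.mul_sub, Matrix.sub_mul, Matrix.mul_smul, Matrix.smul_mul, Matrix.mul_assoc, smul_add,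
    smul_sub]
  abel

theorem riccatiMap_eq_policyMap (hβ : 0 ≤ β) (hR : R.PosDef) {M : Matrix n n ℝ}
    (hM : M.PosSemidef) :
    riccatiMap β A B Q R M = policyMap β A B Q R (riccatiGain β A B R M) M := by
  simp [policyMap_eq hβ hR hM]

theorem posSemidef_policyMap (hβ : 0 ≤ β) (hQ : Q.PosSemidef) (hR : R.PosSemidef)
    {M : Matrix n n ℝ} (hM : M.PosSemidef) (F : Matrix m n ℝ) :
    (policyMap β A B Q R F M).PosSemidef := by
  have h1 : (Fᵀ * R * F).PosSemidef := by simpa using hR.conjTranspose_mul_mul_same F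
  have h2 : ((A + B * F)ᵀ * M * (A + B * F)).PosSemidef := by
    simpa using hM.conjTranspose_mul_mul_same (A + B * F)
  exact (hQ.add h1).add (h2.smul hβ)

theorem policyMap_quadForm (F : Matrix m n ℝ) (M : Matrix n n ℝ) (x : n → ℝ) :
    x ⬝ᵥ (policyMap β A B Q R F M *ᵥ x) = x ⬝ᵥ ((Q + Fᵀ * R * F) *ᵥ x)
      + β * (((A + B * F) *ᵥ x) ⬝ᵥ (M *ᵥ ((A + B * F) *ᵥ x))) := by
  rw [policyMap, Matrix.add_mulVec, dotProduct_add, Matrix.smul_mulVec, dotProduct_smul,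
    smul_eq_mul, ← Matrix.mulVec_mulVec, ← Matrix.mulVec_mulVec]
  congr 2
  rw [dotProduct_comm, transpose_mulVec_dotProduct, dotProduct_comm]

theorem riccatiMap_quadForm_le (hβ : 0 ≤ β) (hR : R.PosDef) {M : Matrix n n ℝ}
    (hM : M.PosSemidef) (F : Matrix m n ℝ) (x : n → ℝ) :
    x ⬝ᵥ (riccatiMap β A B Q R M *ᵥ x) ≤ x ⬝ᵥ (policyMap β A B Q R F M *ᵥ x) := by
  rw [policyMap_eq hβ hR hM F, Matrix.add_mulVec, dotProduct_add]
  have h : ((F - riccatiGain β A B R M)ᵀ * (R + β • (Bᵀ * M * B)) *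
      (F - riccatiGain β A B R M)).PosSemidef := by
    simpa using (posDef_riccatiWeight (B := B) hβ hR hM).posSemidef.conjTranspose_mul_mul_same
      (F - riccatiGain β A B R M)
  linarith [h.quadForm_nonneg x]

theorem posSemidef_riccatiMap (hβ : 0 ≤ β) (hQ : Q.PosSemidef) (hR : R.PosDef)
    {M : Matrix n n ℝ} (hM : M.PosSemidef) : (riccatiMap β A B Q R M).PosSemidef := by
  rw [riccatiMap_eq_policyMap hβ hR hM]
  exact posSemidef_policyMap hβ hQ hR.posSemidef hM _

/-- A minimum of monotone maps is monotone: the gain that is optimal for `N` is a candidate for `M`.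
-/
theorem riccatiMap_mono (hβ : 0 ≤ β) (hR : R.PosDef) {M N : Matrix n n ℝ}
    (hM : M.PosSemidef) (hN : N.PosSemidef)
    (h : ∀ x : n → ℝ, x ⬝ᵥ (M *ᵥ x) ≤ x ⬝ᵥ (N *ᵥ x)) (x : n → ℝ) :
    x ⬝ᵥ (riccatiMap β A B Q R M *ᵥ x) ≤ x ⬝ᵥ (riccatiMap β A B Q R N *ᵥ x) := by
  refine (riccatiMap_quadForm_le hβ hR hM (riccatiGain β A B R N) x).trans ?_
  rw [riccatiMap_eq_policyMap hβ hR hN, policyMap_quadForm, policyMap_quadForm]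
  gcongr
  exact h _

variable (β A B Q R) in
/-- Value iteration for the discounted linear-quadratic regulator. -/
def valueIter (k : ℕ) : Matrix n n ℝ := (riccatiMap β A B Q R)^[k] 0

theorem valueIter_succ (k : ℕ) :
    valueIter β A B Q R (k + 1) = riccatiMap β A B Q R (valueIter β A B Q R k) := by
  rw [valueIter, Function.iterate_succ_apply', valueIter]

theorem posSemidef_valueIter (hβ : 0 ≤ β) (hQ : Q.PosSemidef) (hR : R.PosDef) (k : ℕ) :
    (valueIter β A B Q R k).PosSemidef := by
  induction k with
  | zero => exact Matrix.PosSemidef.zero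
  | succ k ih =>
    rw [valueIter_succ]
    exact posSemidef_riccatiMap hβ hQ hR ih

theorem valueIter_quadForm_mono (hβ : 0 ≤ β) (hQ : Q.PosSemidef) (hR : R.PosDef) (x : n → ℝ) :
    Monotone fun k => x ⬝ᵥ (valueIter β A B Q R k *ᵥ x) := by
  refine monotone_nat_of_le_succ fun k => ?_
  induction k generalizing x with
  | zero =>
    have h := (posSemidef_valueIter (A := A) (B := B) hβ hQ hR 1).quadForm_nonneg x
    simpa [valueIter] using h
  | succ k ih =>
    rw [valueIter_succ, valueIter_succ (k + 1)]
    exact riccatiMap_mono hβ hR (posSemidef_valueIter hβ hQ hR k)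
      (posSemidef_valueIter hβ hQ hR (k + 1)) ih x

/-- Value iteration costs no more than applying one fixed feedback for `k` steps. A stabilizing
feedback then makes the bound uniform in `k`. -/
theorem valueIter_quadForm_le_sum (hβ : 0 ≤ β) (hQ : Q.PosSemidef) (hR : R.PosDef)
    (F : Matrix m n ℝ) (k : ℕ) (x : n → ℝ) :
    x ⬝ᵥ (valueIter β A B Q R k *ᵥ x) ≤ ∑ j ∈ Finset.range k, β ^ j *
      (((A + B * F) ^ j *ᵥ x) ⬝ᵥ ((Q + Fᵀ * R * F) *ᵥ ((A + B * F) ^ j *ᵥ x))) := by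
  induction k generalizing x with
  | zero => simp [valueIter]
  | succ k ih =>
    rw [valueIter_succ, Finset.sum_range_succ']
    refine (riccatiMap_quadForm_le hβ hR (posSemidef_valueIter hβ hQ hR k) F x).trans ?_
    rw [policyMap_quadForm, add_comm]
    refine add_le_add ?_ (by simp)
    refine (mul_le_mul_of_nonneg_left (ih ((A + B * F) *ᵥ x)) hβ).trans (le_of_eq ?_)
    rw [Finset.mul_sum]
    refine Finset.sum_congr rfl fun j _ => ?_
    rw [Matrix.mulVec_mulVec, ← pow_succ, pow_succ' β, mul_assoc]

theorem valueIter_quadForm_bdd (hβ : 0 ≤ β) (hβ1 : β < 1) (hQ : Q.PosSemidef) (hR : R.PosDef)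
    (hstab : IsStabilizable A B) (x : n → ℝ) :
    BddAbove (Set.range fun k => x ⬝ᵥ (valueIter β A B Q R k *ᵥ x)) := by
  obtain ⟨F, hF⟩ := hstab
  have hcont : Continuous fun x : n → ℝ => x ⬝ᵥ ((Q + Fᵀ * R * F) *ᵥ x) := by
    unfold dotProduct Matrix.mulVec dotProduct
    fun_prop
  obtain ⟨c, hc⟩ := ((hcont.tendsto 0).comp (hF.tendsto_mulVec x)).bddAbove_range
  have hc' : ∀ j, ((A + B * F) ^ j *ᵥ x) ⬝ᵥ ((Q + Fᵀ * R * F) *ᵥ ((A + B * F) ^ j *ᵥ x)) ≤ c :=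
    fun j => hc ⟨j, rfl⟩
  have hpsd : (Q + Fᵀ * R * F).PosSemidef :=
    hQ.add (by simpa using hR.posSemidef.conjTranspose_mul_mul_same F)
  have hc0 : 0 ≤ c := (hpsd.quadForm_nonneg _).trans (hc' 0)
  refine ⟨(1 - β)⁻¹ * c, ?_⟩
  rintro _ ⟨k, rfl⟩
  refine (valueIter_quadForm_le_sum hβ hQ hR F k x).trans ?_
  calc _ ≤ ∑ j ∈ Finset.range k, β ^ j * c :=
        Finset.sum_le_sum fun j _ => mul_le_mul_of_nonneg_left (hc' j) (pow_nonneg hβ j)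
    _ = (∑ j ∈ Finset.range k, β ^ j) * c := by rw [Finset.sum_mul]
    _ ≤ _ := by
        refine mul_le_mul_of_nonneg_right ?_ hc0
        rw [← tsum_geometric_of_lt_one hβ hβ1]
        exact (summable_geometric_of_lt_one hβ hβ1).sum_le_tsum _ fun j _ => pow_nonneg hβ j

/-- Polarization passes from the monotone convergence of each quadratic form to the convergence of
the matrix entries. -/
theorem polarization_entry {M : Matrix n n ℝ} (hM : M.IsHermitian) (i j : n) :
    M i j = ((Pi.single i 1 + Pi.single j 1 : n → ℝ) ⬝ᵥ (M *ᵥ (Pi.single i 1 + Pi.single j 1))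
      - (Pi.single i 1 : n → ℝ) ⬝ᵥ (M *ᵥ Pi.single i 1)
      - (Pi.single j 1 : n → ℝ) ⬝ᵥ (M *ᵥ Pi.single j 1)) / 2 := by
  have h : M j i = M i j := by simpa using hM.apply i j
  simp [Matrix.mulVec_add, h]
  ring

/-- Value iteration from `0` increases by monotonicity and is bounded by the discounted cost of a
stabilizing feedback. Its limit is positive semidefinite, so the matrix to be inverted is positive
definite there; the Riccati map is continuous at the limit, which is thus a fixed point. -/
theorem exists_riccatiSolution (hβ : 0 ≤ β) (hβ1 : β < 1) (hQ : Q.PosSemidef) (hR : R.PosDef)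
    (hstab : IsStabilizable A B) :
    ∃ M : Matrix n n ℝ, M.PosSemidef ∧ IsRiccatiSolution β A B Q R M := by
  have hlim : ∀ x : n → ℝ, ∃ l, Tendsto (fun k => x ⬝ᵥ (valueIter β A B Q R k *ᵥ x)) atTop (𝓝 l) :=
    fun x => ⟨_, tendsto_atTop_ciSup (valueIter_quadForm_mono hβ hQ hR x)
      (valueIter_quadForm_bdd hβ hβ1 hQ hR hstab x)⟩
  choose l hl using hlim
  have hentry : ∀ i j, ∃ c, Tendsto (fun k => valueIter β A B Q R k i j) atTop (𝓝 c) := by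
    intro i j
    refine ⟨_, Tendsto.congr (fun k => (polarization_entry
      (posSemidef_valueIter hβ hQ hR k).1 i j).symm)
      ((((hl _).sub (hl _)).sub (hl _)).div_const 2)⟩
  choose c hc using hentry
  have hM : Tendsto (valueIter β A B Q R) atTop (𝓝 (Matrix.of c)) :=
    tendsto_pi_nhds.2 fun i => tendsto_pi_nhds.2 fun j => hc i j
  have hpsd : (Matrix.of c).PosSemidef := by
    refine Matrix.PosSemidef.of_dotProduct_mulVec_nonneg ?_ fun x => ?_
    · refine Matrix.IsHermitian.ext fun i j => tendsto_nhds_unique ?_ (hc i j)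
      refine (hc j i).congr fun k => ?_
      simpa using (posSemidef_valueIter (A := A) (B := B) hβ hQ hR k).1.apply i j
    · have hcont : Continuous fun M : Matrix n n ℝ => star x ⬝ᵥ (M *ᵥ x) := by
        unfold dotProduct Matrix.mulVec dotProduct
        fun_prop
      refine ge_of_tendsto' ((hcont.tendsto _).comp hM) fun k => ?_
      simpa using (posSemidef_valueIter (A := A) (B := B) hβ hQ hR k).quadForm_nonneg x
  refine ⟨Matrix.of c, hpsd, ?_⟩
  have hcontAt : ContinuousAt (riccatiMap β A B Q R) (Matrix.of c) := by
    have hSc : Continuous fun M : Matrix n n ℝ => R + β • (Bᵀ * M * B) := by fun_prop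
    have hu := (Matrix.isUnit_iff_isUnit_det _).1
      (posDef_riccatiWeight (B := B) hβ hR hpsd).isUnit
    have hinv : ContinuousAt (fun M : Matrix n n ℝ => (R + β • (Bᵀ * M * B))⁻¹) (Matrix.of c) :=
      ContinuousAt.comp (g := fun S : Matrix m m ℝ => S⁻¹)
        (continuousAt_matrix_inv _ (NormedRing.inverse_continuousAt hu.unit)) hSc.continuousAt
    unfold riccatiMap
    have hid : ContinuousAt (fun M : Matrix n n ℝ => M) (Matrix.of c) := continuousAt_id
    have hmul : ∀ {p q r : Type} [Fintype q] {f : Matrix n n ℝ → Matrix p q ℝ}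
        {g : Matrix n n ℝ → Matrix q r ℝ}, ContinuousAt f (Matrix.of c) →
        ContinuousAt g (Matrix.of c) → ContinuousAt (fun M => f M * g M) (Matrix.of c) := by
      intro p q r _ f g hf hg
      exact (Continuous.matrix_mul continuous_fst continuous_snd).continuousAt.comp
        (hf.prodMk hg)
    have e1 := hmul (hmul (hmul (hmul hid (g := fun _ => B) continuousAt_const) hinv)
      (g := fun _ => Bᵀ) continuousAt_const) hid
    exact continuousAt_const.add ((hmul (hmul (f := fun _ => Aᵀ) continuousAt_const
      (hid.sub (e1.const_smul β))) (g := fun _ => A) continuousAt_const).const_smul β)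
  have h1 : Tendsto (fun k => valueIter β A B Q R (k + 1)) atTop (𝓝 (Matrix.of c)) :=
    (tendsto_add_atTop_iff_nat 1).2 hM
  have h2 : Tendsto (fun k => valueIter β A B Q R (k + 1)) atTop
      (𝓝 (riccatiMap β A B Q R (Matrix.of c))) := by
    simp only [valueIter_succ]
    exact hcontAt.tendsto.comp hM
  exact tendsto_nhds_unique h1 h2

theorem riccatiSol_spec (hβ : 0 ≤ β) (hβ1 : β < 1) (hQ : Q.PosSemidef) (hR : R.PosDef)
    (hstab : IsStabilizable A B) :
    (riccatiSol β A B Q R).PosSemidef ∧ IsRiccatiSolution β A B Q R (riccatiSol β A B Q R) :=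
  Classical.epsilon_spec (exists_riccatiSolution hβ hβ1 hQ hR hstab)

/-- The closed loop of the discounted regulator decays geometrically. -/
theorem exists_geometric_bound (hβ : 0 ≤ β) (hβ1 : β < 1) (hQ : Q.PosDef)
    (hR : R.PosSemidef) {M : Matrix n n ℝ} (hM : M.PosSemidef) {F : Matrix m n ℝ}
    (hfix : M = policyMap β A B Q R F M) :
    ∃ c r : ℝ, 0 ≤ r ∧ r < 1 ∧ ∀ (k : ℕ) (i j : n), |((β • (A + B * F)ᵀ) ^ k) i j| ≤ c * r ^ k := by
  have hlyap : ∀ x : n → ℝ, x ⬝ᵥ (M *ᵥ x) = x ⬝ᵥ (Q *ᵥ x) + (F *ᵥ x) ⬝ᵥ (R *ᵥ (F *ᵥ x))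
      + β * (((A + B * F) *ᵥ x) ⬝ᵥ (M *ᵥ ((A + B * F) *ᵥ x))) := by
    intro x
    conv_lhs => rw [hfix]
    rw [policyMap_quadForm, Matrix.add_mulVec, dotProduct_add]
    congr 2
    rw [← Matrix.mulVec_mulVec, ← Matrix.mulVec_mulVec, dotProduct_comm,
      transpose_mulVec_dotProduct, dotProduct_comm]
  obtain ⟨l, hl, hQl⟩ := hQ.exists_pos_le_quadForm
  have hQM : ∀ x : n → ℝ, x ⬝ᵥ (Q *ᵥ x) + β * (((A + B * F) *ᵥ x) ⬝ᵥ (M *ᵥ ((A + B * F) *ᵥ x)))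
      ≤ x ⬝ᵥ (M *ᵥ x) := fun x => by
    rw [hlyap x]
    linarith [hR.quadForm_nonneg (F *ᵥ x)]
  have hMl : ∀ x : n → ℝ, l * (x ⬝ᵥ x) ≤ x ⬝ᵥ (M *ᵥ x) := fun x => by
    have := hQM x
    have h2 := mul_nonneg hβ (hM.quadForm_nonneg ((A + B * F) *ᵥ x))
    linarith [hQl x]
  -- The form of `M` lies between `l` and `c` times `x ⬝ᵥ x`. Adding `l` guarantees `0 < l ≤ c`, so
  -- that `q = 1 - l / c` is in `[0, 1)`.
  set c : ℝ := 2 * (∑ i, ∑ j, |M i j|) + l with hcdef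
  have hcl : l ≤ c := by
    have : 0 ≤ ∑ i, ∑ j, |M i j| :=
      Finset.sum_nonneg fun i _ => Finset.sum_nonneg fun j _ => abs_nonneg _
    linarith
  have hc : 0 < c := hl.trans_le hcl
  have hMc : ∀ x : n → ℝ, x ⬝ᵥ (M *ᵥ x) ≤ c * (x ⬝ᵥ x) := fun x => by
    have := (abs_le.1 (abs_dotProduct_mulVec_le M x x)).2
    nlinarith [dotProduct_self_nonneg' x]
  set q : ℝ := 1 - l / c
  have hq0 : 0 ≤ q := by
    have : l / c ≤ 1 := (div_le_one hc).2 hcl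
    linarith
  have hq1 : q < 1 := by
    have : 0 < l / c := by positivity
    linarith
  -- The form of `M` is a Lyapunov function: the Riccati equation accounts for one factor `β`, and
  -- the second is dropped because `β ≤ 1`.
  have hstep : ∀ x : n → ℝ, ((β • (A + B * F)) *ᵥ x) ⬝ᵥ (M *ᵥ ((β • (A + B * F)) *ᵥ x))
      ≤ q * (x ⬝ᵥ (M *ᵥ x)) := by
    intro x
    have h1 : x ⬝ᵥ (M *ᵥ x) * (l / c) ≤ x ⬝ᵥ (Q *ᵥ x) := by
      refine le_trans ?_ (hQl x)
      rw [mul_div_assoc', div_le_iff₀ hc]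
      nlinarith [hMc x]
    have h2 := hQM x
    have h3 := mul_nonneg hβ (hM.quadForm_nonneg ((A + B * F) *ᵥ x))
    rw [Matrix.smul_mulVec, Matrix.mulVec_smul, smul_dotProduct, dotProduct_smul, smul_eq_mul,
      smul_eq_mul]
    have h4 : β * (β * (((A + B * F) *ᵥ x) ⬝ᵥ (M *ᵥ ((A + B * F) *ᵥ x)))) ≤
        β * (((A + B * F) *ᵥ x) ⬝ᵥ (M *ᵥ ((A + B * F) *ᵥ x))) :=
      mul_le_of_le_one_left h3 hβ1.le
    have h5 : q * (x ⬝ᵥ (M *ᵥ x)) = x ⬝ᵥ (M *ᵥ x) - x ⬝ᵥ (M *ᵥ x) * (l / c) := by ring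
    linarith
  have hpow : ∀ (k : ℕ) (x : n → ℝ), ((β • (A + B * F)) ^ k *ᵥ x) ⬝ᵥ
      (M *ᵥ ((β • (A + B * F)) ^ k *ᵥ x)) ≤ q ^ k * (x ⬝ᵥ (M *ᵥ x)) := by
    intro k x
    induction k with
    | zero => simp
    | succ k ih =>
      rw [pow_succ', ← Matrix.mulVec_mulVec]
      refine (hstep _).trans ?_
      rw [pow_succ', mul_assoc]
      exact mul_le_mul_of_nonneg_left ih hq0
  refine ⟨√(c / l), √q, Real.sqrt_nonneg _, (Real.sqrt_lt' one_pos).2 (by simpa using hq1),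
    fun k i j => ?_⟩
  have e1 : ((β • (A + B * F)ᵀ) ^ k) i j = ((β • (A + B * F)) ^ k *ᵥ Pi.single i 1) j := by
    rw [← Matrix.transpose_smul, ← Matrix.transpose_pow]
    simp
  have h1 := hpow k (Pi.single i 1)
  have h2 := hMl ((β • (A + B * F)) ^ k *ᵥ Pi.single i 1)
  have h3 := sq_le_dotProduct_self ((β • (A + B * F)) ^ k *ᵥ Pi.single i 1) j
  have h4 := hMc (Pi.single i 1)
  have h5 : (Pi.single i 1 : n → ℝ) ⬝ᵥ Pi.single i 1 = 1 := by simp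
  rw [h5, mul_one] at h4
  rw [e1]
  refine Real.abs_le_sqrt (y := c / l * q ^ k) ?_ |>.trans (le_of_eq ?_)
  · rw [div_mul_eq_mul_div, le_div_iff₀ hl]
    have h6 : q ^ k * ((Pi.single i 1 : n → ℝ) ⬝ᵥ (M *ᵥ Pi.single i 1)) ≤ q ^ k * c :=
      mul_le_mul_of_nonneg_left h4 (pow_nonneg hq0 k)
    nlinarith
  · rw [Real.sqrt_mul (by positivity)]
    congr 1
    rw [Real.sqrt_eq_iff_mul_self_eq (by positivity) (by positivity), ← mul_pow,
      Real.mul_self_sqrt hq0]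

end Riccati


/-! ### Entrywise absolutely summable sequences of matrices -/

section EntrySummable

variable {l m n p : Type}

/-- All entries are absolutely summable. -/
def EntrySummable (f : ℕ → Matrix m n ℝ) : Prop := ∀ i j, Summable fun k => |f k i j|

theorem EntrySummable.mul_left [Fintype m] {f : ℕ → Matrix m n ℝ} (hf : EntrySummable f)
    (A : Matrix l m ℝ) : EntrySummable fun k => A * f k := by
  intro i j
  refine Summable.of_nonneg_of_le (fun _ => abs_nonneg _) (fun k => ?_)
    (summable_sum fun s (_ : s ∈ Finset.univ) => (hf s j).mul_left |A i s|)
  change |(A * f k) i j| ≤ _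
  rw [Matrix.mul_apply]
  exact (Finset.abs_sum_le_sum_abs _ _).trans (Finset.sum_le_sum fun s _ => (abs_mul _ _).le)

theorem EntrySummable.transpose {f : ℕ → Matrix m n ℝ} (hf : EntrySummable f) :
    EntrySummable fun k => (f k)ᵀ := fun i j => hf j i

theorem EntrySummable.mul_right [Fintype n] {f : ℕ → Matrix m n ℝ} (hf : EntrySummable f)
    (A : Matrix n p ℝ) : EntrySummable fun k => f k * A := by
  simpa [Matrix.transpose_mul] using (hf.transpose.mul_left Aᵀ).transpose

theorem EntrySummable.neg {f : ℕ → Matrix m n ℝ} (hf : EntrySummable f) :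
    EntrySummable fun k => -f k := fun i j => by simpa using hf i j

theorem EntrySummable.smul {f : ℕ → Matrix m n ℝ} (hf : EntrySummable f) (c : ℝ) :
    EntrySummable fun k => c • f k := fun i j => by
  simpa [abs_mul] using (hf i j).mul_left |c|

theorem EntrySummable.sum {ι : Type*} [Fintype ι] {f : ι → ℕ → Matrix m n ℝ}
    (hf : ∀ s, EntrySummable (f s)) : EntrySummable fun k => ∑ s, f s k := by
  intro i j
  refine Summable.of_nonneg_of_le (fun _ => abs_nonneg _) (fun k => ?_)
    (summable_sum fun s (_ : s ∈ Finset.univ) => hf s i j)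
  change |(∑ s, f s k) i j| ≤ _
  rw [Matrix.sum_apply]
  exact Finset.abs_sum_le_sum_abs _ _

theorem EntrySummable.of_succ {f : ℕ → Matrix m n ℝ} (hf : EntrySummable fun k => f (k + 1)) :
    EntrySummable f := fun i j => (summable_nat_add_iff 1).1 (hf i j)

theorem EntrySummable.of_geometric {f : ℕ → Matrix m n ℝ} {c r : ℝ} (hr : 0 ≤ r) (hr1 : r < 1)
    (h : ∀ k i j, |f k i j| ≤ c * r ^ k) : EntrySummable f := fun i j =>
  Summable.of_nonneg_of_le (fun _ => abs_nonneg _) (fun k => h k i j)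
    ((summable_geometric_of_lt_one hr hr1).mul_left c)

theorem EntrySummable.mul_bounded [Fintype n] {f : ℕ → Matrix m n ℝ} (hf : EntrySummable f)
    {a : ℕ → Matrix n p ℝ} (ha : ∃ c : ℝ, ∀ t j k, |a t j k| ≤ c) :
    EntrySummable fun k => f k * a k := by
  obtain ⟨c, hc⟩ := ha
  intro i j
  refine Summable.of_nonneg_of_le (fun _ => abs_nonneg _) (fun k => ?_)
    (summable_sum fun s (_ : s ∈ Finset.univ) => (hf i s).mul_right c)
  change |(f k * a k) i j| ≤ _
  rw [Matrix.mul_apply]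
  refine (Finset.abs_sum_le_sum_abs _ _).trans (Finset.sum_le_sum fun s _ => ?_)
  rw [abs_mul]
  exact mul_le_mul_of_nonneg_left (hc k s j) (abs_nonneg _)

theorem EntrySummable.summable {f : ℕ → Matrix m n ℝ} (hf : EntrySummable f) : Summable f :=
  Pi.summable.2 fun i => Pi.summable.2 fun j => (hf i j).of_abs

theorem EntrySummable.summable_mulVec [Fintype n] {f : ℕ → Matrix m n ℝ} (hf : EntrySummable f)
    {b : ℕ → n → ℝ} (hb : ∃ c : ℝ, ∀ t j, |b t j| ≤ c) : Summable fun k => f k *ᵥ b k := by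
  have h := (hf.mul_bounded (a := fun k => Matrix.of fun j (_ : Unit) => b k j)
    (hb.imp fun c hc t j _ => hc t j))
  exact Pi.summable.2 fun i => (h i ()).of_abs

theorem HasSum.matrix_mulVec [Fintype n] {f : ℕ → Matrix m n ℝ} {s : Matrix m n ℝ}
    (hf : HasSum f s) (x : n → ℝ) : HasSum (fun k => f k *ᵥ x) (s *ᵥ x) :=
  hf.map (AddMonoidHom.mk' (fun M : Matrix m n ℝ => M *ᵥ x)
    fun A B => Matrix.add_mulVec A B x) (Continuous.matrix_mulVec continuous_id continuous_const)

theorem HasSum.mulVec_left [Fintype n] {f : ℕ → n → ℝ} {s : n → ℝ}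
    (hf : HasSum f s) (A : Matrix m n ℝ) : HasSum (fun k => A *ᵥ f k) (A *ᵥ s) :=
  hf.map (AddMonoidHom.mk' (fun v : n → ℝ => A *ᵥ v)
    fun v w => Matrix.mulVec_add A v w) (Continuous.matrix_mulVec continuous_const continuous_id)

/-- This is how coefficients defined by separate sums over `a` and over `b` recombine along an
affine trajectory. -/
theorem EntrySummable.hasSum_affine [Fintype n] [Fintype p] {f : ℕ → Matrix m n ℝ}
    (hf : EntrySummable f) {a : ℕ → Matrix n p ℝ} (ha : ∃ c : ℝ, ∀ t j k, |a t j k| ≤ c)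
    {b : ℕ → n → ℝ} (hb : ∃ c : ℝ, ∀ t j, |b t j| ≤ c) (x : p → ℝ) :
    HasSum (fun k => f k *ᵥ (a k *ᵥ x + b k)) ((∑' k, f k * a k) *ᵥ x + ∑' k, f k *ᵥ b k) := by
  have h := ((hf.mul_bounded ha).summable.hasSum.matrix_mulVec x).add
    (hf.summable_mulVec hb).hasSum
  refine h.congr_fun ?_
  intro k
  rw [Matrix.mulVec_add, Matrix.mulVec_mulVec]

theorem exists_bound_affine [Fintype p] {a : ℕ → Matrix n p ℝ}
    (ha : ∃ c : ℝ, ∀ t j k, |a t j k| ≤ c) {b : ℕ → n → ℝ} (hb : ∃ c : ℝ, ∀ t j, |b t j| ≤ c)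
    (x : p → ℝ) : ∃ c : ℝ, ∀ t j, |(a t *ᵥ x + b t) j| ≤ c := by
  obtain ⟨c, hc⟩ := ha
  obtain ⟨c', hc'⟩ := hb
  refine ⟨(∑ k, c * |x k|) + c', fun t j => ?_⟩
  refine (abs_add_le _ _).trans (add_le_add ?_ (hc' t j))
  refine (Finset.abs_sum_le_sum_abs _ _).trans (Finset.sum_le_sum fun k _ => ?_)
  rw [abs_mul]
  exact mul_le_mul_of_nonneg_right (hc t j k) (abs_nonneg _)

end EntrySummable

namespace LQGame

variable (g : LQGame)

/-! ### The Riccati solution of a decision maker -/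

section BestResponse

variable {g} {i : Fin g.N} (hst : IsStabilizable (g.A i) (g.B i))
include hst

theorem M_posSemidef : (g.M i).PosSemidef :=
  (riccatiSol_spec (g.β_nonneg i) (g.β_lt_one i) (g.Q_posDef i).posSemidef (g.R_posDef i) hst).1

theorem M_eq_policyMap :
    g.M i = policyMap (g.β i) (g.A i) (g.B i) (g.Q i) (g.R i) (g.F i) (g.M i) :=
  (riccatiSol_spec (g.β_nonneg i) (g.β_lt_one i) (g.Q_posDef i).posSemidef (g.R_posDef i) hst).2.trans
    (riccatiMap_eq_policyMap (g.β_nonneg i) (g.R_posDef i) (M_posSemidef hst))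

theorem S_posDef : (g.S i).PosDef :=
  posDef_riccatiWeight (g.β_nonneg i) (g.R_posDef i) (M_posSemidef hst)

theorem S_mul_F : g.S i * g.F i = -(g.β i • ((g.B i)ᵀ * g.M i * g.A i)) :=
  riccatiWeight_mul_gain (g.β_nonneg i) (g.R_posDef i) (M_posSemidef hst)

theorem Φ_pow_entrySummable : EntrySummable fun n => g.Φ i ^ n := by
  obtain ⟨c, r, hr, hr1, h⟩ := exists_geometric_bound (g.β_nonneg i) (g.β_lt_one i) (g.Q_posDef i)
    (g.R_posDef i).posSemidef (M_posSemidef hst) (M_eq_policyMap hst)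
  exact EntrySummable.of_geometric hr hr1 h

/-- Neumann series: the summable powers of `Φ` provide a one-sided inverse of `1 - Φ`, which
suffices for a square matrix. -/
theorem one_sub_Φ_mul_inv : (1 - g.Φ i) * (1 - g.Φ i)⁻¹ = 1 := by
  have h := (Φ_pow_entrySummable hst).summable.one_sub_mul_tsum_pow
  have hu : IsUnit (1 - g.Φ i) := IsUnit.of_mul_eq_one _ h
  exact Matrix.mul_nonsing_inv _ ((Matrix.isUnit_iff_isUnit_det _).1 hu)

theorem Gn_entrySummable : EntrySummable (g.Gn i) := by
  -- For `n ≥ 1` the coefficients are powers of `Φ` between fixed matrices; the exceptional term `n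
  -- = 0` does not affect summability.
  refine EntrySummable.of_succ ?_
  exact ((((Φ_pow_entrySummable hst).mul_left _).mul_right _).smul _).neg

end BestResponse

/-! ### Aggregated coefficients -/

section Aggregate

variable {g} (hst : ∀ i, IsStabilizable (g.A i) (g.B i))
  (Ŵ : g.X) {a : ℕ → Matrix (Fin g.ny) g.SIdx ℝ} {b : ℕ → g.Y}
  (ha : ∃ c : ℝ, ∀ t j k, |a t j k| ≤ c) (hb : ∃ c : ℝ, ∀ t j, |b t j| ≤ c)
include hst

theorem Gpn_entrySummable : EntrySummable g.Gpn :=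
  EntrySummable.sum fun i => (Gn_entrySummable (hst i)).mul_left _

theorem GXn_entrySummable : EntrySummable g.GXn := by
  rintro (j | ⟨i, j⟩) k
  · exact EntrySummable.sum (fun i => (Gn_entrySummable (hst i)).mul_left (g.B1 i)) j k
  · exact (Gn_entrySummable (hst i)).mul_left (g.B i) j k

include ha hb

theorem hasSum_Gn (i : Fin g.N) (x : g.X) :
    HasSum (fun n => g.Gn i n *ᵥ (a n *ᵥ x + b n)) (g.Gi a i *ᵥ x + ∑' n, g.Gn i n *ᵥ b n) :=
  (Gn_entrySummable (hst i)).hasSum_affine ha hb x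

/-- Both sides come from the series `∑ 𝒢ᵖₙ (aₙ x + bₙ)`, summed once per decision maker and once in
aggregate, so uniqueness of sums identifies them. The same argument gives the next lemma. -/
theorem sum_E1_decision (x : g.X) :
    ∑ i, g.E1 i *ᵥ (g.Gi a i *ᵥ x + g.Hi Ŵ b i) = g.Gp a *ᵥ x + g.Hpc Ŵ b := by
  have h1 := (Gpn_entrySummable hst).hasSum_affine ha hb x
  have h2 : HasSum (fun n => g.Gpn n *ᵥ (a n *ᵥ x + b n))
      (∑ i, g.E1 i *ᵥ (g.Gi a i *ᵥ x + ∑' n, g.Gn i n *ᵥ b n)) := by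
    refine (hasSum_sum fun i _ => (hasSum_Gn hst ha hb i x).mulVec_left (g.E1 i)).congr_fun ?_
    intro n
    simp [Gpn, Matrix.sum_mulVec, Matrix.mulVec_mulVec]
  have h3 := h2.unique h1
  simp only [Hi, Hpc, Hp, ← add_assoc, Matrix.mulVec_add, Finset.sum_add_distrib, Gp] at h3 ⊢
  rw [h3]

theorem GX_mulVec_add (x : g.X) :
    g.GX a *ᵥ x + g.HXc Ŵ b = Sum.elim (∑ i, g.B1 i *ᵥ (g.Gi a i *ᵥ x + g.Hi Ŵ b i))
      (fun p => (g.B p.1 *ᵥ (g.Gi a p.1 *ᵥ x + g.Hi Ŵ b p.1)) p.2) := by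
  have h1 := (GXn_entrySummable hst).hasSum_affine ha hb x
  have h2 : HasSum (fun n => g.GXn n *ᵥ (a n *ᵥ x + b n))
      (Sum.elim (∑ i, g.B1 i *ᵥ (g.Gi a i *ᵥ x + ∑' n, g.Gn i n *ᵥ b n))
        (fun p => (g.B p.1 *ᵥ (g.Gi a p.1 *ᵥ x + ∑' n, g.Gn p.1 n *ᵥ b n)) p.2)) := by
    refine Pi.hasSum.2 ?_
    rintro (j | ⟨i, j⟩)
    · refine (Pi.hasSum.1 (hasSum_sum fun i (_ : i ∈ Finset.univ) =>
        (hasSum_Gn hst ha hb i x).mulVec_left (g.B1 i)) j).congr_fun ?_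
      intro n
      rw [GXn, Matrix.fromRows_mulVec]
      simp [Matrix.sum_mulVec, Matrix.mulVec_mulVec]
    · refine (Pi.hasSum.1 ((hasSum_Gn hst ha hb i x).mulVec_left (g.B i)) j).congr_fun ?_
      intro n
      rw [GXn, Matrix.fromRows_mulVec, Matrix.mulVec_mulVec]
      rfl
  have h3 := h2.unique h1
  simp only [HXc, HX, ← add_assoc, GX] at h3 ⊢
  rw [← h3]
  ext (j | ⟨i, j⟩)
  · simp [Hi, Matrix.mulVec_add, Finset.sum_add_distrib, ← add_assoc]
  · simp [Hi, Matrix.mulVec_add, ← add_assoc]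

end Aggregate

/-! ### Consequences of unique solvability -/

section Predictor

variable (ξhat : g.Y) (Ŵ : g.X) (a : ℕ → Matrix (Fin g.ny) g.SIdx ℝ) (b : ℕ → g.Y)

/-- Prediction of the current environment variable from the current state estimate. -/
def predOutput (x : g.X) : g.Y := (g.Dc + g.Gp a) *ᵥ x + g.Hpc Ŵ b + ξhat

/-- Prediction of the next state from the current state estimate. -/
def predState (x : g.X) : g.X :=
  g.Ac *ᵥ x + g.GX a *ᵥ x + g.HXc Ŵ b + g.Cc *ᵥ g.predOutput ξhat Ŵ a b x + Ŵ

variable {g} {ξhat Ŵ a b}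

/-- The tail of the mean trajectory from `x` is a bounded solution of the same system started at the
next mean state, so uniqueness identifies it with the trajectory from there. This semigroup property
is the only use made of uniqueness. -/
theorem SolvesMeanSystem.eq_pred (hsol : g.UniquelySolvable ξhat Ŵ a b)
    (hst : ∀ i, IsStabilizable (g.A i) (g.B i)) (x : g.X) :
    a 0 *ᵥ x + b 0 = g.predOutput ξhat Ŵ a b x ∧
    ∀ n, a (n + 1) *ᵥ x + b (n + 1) = a n *ᵥ g.predState ξhat Ŵ a b x + b n := by
  have ha := hsol.bounded_a
  have hb := hsol.bounded_b
  obtain ⟨hs1, hs2, xs, hx0, hy, hxs⟩ := hsol.solves x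
  have hout : a 0 *ᵥ x + b 0 = g.predOutput ξhat Ŵ a b x := by
    have h := hy 0
    simp only [zero_add] at h
    rw [((Gpn_entrySummable hst).hasSum_affine ha hb x).tsum_eq, hx0] at h
    rw [h, predOutput, Hpc, Matrix.add_mulVec, Gp]
    abel
  have hstate : xs 1 = g.predState ξhat Ŵ a b x := by
    have h := hxs 0
    simp only [zero_add] at h
    rw [((GXn_entrySummable hst).hasSum_affine ha hb x).tsum_eq, hx0, hout] at h
    rw [h, predState, HXc, GX]
    abel
  refine ⟨hout, fun n => ?_⟩
  have hbd : ∃ c : ℝ, ∀ t j, |(a (t + 1) *ᵥ x + b (t + 1)) j| ≤ c := by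
    obtain ⟨c, hc⟩ := exists_bound_affine ha hb x
    exact ⟨c, fun t j => hc (t + 1) j⟩
  have hshift : g.SolvesMeanSystem ξhat Ŵ (xs 1) fun t => a (t + 1) *ᵥ x + b (t + 1) := by
    refine ⟨fun t => ?_, fun t => ?_, fun t => xs (t + 1), rfl, fun t => ?_, fun t => ?_⟩
    · simpa only [add_right_comm] using hs1 (t + 1)
    · simpa only [add_right_comm] using hs2 (t + 1)
    · simpa only [add_right_comm] using hy (t + 1)
    · simpa only [add_right_comm] using hxs (t + 1)
  have h := congrFun (hsol.unique (xs 1) _ hbd hshift) n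
  rw [hstate] at h
  exact h

end Predictor

/-! ### The costate of a decision maker -/

section Costate

/-- Source term of the costate recursion. -/
def costateSource (i : Fin g.N) : Matrix (Fin (g.nx i)) (Fin g.ny) ℝ :=
  (g.F i)ᵀ * (g.K i)ᵀ + (g.L i)ᵀ + g.Φ i * g.M i * g.C i

/-- Linear part of the costate. -/
def costateMat (a : ℕ → Matrix (Fin g.ny) g.SIdx ℝ) (i : Fin g.N) :
    Matrix (Fin (g.nx i)) g.SIdx ℝ := ∑' n, g.Φ i ^ n * g.costateSource i * a n

/-- Constant part of the costate. -/
def costateConst (Ŵ : g.X) (b : ℕ → g.Y) (i : Fin g.N) : Fin (g.nx i) → ℝ :=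
  ∑' n, (g.Φ i ^ n * g.costateSource i) *ᵥ b n
    + (g.Φ i * (1 - g.Φ i)⁻¹ * g.M i) *ᵥ g.ownPart i Ŵ

/-- The costate: half the gradient at `0` of the value function of decision maker `i`, as a
function of the state estimate. -/
def costate (Ŵ : g.X) (a : ℕ → Matrix (Fin g.ny) g.SIdx ℝ) (b : ℕ → g.Y) (i : Fin g.N)
    (x : g.X) : Fin (g.nx i) → ℝ := g.costateMat a i *ᵥ x + g.costateConst Ŵ b i

variable {g} {Ŵ : g.X} {a : ℕ → Matrix (Fin g.ny) g.SIdx ℝ} {b : ℕ → g.Y} {i : Fin g.N}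
  (hst : IsStabilizable (g.A i) (g.B i))
  (ha : ∃ c : ℝ, ∀ t j k, |a t j k| ≤ c) (hb : ∃ c : ℝ, ∀ t j, |b t j| ≤ c)
include hst ha hb

/-- The subtracted constant is the closed form of `∑ₙ Φⁿ⁺¹ M ŵ`, the contribution of the mean
disturbance; what remains is the series over predictions. -/
theorem hasSum_costate (x : g.X) :
    HasSum (fun n => (g.Φ i ^ n * g.costateSource i) *ᵥ (a n *ᵥ x + b n))
      (g.costate Ŵ a b i x - (g.Φ i * (1 - g.Φ i)⁻¹ * g.M i) *ᵥ g.ownPart i Ŵ) := by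
  rw [costate, costateConst, ← add_assoc, add_sub_cancel_right]
  exact ((Φ_pow_entrySummable hst).mul_right _).hasSum_affine ha hb x

/-- Split off the term `n = 0` and shift the rest: by the semigroup property it is `Φ` times the
series at `x'`. -/
theorem costate_step {x x' : g.X} (hx : ∀ n, a (n + 1) *ᵥ x + b (n + 1) = a n *ᵥ x' + b n) :
    g.costate Ŵ a b i x = g.costateSource i *ᵥ (a 0 *ᵥ x + b 0)
      + g.Φ i *ᵥ (g.costate Ŵ a b i x' + g.M i *ᵥ g.ownPart i Ŵ) := by
  have h1 := hasSum_costate (Ŵ := Ŵ) hst ha hb x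
  have h2 := (hasSum_costate (Ŵ := Ŵ) hst ha hb x').mulVec_left (g.Φ i)
  have h3 := (hasSum_nat_add_iff' 1).2 h1
  have h4 := h3.unique (h2.congr_fun fun n => by
    rw [hx, Matrix.mulVec_mulVec, pow_succ', Matrix.mul_assoc])
  simp only [Finset.range_one, Finset.sum_singleton, pow_zero, Matrix.one_mul] at h4
  -- The identity `(1 - Φ)⁻¹ = 1 + Φ (1 - Φ)⁻¹` performs the same shift on the disturbance part.
  have h5 : (g.Φ i * (1 - g.Φ i)⁻¹ * g.M i) *ᵥ g.ownPart i Ŵ = g.Φ i *ᵥ (g.M i *ᵥ g.ownPart i Ŵ)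
      + g.Φ i *ᵥ ((g.Φ i * (1 - g.Φ i)⁻¹ * g.M i) *ᵥ g.ownPart i Ŵ) := by
    have h := one_sub_Φ_mul_inv hst
    rw [Matrix.sub_mul, Matrix.one_mul, sub_eq_iff_eq_add] at h
    conv_lhs => rw [h]
    simp only [Matrix.mul_add, Matrix.add_mul, Matrix.mul_assoc, Matrix.mul_one,
      Matrix.add_mulVec, Matrix.mulVec_mulVec]
  rw [sub_sub, sub_eq_iff_eq_add, Matrix.mulVec_sub] at h4
  rw [h4, Matrix.mulVec_add (g.Φ i)]
  generalize g.Φ i *ᵥ ((g.Φ i * (1 - g.Φ i)⁻¹ * g.M i) *ᵥ g.ownPart i Ŵ) = z at h5 ⊢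
  rw [h5]
  abel

/-- The first-order condition of the one-step problem. For `n ≥ 1`, `Gₙ` is `-β S⁻¹ B'` times a
coefficient of the costate series at the next estimate; `G₀` accounts for the current environment
variable and `H` for the mean disturbance. -/
theorem S_mulVec_decision {x x' : g.X}
    (hx : ∀ n, a (n + 1) *ᵥ x + b (n + 1) = a n *ᵥ x' + b n) :
    g.S i *ᵥ (g.Gi a i *ᵥ x + g.Hi Ŵ b i) = -((g.K i)ᵀ *ᵥ (a 0 *ᵥ x + b 0)
      + g.β i • ((g.B i)ᵀ *ᵥ (g.M i *ᵥ (g.C i *ᵥ (a 0 *ᵥ x + b 0) + g.ownPart i Ŵ)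
        + g.costate Ŵ a b i x'))) := by
  have hu := (Matrix.isUnit_iff_isUnit_det _).1 (S_posDef hst).isUnit
  have h1 : HasSum (fun n => g.Gn i n *ᵥ (a n *ᵥ x + b n))
      (g.Gi a i *ᵥ x + ∑' n, g.Gn i n *ᵥ b n) := (Gn_entrySummable hst).hasSum_affine ha hb x
  have h2 := ((hasSum_nat_add_iff' 1).2 h1).mulVec_left (g.S i)
  have h3 := ((hasSum_costate (Ŵ := Ŵ) hst ha hb x').mulVec_left (g.β i • (g.B i)ᵀ)).neg
  have h4 := h2.unique (h3.congr_fun fun n => by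
    rw [hx, Gn, Matrix.mulVec_mulVec, Matrix.mulVec_mulVec, ← Matrix.neg_mulVec, costateSource]
    congr 1
    rw [Matrix.mul_neg, Matrix.mul_smul, Matrix.smul_mul]
    simp only [Matrix.mul_assoc]
    rw [Matrix.mul_nonsing_inv_cancel_left _ _ hu])
  simp only [Finset.range_one, Finset.sum_singleton] at h4
  have h5 : g.S i *ᵥ g.H Ŵ i = -((g.β i • (g.B i)ᵀ) *ᵥ (g.M i *ᵥ g.ownPart i Ŵ
      + (g.Φ i * (1 - g.Φ i)⁻¹ * g.M i) *ᵥ g.ownPart i Ŵ)) := by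
    rw [H, Matrix.mulVec_neg, Matrix.mulVec_smul, Matrix.mulVec_mulVec]
    simp only [Matrix.mul_assoc]
    rw [Matrix.mul_nonsing_inv_cancel_left _ _ hu]
    have h := one_sub_Φ_mul_inv hst
    rw [Matrix.sub_mul, Matrix.one_mul, sub_eq_iff_eq_add] at h
    conv_lhs => rw [h]
    simp only [Matrix.mul_add, Matrix.add_mul, Matrix.mul_assoc, Matrix.one_mul,
      Matrix.add_mulVec, Matrix.mulVec_mulVec, Matrix.mulVec_add, Matrix.smul_mul, smul_add,
      Matrix.smul_mulVec]
  have h7 : g.S i *ᵥ (g.Gn i 0 *ᵥ (a 0 *ᵥ x + b 0)) = -(((g.K i)ᵀ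
      + g.β i • ((g.B i)ᵀ * g.M i * g.C i)) *ᵥ (a 0 *ᵥ x + b 0)) := by
    rw [Gn, Matrix.mulVec_mulVec, Matrix.mul_neg, Matrix.mul_nonsing_inv_cancel_left _ _ hu,
      Matrix.neg_mulVec]
  rw [Matrix.mulVec_sub, h7, sub_eq_iff_eq_add] at h4
  rw [Hi, ← add_assoc, Matrix.mulVec_add, h4, h5]
  generalize (g.Φ i * (1 - g.Φ i)⁻¹ * g.M i) *ᵥ g.ownPart i Ŵ = z
  generalize a 0 *ᵥ x + b 0 = y
  simp only [Matrix.mulVec_add, Matrix.mulVec_sub, Matrix.add_mulVec, Matrix.mulVec_mulVec,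
    Matrix.mul_assoc, Matrix.smul_mulVec, smul_add, Matrix.smul_mul]
  abel

end Costate

end LQGame


namespace LQGame

/-! ### The closed loop -/

section ClosedLoop

variable {g : LQGame}

/-- The system state at a history. -/
def sysState {t : ℕ} (h : g.History t) : g.X :=
  Sum.elim h.env fun p => h.x p.1 (Fin.last t) p.2

theorem hist_y (s : ∀ i, g.Strategy i) (X₀ : g.X) (ξ : ℕ → g.Y) (W : ℕ → g.X) (t : ℕ) :
    (hist s X₀ ξ W t).y = fun k : Fin t => envVar s X₀ ξ W k := by
  induction t with
  | zero => exact funext fun k => k.elim0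
  | succ t ih =>
    funext k
    refine Fin.lastCases ?_ (fun j => ?_) k
    · simp [hist, envVar]
    · simp [hist, ih]

theorem sysState_hist_zero (s : ∀ i, g.Strategy i) (X₀ : g.X) (ξ : ℕ → g.Y) (W : ℕ → g.X) :
    sysState (hist s X₀ ξ W 0) = X₀ := by
  ext (j | ⟨i, j⟩) <;> rfl

theorem Dc_mulVec (v : g.X) :
    g.Dc *ᵥ v = g.D *ᵥ (g.envPart v) + ∑ i, (g.E1 i * g.F i + g.E2 i) *ᵥ g.ownPart i v := by
  ext j
  simp only [Dc, Matrix.mulVec, dotProduct, Fintype.sum_sum_type, Matrix.fromCols_apply_inl,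
    Matrix.fromCols_apply_inr, Fintype.sum_sigma, Matrix.of_apply, Pi.add_apply,
    Finset.sum_apply, envPart, ownPart]

theorem Ac_mulVec_env (v : g.X) (j : Fin g.n0) :
    (g.Ac *ᵥ v) (Sum.inl j) = (g.A0 *ᵥ (g.envPart v)
      + ∑ i, (g.B1 i * g.F i + g.B2 i) *ᵥ g.ownPart i v) j := by
  simp only [Ac, Matrix.mulVec, dotProduct, Fintype.sum_sum_type, Matrix.fromBlocks_apply₁₁,
    Matrix.fromBlocks_apply₁₂, Fintype.sum_sigma, Matrix.of_apply, Pi.add_apply,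
    Finset.sum_apply, envPart, ownPart]

theorem Ac_mulVec_own (v : g.X) (i : Fin g.N) (j : Fin (g.nx i)) :
    (g.Ac *ᵥ v) (Sum.inr ⟨i, j⟩) = ((g.A i + g.B i * g.F i) *ᵥ g.ownPart i v) j := by
  simp only [Ac, Matrix.mulVec, dotProduct, Fintype.sum_sum_type, Matrix.fromBlocks_apply₂₁,
    Matrix.fromBlocks_apply₂₂, Fintype.sum_sigma, ownPart, Matrix.zero_apply, zero_mul,
    Finset.sum_const_zero, zero_add]
  rw [Finset.sum_eq_single i]
  · simp [Matrix.blockDiagonal'_apply_eq]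
  · intro k _ hk
    exact Finset.sum_eq_zero fun s _ => by
      rw [Matrix.blockDiagonal'_apply_ne _ _ _ hk.symm, zero_mul]
  · simp

theorem Cc_mulVec_env (y : g.Y) (j : Fin g.n0) : (g.Cc *ᵥ y) (Sum.inl j) = 0 := by
  simp [Cc, Matrix.mulVec]

theorem Cc_mulVec_own (y : g.Y) (i : Fin g.N) (j : Fin (g.nx i)) :
    (g.Cc *ᵥ y) (Sum.inr ⟨i, j⟩) = (g.C i *ᵥ y) j := by
  simp [Cc, Matrix.mulVec, dotProduct]

variable (hst : ∀ i, IsStabilizable (g.A i) (g.B i))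
  (Ŵ : g.X) {a : ℕ → Matrix (Fin g.ny) g.SIdx ℝ} {b : ℕ → g.Y}
  (ha : ∃ c : ℝ, ∀ t j k, |a t j k| ≤ c) (hb : ∃ c : ℝ, ∀ t j, |b t j| ≤ c)
include hst ha hb

/-- Here and in the state recursion below, the own feedback `F` is absorbed into `𝒟` and `𝒜`. What
results are the replica's equations with the estimator mapping in place of the conditional
expectation. -/
theorem output_affineStrategy (e : g.EstimatorMap) {t : ℕ} (h : g.History t) (ξt : g.Y) :
    output (g.affineStrategy Ŵ a b e) h ξt =
      g.Dc *ᵥ sysState h + g.Gp a *ᵥ e.map t h.y + g.Hpc Ŵ b + ξt := by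
  have h1 := sum_E1_decision hst Ŵ ha hb (e.map t h.y)
  have h2 : ∀ i, g.ownPart i (sysState h) = h.x i (Fin.last t) := fun i => rfl
  have h3 : g.envPart (sysState h) = h.env := rfl
  rw [add_assoc (g.Dc *ᵥ sysState h), ← h1, Dc_mulVec, h3, output]
  simp only [h2, control, affineStrategy, Matrix.mulVec_add, Matrix.add_mulVec,
    Matrix.mulVec_mulVec, Finset.sum_add_distrib]
  abel

theorem sysState_hist_succ (e : g.EstimatorMap) (X₀ : g.X) (ξ : ℕ → g.Y) (W : ℕ → g.X) (t : ℕ) :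
    sysState (hist (g.affineStrategy Ŵ a b e) X₀ ξ W (t + 1)) =
      g.Ac *ᵥ sysState (hist (g.affineStrategy Ŵ a b e) X₀ ξ W t)
        + g.GX a *ᵥ e.map t (hist (g.affineStrategy Ŵ a b e) X₀ ξ W t).y + g.HXc Ŵ b
        + g.Cc *ᵥ envVar (g.affineStrategy Ŵ a b e) X₀ ξ W t + W t := by
  rw [add_assoc (g.Ac *ᵥ _), GX_mulVec_add hst Ŵ ha hb]
  set h := hist (g.affineStrategy Ŵ a b e) X₀ ξ W t with hh
  have h2 : ∀ i, g.ownPart i (sysState h) = h.x i (Fin.last t) := fun i => rfl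
  have h3 : g.envPart (sysState h) = h.env := rfl
  ext (j | ⟨i, j⟩)
  · simp only [Pi.add_apply, Ac_mulVec_env, Cc_mulVec_env, Sum.elim_inl, h2, h3]
    simp only [sysState, hist, Sum.elim_inl, ← hh, control, affineStrategy, Matrix.mulVec_add,
      Matrix.add_mulVec, Matrix.mulVec_mulVec, Finset.sum_add_distrib, Pi.add_apply, envPart]
    ring
  · simp only [Pi.add_apply, Ac_mulVec_own, Cc_mulVec_own, Sum.elim_inr, h2]
    simp only [sysState, hist, Sum.elim_inr, ← hh, control, affineStrategy, Matrix.mulVec_add,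
      Matrix.add_mulVec, Matrix.mulVec_mulVec, Fin.snoc_last, Pi.add_apply, ownPart, envVar]
    ring

/-- Under affine strategies the system state and the recorded outputs form a closed recursion, so
the remainder of the history need not be followed. -/
theorem measurable_closedLoop (e : g.EstimatorMap) (t : ℕ) :
    (Measurable fun p : g.X × (ℕ → g.Y) × (ℕ → g.X) =>
      sysState (hist (g.affineStrategy Ŵ a b e) p.1 p.2.1 p.2.2 t)) ∧
    Measurable fun p : g.X × (ℕ → g.Y) × (ℕ → g.X) =>
      (hist (g.affineStrategy Ŵ a b e) p.1 p.2.1 p.2.2 t).y := by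
  have hmv : ∀ {p q : Type} [Fintype p] [Fintype q] (M : Matrix p q ℝ)
      {f : g.X × (ℕ → g.Y) × (ℕ → g.X) → q → ℝ}, Measurable f → Measurable fun z => M *ᵥ f z :=
    fun M f hf => (Continuous.matrix_mulVec continuous_const continuous_id).measurable.comp hf
  induction t with
  | zero =>
    simp only [sysState_hist_zero]
    refine ⟨measurable_fst, ?_⟩
    exact measurable_pi_lambda _ fun k => k.elim0
  | succ t ih =>
    obtain ⟨ihx, ihy⟩ := ih
    have hy : Measurable fun p : g.X × (ℕ → g.Y) × (ℕ → g.X) =>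
        envVar (g.affineStrategy Ŵ a b e) p.1 p.2.1 p.2.2 t := by
      simp only [envVar, output_affineStrategy hst Ŵ ha hb]
      exact (((hmv _ ihx).add (hmv _ ((e.measurable_map t).comp ihy))).add_const _).add
        ((measurable_pi_apply t).comp (measurable_fst.comp measurable_snd))
    constructor
    · simp only [sysState_hist_succ hst Ŵ ha hb]
      exact ((((hmv _ ihx).add (hmv _ ((e.measurable_map t).comp ihy))).add_const _).add
        (hmv _ hy)).add ((measurable_pi_apply t).comp (measurable_snd.comp measurable_snd))
    · refine measurable_pi_lambda _ fun k => ?_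
      refine Fin.lastCases ?_ (fun j => ?_) k
      · simpa [hist, envVar] using hy
      · simpa [Function.comp_def, hist] using (measurable_pi_apply j).comp ihy

theorem measurable_envVar (e : g.EstimatorMap) :
    Measurable fun p : g.X × (ℕ → g.Y) × (ℕ → g.X) =>
      (fun t => envVar (g.affineStrategy Ŵ a b e) p.1 p.2.1 p.2.2 t : ℕ → g.Y) := by
  refine measurable_pi_lambda _ fun t => ?_
  have h := (measurable_pi_apply (Fin.last t)).comp
    (measurable_closedLoop hst Ŵ ha hb e (t + 1)).2
  simpa [Function.comp_def, hist, envVar] using h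

variable {Ω Ωbar : Type*} [MeasurableSpace Ω] [MeasurableSpace Ωbar]
  {P : Measure Ω} {Pbar : Measure Ωbar} {X₀bar : Ωbar → g.X} {ξbar : ℕ → Ωbar → g.Y}
  {Wbar : ℕ → Ωbar → g.X} {Xbar : ℕ → Ωbar → g.X} {ybar : ℕ → Ωbar → g.Y}

/-- The estimator mapping applied to the replica's past is the conditional expectation in the
replica's equations. Off one null set, common to all times, the two recursions coincide. -/
theorem IsReplica.ae_eq_closedLoop
    (hrep : g.IsReplica Pbar Ŵ a b X₀bar ξbar Wbar Xbar ybar) {e : g.EstimatorMap}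
    (he : g.IsStateEstimator Pbar Xbar ybar e) :
    ∀ᵐ ω ∂Pbar, ∀ t, ybar t ω = envVar (g.affineStrategy Ŵ a b e) (X₀bar ω)
      (fun t => ξbar t ω) (fun t => Wbar t ω) t := by
  filter_upwards [hrep.init, ae_all_iff.2 hrep.output, ae_all_iff.2 hrep.step, ae_all_iff.2 he]
    with ω h0 hy hx hest
  have key : ∀ t, Xbar t ω = sysState (hist (g.affineStrategy Ŵ a b e) (X₀bar ω)
      (fun t => ξbar t ω) (fun t => Wbar t ω) t) ∧
      (fun k : Fin t => ybar k ω) = (hist (g.affineStrategy Ŵ a b e) (X₀bar ω)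
      (fun t => ξbar t ω) (fun t => Wbar t ω) t).y ∧
      ybar t ω = envVar (g.affineStrategy Ŵ a b e) (X₀bar ω)
        (fun t => ξbar t ω) (fun t => Wbar t ω) t := by
    intro t
    have hout : ∀ t, Xbar t ω = sysState (hist (g.affineStrategy Ŵ a b e) (X₀bar ω)
        (fun t => ξbar t ω) (fun t => Wbar t ω) t) →
        (fun k : Fin t => ybar k ω) = (hist (g.affineStrategy Ŵ a b e) (X₀bar ω)
        (fun t => ξbar t ω) (fun t => Wbar t ω) t).y →
        ybar t ω = envVar (g.affineStrategy Ŵ a b e) (X₀bar ω)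
        (fun t => ξbar t ω) (fun t => Wbar t ω) t := by
      intro t h1 h2
      rw [hy, ← hest, h1, h2, envVar, output_affineStrategy hst Ŵ ha hb]
    induction t with
    | zero =>
      have e1 := h0.trans (sysState_hist_zero (g.affineStrategy Ŵ a b e) (X₀bar ω)
        (fun t => ξbar t ω) (fun t => Wbar t ω)).symm
      have e2 : (fun k : Fin 0 => ybar k ω) = (hist (g.affineStrategy Ŵ a b e) (X₀bar ω)
        (fun t => ξbar t ω) (fun t => Wbar t ω) 0).y := funext fun k => k.elim0
      exact ⟨e1, e2, hout 0 e1 e2⟩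
    | succ t ih =>
      obtain ⟨ih1, ih2, ih3⟩ := ih
      have e1 : Xbar (t + 1) ω = sysState (hist (g.affineStrategy Ŵ a b e) (X₀bar ω)
          (fun t => ξbar t ω) (fun t => Wbar t ω) (t + 1)) := by
        rw [hx, ← hest, sysState_hist_succ hst Ŵ ha hb, ← ih1, ← ih2, ← ih3]
      have e2 : (fun k : Fin (t + 1) => ybar k ω) = (hist (g.affineStrategy Ŵ a b e) (X₀bar ω)
          (fun t => ξbar t ω) (fun t => Wbar t ω) (t + 1)).y := by
        funext k
        refine Fin.lastCases ?_ (fun j => ?_) k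
        · simpa [hist, envVar] using ih3
        · simpa [hist] using congrFun ih2 j
      exact ⟨e1, e2, hout _ e1 e2⟩
  exact fun t => (key t).2.2

/-- The law of the environment variables generated by an affine strategy is that of the
replica. -/
theorem IsReplica.map_eq_envLaw {X₀ : Ω → g.X} {ξ : ℕ → Ω → g.Y} {W : ℕ → Ω → g.X}
    (hrep : g.IsReplica Pbar Ŵ a b X₀bar ξbar Wbar Xbar ybar) {e : g.EstimatorMap}
    (he : g.IsStateEstimator Pbar Xbar ybar e)
    (hlaw : IdentDistrib
      (fun ω => (X₀bar ω, (fun t => ξbar t ω : ℕ → g.Y), (fun t => Wbar t ω : ℕ → g.X)))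
      (fun ω => (X₀ ω, (fun t => ξ t ω : ℕ → g.Y), (fun t => W t ω : ℕ → g.X))) Pbar P) :
    Pbar.map (fun ω t => ybar t ω) = envLaw P X₀ ξ W (g.affineStrategy Ŵ a b e) := by
  have h1 : (fun ω t => ybar t ω) =ᵐ[Pbar] fun ω => (fun t => envVar (g.affineStrategy Ŵ a b e)
      (X₀bar ω) (fun t => ξbar t ω) (fun t => Wbar t ω) t : ℕ → g.Y) := by
    filter_upwards [hrep.ae_eq_closedLoop hst Ŵ ha hb he] with ω hω
    exact funext hω
  rw [Measure.map_congr h1]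
  exact (hlaw.comp (measurable_envVar hst Ŵ ha hb e)).map_eq

end ClosedLoop

end LQGame


/-! ### Square integrable random vectors and their covariances -/

section L2Vec

variable {Ω : Type*} [MeasurableSpace Ω] {P : Measure Ω} {ι κ : Type}

/-- All coordinates are square integrable. -/
def L2Vec (P : Measure Ω) (U : Ω → ι → ℝ) : Prop := ∀ j, MemLp (fun ω => U ω j) 2 P

theorem L2Vec.add {U V : Ω → ι → ℝ} (hU : L2Vec P U) (hV : L2Vec P V) :
    L2Vec P fun ω => U ω + V ω := fun j => (hU j).add (hV j)

theorem L2Vec.sub {U V : Ω → ι → ℝ} (hU : L2Vec P U) (hV : L2Vec P V) :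
    L2Vec P fun ω => U ω - V ω := fun j => (hU j).sub (hV j)

theorem L2Vec.const [IsFiniteMeasure P] (c : ι → ℝ) : L2Vec P fun _ => c :=
  fun j => memLp_const (c j)

theorem L2Vec.mulVec [Fintype ι] {U : Ω → ι → ℝ} (hU : L2Vec P U) (A : Matrix κ ι ℝ) :
    L2Vec P fun ω => A *ᵥ U ω := fun i => by
  simp only [Matrix.mulVec, dotProduct]
  exact memLp_finsetSum _ fun j _ => (hU j).const_mul (A i j)

theorem L2Vec.congr {U V : Ω → ι → ℝ} (hU : L2Vec P U) (h : U =ᵐ[P] V) : L2Vec P V := fun j =>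
  (memLp_congr_ae (h.mono fun _ hω => congrFun hω j)).1 (hU j)

theorem L2Vec.integrable_dotProduct [Fintype ι] {U V : Ω → ι → ℝ} (hU : L2Vec P U)
    (hV : L2Vec P V) : Integrable (fun ω => U ω ⬝ᵥ V ω) P :=
  integrable_finsetSum _ fun j _ => (hU j).integrable_mul (hV j)

theorem L2Vec.integrable_apply [IsFiniteMeasure P] {U : Ω → ι → ℝ} (hU : L2Vec P U) (j : ι) :
    Integrable (fun ω => U ω j) P := (hU j).integrable (by norm_num)

theorem L2Vec.integrable [Fintype ι] [IsFiniteMeasure P] {U : Ω → ι → ℝ} (hU : L2Vec P U) :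
    Integrable U P := Integrable.of_eval fun j => hU.integrable_apply j

theorem MeasureTheory.MemLp.l2Vec [Fintype ι] {U : Ω → ι → ℝ} (hU : MemLp U 2 P) :
    L2Vec P U := fun j => hU.eval j

theorem meanVec_add [IsFiniteMeasure P] {U V : Ω → ι → ℝ} (hU : L2Vec P U) (hV : L2Vec P V) :
    meanVec P (fun ω => U ω + V ω) = meanVec P U + meanVec P V :=
  funext fun j => integral_add (hU.integrable_apply j) (hV.integrable_apply j)

theorem meanVec_sub [IsFiniteMeasure P] {U V : Ω → ι → ℝ} (hU : L2Vec P U) (hV : L2Vec P V) :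
    meanVec P (fun ω => U ω - V ω) = meanVec P U - meanVec P V :=
  funext fun j => integral_sub (hU.integrable_apply j) (hV.integrable_apply j)

theorem meanVec_mulVec [Fintype ι] [IsFiniteMeasure P] {U : Ω → ι → ℝ} (hU : L2Vec P U)
    (A : Matrix κ ι ℝ) : meanVec P (fun ω => A *ᵥ U ω) = A *ᵥ meanVec P U := by
  funext i
  simp only [meanVec, Matrix.mulVec, dotProduct]
  rw [integral_finsetSum _ fun j _ => (hU.integrable_apply j).const_mul _]
  simp_rw [integral_const_mul]

/-- Cross-covariance matrix of two random vectors. -/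
def crossCov (P : Measure Ω) (U : Ω → ι → ℝ) (V : Ω → κ → ℝ) : Matrix ι κ ℝ :=
  Matrix.of fun j k => cov[fun ω => U ω j, fun ω => V ω k; P]

theorem crossCov_transpose (U : Ω → ι → ℝ) (V : Ω → κ → ℝ) :
    (crossCov P U V)ᵀ = crossCov P V U := by
  ext j k
  exact covariance_comm _ _

variable [IsProbabilityMeasure P]

theorem crossCov_add_left {U V : Ω → ι → ℝ} {Z : Ω → κ → ℝ} (hU : L2Vec P U) (hV : L2Vec P V)
    (hZ : L2Vec P Z) : crossCov P (fun ω => U ω + V ω) Z = crossCov P U Z + crossCov P V Z := by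
  ext j k
  exact covariance_add_left (hU j) (hV j) (hZ k)

theorem crossCov_sub_left {U V : Ω → ι → ℝ} {Z : Ω → κ → ℝ} (hU : L2Vec P U) (hV : L2Vec P V)
    (hZ : L2Vec P Z) : crossCov P (fun ω => U ω - V ω) Z = crossCov P U Z - crossCov P V Z := by
  ext j k
  exact covariance_sub_left (hU j) (hV j) (hZ k)

theorem crossCov_mulVec_left [Fintype ι] {l : Type} {U : Ω → ι → ℝ} {Z : Ω → κ → ℝ}
    (hU : L2Vec P U) (hZ : L2Vec P Z) (A : Matrix l ι ℝ) :
    crossCov P (fun ω => A *ᵥ U ω) Z = A * crossCov P U Z := by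
  ext j k
  simp only [crossCov, Matrix.of_apply, Matrix.mulVec, dotProduct, Matrix.mul_apply]
  rw [covariance_fun_sum_left (fun s => (hU s).const_mul (A j s)) (hZ k)]
  simp_rw [covariance_const_mul_left]

theorem crossCov_add_right {U V : Ω → ι → ℝ} {Z : Ω → κ → ℝ} (hU : L2Vec P U) (hV : L2Vec P V)
    (hZ : L2Vec P Z) : crossCov P Z (fun ω => U ω + V ω) = crossCov P Z U + crossCov P Z V := by
  rw [← crossCov_transpose, crossCov_add_left hU hV hZ, Matrix.transpose_add, crossCov_transpose,
    crossCov_transpose]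

theorem crossCov_sub_right {U V : Ω → ι → ℝ} {Z : Ω → κ → ℝ} (hU : L2Vec P U) (hV : L2Vec P V)
    (hZ : L2Vec P Z) : crossCov P Z (fun ω => U ω - V ω) = crossCov P Z U - crossCov P Z V := by
  rw [← crossCov_transpose, crossCov_sub_left hU hV hZ, Matrix.transpose_sub, crossCov_transpose,
    crossCov_transpose]

theorem crossCov_mulVec_right [Fintype ι] {l : Type} {U : Ω → ι → ℝ} {Z : Ω → κ → ℝ}
    (hU : L2Vec P U) (hZ : L2Vec P Z) (A : Matrix l ι ℝ) :
    crossCov P Z (fun ω => A *ᵥ U ω) = crossCov P Z U * Aᵀ := by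
  rw [← crossCov_transpose, crossCov_mulVec_left hU hZ, Matrix.transpose_mul, crossCov_transpose]

theorem crossCov_eq_zero_of_indepFun {U : Ω → ι → ℝ} {V : Ω → κ → ℝ} (h : IndepFun U V P)
    (hU : L2Vec P U) (hV : L2Vec P V) : crossCov P U V = 0 := by
  ext j k
  exact (h.comp (measurable_pi_apply j) (measurable_pi_apply k)).covariance_eq_zero (hU j) (hV k)

theorem covMat_congr_identDistrib {Ω' : Type*} [MeasurableSpace Ω'] {P' : Measure Ω'}
    {U : Ω → ι → ℝ} {V : Ω' → ι → ℝ} (h : IdentDistrib U V P P') : covMat P U = covMat P' V := by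
  ext j k
  simp only [covMat, Matrix.of_apply]
  rw [← covariance_map_fun (X := fun v : ι → ℝ => v j) (Y := fun v : ι → ℝ => v k)
      (measurable_pi_apply j).aestronglyMeasurable (measurable_pi_apply k).aestronglyMeasurable
      h.aemeasurable_fst, h.map_eq,
    covariance_map_fun (X := fun v : ι → ℝ => v j) (Y := fun v : ι → ℝ => v k)
      (measurable_pi_apply j).aestronglyMeasurable (measurable_pi_apply k).aestronglyMeasurable
      h.aemeasurable_snd]

end L2Vec

/-- Estimation errors and innovations are finite linear combinations of the primitives; this makes
them jointly Gaussian. -/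
theorem IsGaussianProcess.of_mem_span {Ω S T : Type*} [MeasurableSpace Ω] {P : Measure Ω}
    {X : T → Ω → ℝ} {Y : S → Ω → ℝ} (hX : IsGaussianProcess X P)
    (h : ∀ s, Y s ∈ Submodule.span ℝ (Set.range X)) : IsGaussianProcess Y P := by
  refine hX.of_isGaussianProcess fun s => ?_
  obtain ⟨c, hc⟩ := Finsupp.mem_span_range_iff_exists_finsupp.1 (h s)
  refine ⟨c.support, ∑ i : c.support, c i • ContinuousLinearMap.proj i, fun ω => ?_⟩
  rw [← hc, Finsupp.sum, Finset.sum_apply, ← Finset.sum_coe_sort]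
  simp

namespace LQGame

/-! ### The estimation error of the time-invariant filter -/

section EstimationError

variable {g : LQGame}

variable (g) in
/-- Uncentred estimation error of the filter with gain `K`. -/
def errState (K : Matrix g.SIdx (Fin g.ny) ℝ) (x₀ : g.X) (ξ : ℕ → g.Y) (W : ℕ → g.X) : ℕ → g.X
  | 0 => x₀
  | t + 1 => (g.Ac - K * g.Dc) *ᵥ errState K x₀ ξ W t + W t - K *ᵥ ξ t

variable (g) in
/-- Uncentred innovation of the filter with gain `K`. -/
def innov (K : Matrix g.SIdx (Fin g.ny) ℝ) (x₀ : g.X) (ξ : ℕ → g.Y) (W : ℕ → g.X) (t : ℕ) : g.Y :=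
  g.Dc *ᵥ g.errState K x₀ ξ W t + ξ t

theorem measurable_errState (K : Matrix g.SIdx (Fin g.ny) ℝ) (t : ℕ) :
    Measurable fun p : g.X × (ℕ → g.Y) × (ℕ → g.X) => g.errState K p.1 p.2.1 p.2.2 t := by
  have hmv : ∀ {p q : Type} [Fintype p] [Fintype q] (M : Matrix p q ℝ)
      {f : g.X × (ℕ → g.Y) × (ℕ → g.X) → q → ℝ}, Measurable f → Measurable fun z => M *ᵥ f z :=
    fun M f hf => (Continuous.matrix_mulVec continuous_const continuous_id).measurable.comp hf
  induction t with
  | zero => exact measurable_fst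
  | succ t ih =>
    exact ((hmv _ ih).add ((measurable_pi_apply t).comp (measurable_snd.comp measurable_snd))).sub
      (hmv _ ((measurable_pi_apply t).comp (measurable_fst.comp measurable_snd)))

theorem measurable_innov (K : Matrix g.SIdx (Fin g.ny) ℝ) (t : ℕ) :
    Measurable fun p : g.X × (ℕ → g.Y) × (ℕ → g.X) => g.innov K p.1 p.2.1 p.2.2 t :=
  ((Continuous.matrix_mulVec continuous_const continuous_id).measurable.comp
    (measurable_errState K t)).add ((measurable_pi_apply t).comp (measurable_fst.comp measurable_snd))

variable {Ω : Type*} [MeasurableSpace Ω] {P : Measure Ω} [IsProbabilityMeasure P]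
  {X₀ : Ω → g.X} {ξ : ℕ → Ω → g.Y} {W : ℕ → Ω → g.X} (hstd : g.StandingAssumptions P X₀ ξ W)
include hstd

theorem StandingAssumptions.indepFun_X₀_W (t : ℕ) : IndepFun X₀ (W t) P :=
  (IndepFun_iff_Indep _ _ _).2 (hstd.indep.indep (i := .inl ()) (j := .inr (.inl t)) (by simp))

theorem StandingAssumptions.indepFun_X₀_ξ (t : ℕ) : IndepFun X₀ (ξ t) P :=
  (IndepFun_iff_Indep _ _ _).2 (hstd.indep.indep (i := .inl ()) (j := .inr (.inr t)) (by simp))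

theorem StandingAssumptions.indepFun_W_W {s t : ℕ} (h : s ≠ t) : IndepFun (W s) (W t) P :=
  (IndepFun_iff_Indep _ _ _).2
    (hstd.indep.indep (i := .inr (.inl s)) (j := .inr (.inl t)) (by simpa using h))

theorem StandingAssumptions.indepFun_ξ_ξ {s t : ℕ} (h : s ≠ t) : IndepFun (ξ s) (ξ t) P :=
  (IndepFun_iff_Indep _ _ _).2
    (hstd.indep.indep (i := .inr (.inr s)) (j := .inr (.inr t)) (by simpa using h))

theorem StandingAssumptions.indepFun_W_ξ (s t : ℕ) : IndepFun (W s) (ξ t) P :=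
  (IndepFun_iff_Indep _ _ _).2
    (hstd.indep.indep (i := .inr (.inl s)) (j := .inr (.inr t)) (by simp))

variable (K : Matrix g.SIdx (Fin g.ny) ℝ)

theorem l2Vec_errState (t : ℕ) :
    L2Vec P fun ω => g.errState K (X₀ ω) (fun k => ξ k ω) (fun k => W k ω) t := by
  induction t with
  | zero => exact hstd.memLp_X₀.l2Vec
  | succ t ih =>
    exact ((ih.mulVec _).add (hstd.memLp_W t).l2Vec).sub ((hstd.memLp_ξ t).l2Vec.mulVec _)

theorem l2Vec_innov (t : ℕ) :
    L2Vec P fun ω => g.innov K (X₀ ω) (fun k => ξ k ω) (fun k => W k ω) t :=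
  ((l2Vec_errState hstd K t).mulVec _).add (hstd.memLp_ξ t).l2Vec

theorem meanVec_errState_succ (t : ℕ) :
    meanVec P (fun ω => g.errState K (X₀ ω) (fun k => ξ k ω) (fun k => W k ω) (t + 1)) =
      (g.Ac - K * g.Dc) *ᵥ
        meanVec P (fun ω => g.errState K (X₀ ω) (fun k => ξ k ω) (fun k => W k ω) t)
        + meanVec P (W 0) - K *ᵥ meanVec P (ξ 0) := by
  have h1 := l2Vec_errState hstd K t
  have h2 := (hstd.memLp_W t).l2Vec
  have h3 := (hstd.memLp_ξ t).l2Vec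
  have hW : meanVec P (W t) = meanVec P (W 0) := funext fun j =>
    ((hstd.identDistrib_W t).comp (measurable_pi_apply j)).integral_eq
  have hξ : meanVec P (ξ t) = meanVec P (ξ 0) := funext fun j =>
    ((hstd.identDistrib_ξ t).comp (measurable_pi_apply j)).integral_eq
  simp only [errState]
  rw [meanVec_sub ((h1.mulVec _).add h2) (h3.mulVec _), meanVec_add (h1.mulVec _) h2,
    meanVec_mulVec h1, meanVec_mulVec h3, hW, hξ]

/-- The error at `t` involves only `X₀` and the noises before `t`. -/
theorem crossCov_errState_noise (t : ℕ) :
    (∀ s, t ≤ s → crossCov P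
      (fun ω => g.errState K (X₀ ω) (fun k => ξ k ω) (fun k => W k ω) t) (W s) = 0) ∧
    ∀ s, t ≤ s → crossCov P
      (fun ω => g.errState K (X₀ ω) (fun k => ξ k ω) (fun k => W k ω) t) (ξ s) = 0 := by
  have hW := fun t => (hstd.memLp_W t).l2Vec
  have hξ := fun t => (hstd.memLp_ξ t).l2Vec
  induction t with
  | zero =>
    exact ⟨fun s _ => crossCov_eq_zero_of_indepFun (hstd.indepFun_X₀_W s) hstd.memLp_X₀.l2Vec (hW s),
      fun s _ => crossCov_eq_zero_of_indepFun (hstd.indepFun_X₀_ξ s) hstd.memLp_X₀.l2Vec (hξ s)⟩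
  | succ t ih =>
    have h1 := l2Vec_errState hstd K t
    simp only [errState]
    constructor
    · intro s hs
      rw [crossCov_sub_left ((h1.mulVec _).add (hW t)) ((hξ t).mulVec _) (hW s),
        crossCov_add_left (h1.mulVec _) (hW t) (hW s), crossCov_mulVec_left h1 (hW s),
        crossCov_mulVec_left (hξ t) (hW s), ih.1 s (by omega),
        crossCov_eq_zero_of_indepFun (hstd.indepFun_W_W (by omega : t ≠ s)) (hW t) (hW s),
        crossCov_eq_zero_of_indepFun (hstd.indepFun_W_ξ s t).symm (hξ t) (hW s)]
      simp
    · intro s hs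
      rw [crossCov_sub_left ((h1.mulVec _).add (hW t)) ((hξ t).mulVec _) (hξ s),
        crossCov_add_left (h1.mulVec _) (hW t) (hξ s), crossCov_mulVec_left h1 (hξ s),
        crossCov_mulVec_left (hξ t) (hξ s), ih.2 s (by omega),
        crossCov_eq_zero_of_indepFun (hstd.indepFun_ξ_ξ (by omega : t ≠ s)) (hξ t) (hξ s),
        crossCov_eq_zero_of_indepFun (hstd.indepFun_W_ξ t s) (hW t) (hξ s)]
      simp

theorem crossCov_noise_self (t : ℕ) : crossCov P (W t) (W t) = covMat P (W 0) ∧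
    crossCov P (ξ t) (ξ t) = covMat P (ξ 0) :=
  ⟨covMat_congr_identDistrib (hstd.identDistrib_W t),
    covMat_congr_identDistrib (hstd.identDistrib_ξ t)⟩

theorem crossCov_errState_innov_self (t : ℕ) :
    crossCov P (fun ω => g.errState K (X₀ ω) (fun k => ξ k ω) (fun k => W k ω) t)
      (fun ω => g.innov K (X₀ ω) (fun k => ξ k ω) (fun k => W k ω) t) =
    crossCov P (fun ω => g.errState K (X₀ ω) (fun k => ξ k ω) (fun k => W k ω) t)
      (fun ω => g.errState K (X₀ ω) (fun k => ξ k ω) (fun k => W k ω) t) * g.Dcᵀ := by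
  have h1 := l2Vec_errState hstd K t
  have hξ := (hstd.memLp_ξ t).l2Vec
  simp only [innov]
  rw [crossCov_add_right (h1.mulVec _) hξ h1, crossCov_mulVec_right h1 h1,
    (crossCov_errState_noise hstd K t).2 t le_rfl, add_zero]

variable {K} {Sig : Matrix g.SIdx g.SIdx ℝ}
  (hK : K * (g.Dc * Sig * g.Dcᵀ + covMat P (ξ 0)) = g.Ac * Sig * g.Dcᵀ)
  (hcov : covMat P X₀ = Sig)
  (hric : Sig = g.Ac * Sig * g.Acᵀ - K * g.Dc * Sig * g.Acᵀ + covMat P (W 0))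
include hK hcov hric

/-- The Riccati equation makes `Σ` invariant under the error recursion and `cov[X₀] = Σ` starts it
there. This is why a constant gain is exact at every time and not only asymptotically. -/
theorem crossCov_errState_self (t : ℕ) :
    crossCov P (fun ω => g.errState K (X₀ ω) (fun k => ξ k ω) (fun k => W k ω) t)
      (fun ω => g.errState K (X₀ ω) (fun k => ξ k ω) (fun k => W k ω) t) = Sig := by
  have hW := (hstd.memLp_W t).l2Vec
  have hξ := (hstd.memLp_ξ t).l2Vec
  induction t with
  | zero => exact hcov
  | succ t ih =>
    have hW := (hstd.memLp_W t).l2Vec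
    have hξ := (hstd.memLp_ξ t).l2Vec
    have h1 := l2Vec_errState hstd K t
    have hn := crossCov_errState_noise hstd K t
    have h2 := ((h1.mulVec (g.Ac - K * g.Dc)).add hW).sub (hξ.mulVec K)
    have c1 := hn.1 t le_rfl
    have c2 := hn.2 t le_rfl
    have c3 := congrArg Matrix.transpose c1
    have c4 := congrArg Matrix.transpose c2
    have c5 := crossCov_eq_zero_of_indepFun (hstd.indepFun_W_ξ t t) hW hξ
    have c6 := crossCov_eq_zero_of_indepFun (hstd.indepFun_W_ξ t t).symm hξ hW
    rw [crossCov_transpose, Matrix.transpose_zero] at c3 c4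
    obtain ⟨c7, c8⟩ := crossCov_noise_self hstd t
    simp only [errState]
    rw [crossCov_sub_left ((h1.mulVec _).add hW) (hξ.mulVec _) h2,
      crossCov_add_left (h1.mulVec _) hW h2, crossCov_mulVec_left h1 h2,
      crossCov_mulVec_left hξ h2,
      crossCov_sub_right ((h1.mulVec _).add hW) (hξ.mulVec _) h1,
      crossCov_add_right (h1.mulVec _) hW h1, crossCov_mulVec_right h1 h1,
      crossCov_mulVec_right hξ h1,
      crossCov_sub_right ((h1.mulVec _).add hW) (hξ.mulVec _) hW,
      crossCov_add_right (h1.mulVec _) hW hW, crossCov_mulVec_right h1 hW,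
      crossCov_mulVec_right hξ hW,
      crossCov_sub_right ((h1.mulVec _).add hW) (hξ.mulVec _) hξ,
      crossCov_add_right (h1.mulVec _) hW hξ, crossCov_mulVec_right h1 hξ,
      crossCov_mulVec_right hξ hξ, c1, c2, c3, c4, c5, c6, c7, c8, ih (hstd.memLp_W t).l2Vec hξ]
    -- The gain equation eliminates `K V K'`; the terms quadratic in `K` cancel and the covariance
    -- recursion reduces to `hric`.
    have hK' : K * covMat P (ξ 0) * Kᵀ = g.Ac * Sig * g.Dcᵀ * Kᵀ
        - K * (g.Dc * Sig * g.Dcᵀ) * Kᵀ := by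
      rw [← hK, Matrix.mul_add, Matrix.add_mul, add_sub_cancel_left]
    have hK'' : K * (covMat P (ξ 0) * Kᵀ) = g.Ac * Sig * g.Dcᵀ * Kᵀ
        - K * (g.Dc * Sig * g.Dcᵀ) * Kᵀ := by rw [← hK', Matrix.mul_assoc]
    conv_rhs => rw [hric]
    simp only [Matrix.zero_mul, add_zero, zero_add, sub_zero, zero_sub,
      Matrix.mul_neg, sub_neg_eq_add, hK'', Matrix.transpose_sub, Matrix.transpose_mul,
      Matrix.sub_mul, Matrix.mul_sub, Matrix.mul_assoc]
    abel

/-- The gain is the one that makes the next error uncorrelated with the current innovation: `(𝒜 - K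
𝒟) Σ 𝒟' = K V`. Later errors only multiply this zero by `𝒜 - K 𝒟` and add fresh noise, hence the
induction on the time gap. -/
theorem crossCov_errState_innov {s t : ℕ} (hst : s < t) :
    crossCov P (fun ω => g.errState K (X₀ ω) (fun k => ξ k ω) (fun k => W k ω) t)
      (fun ω => g.innov K (X₀ ω) (fun k => ξ k ω) (fun k => W k ω) s) = 0 := by
  obtain ⟨n, rfl⟩ := Nat.exists_eq_add_of_lt hst
  clear hst
  have hin := l2Vec_innov hstd K s
  have hWs : ∀ t, s ≤ t → crossCov P (W t)
      (fun ω => g.innov K (X₀ ω) (fun k => ξ k ω) (fun k => W k ω) s) = 0 := by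
    intro t hst
    have h1 := l2Vec_errState hstd K s
    have hW := (hstd.memLp_W t).l2Vec
    have hξ := (hstd.memLp_ξ s).l2Vec
    simp only [innov]
    rw [crossCov_add_right (h1.mulVec _) hξ hW, crossCov_mulVec_right h1 hW,
      crossCov_eq_zero_of_indepFun (hstd.indepFun_W_ξ t s) hW hξ, ← crossCov_transpose,
      (crossCov_errState_noise hstd K s).1 t hst]
    simp
  have hstep : ∀ t, s ≤ t → crossCov P
      (fun ω => g.errState K (X₀ ω) (fun k => ξ k ω) (fun k => W k ω) (t + 1))
      (fun ω => g.innov K (X₀ ω) (fun k => ξ k ω) (fun k => W k ω) s) =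
      (g.Ac - K * g.Dc) * crossCov P
        (fun ω => g.errState K (X₀ ω) (fun k => ξ k ω) (fun k => W k ω) t)
        (fun ω => g.innov K (X₀ ω) (fun k => ξ k ω) (fun k => W k ω) s)
      - K * crossCov P (ξ t)
        (fun ω => g.innov K (X₀ ω) (fun k => ξ k ω) (fun k => W k ω) s) := by
    intro t hst
    have h1 := l2Vec_errState hstd K t
    have hW := (hstd.memLp_W t).l2Vec
    have hξ := (hstd.memLp_ξ t).l2Vec
    conv_lhs => simp only [errState]
    rw [crossCov_sub_left ((h1.mulVec _).add hW) (hξ.mulVec _) hin,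
      crossCov_add_left (h1.mulVec _) hW hin, crossCov_mulVec_left h1 hin,
      crossCov_mulVec_left hξ hin, hWs t hst, add_zero]
  have hξs : ∀ t, s ≤ t → crossCov P (ξ t)
      (fun ω => g.innov K (X₀ ω) (fun k => ξ k ω) (fun k => W k ω) s) = crossCov P (ξ t) (ξ s) := by
    intro t hst
    have h1 := l2Vec_errState hstd K s
    have hξt := (hstd.memLp_ξ t).l2Vec
    have hξ := (hstd.memLp_ξ s).l2Vec
    simp only [innov]
    rw [crossCov_add_right (h1.mulVec _) hξ hξt, crossCov_mulVec_right h1 hξt,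
      ← crossCov_transpose, (crossCov_errState_noise hstd K s).2 t hst]
    simp
  induction n with
  | zero =>
    rw [add_zero, hstep s le_rfl, crossCov_errState_innov_self hstd K s,
      crossCov_errState_self hstd hK hcov hric, hξs s le_rfl, (crossCov_noise_self hstd s).2,
      Matrix.sub_mul, sub_sub, sub_eq_zero, ← Matrix.mul_assoc, ← hK, Matrix.mul_add]
    simp only [Matrix.mul_assoc]
  | succ n ih =>
    rw [show s + (n + 1) + 1 = (s + n + 1) + 1 by ring, hstep _ (by omega), ih, hξs _ (by omega),
      crossCov_eq_zero_of_indepFun (hstd.indepFun_ξ_ξ (by omega)) (hstd.memLp_ξ _).l2Vec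
        (hstd.memLp_ξ _).l2Vec]
    simp

theorem crossCov_innov_innov {s t : ℕ} (hst : s < t) :
    crossCov P (fun ω => g.innov K (X₀ ω) (fun k => ξ k ω) (fun k => W k ω) t)
      (fun ω => g.innov K (X₀ ω) (fun k => ξ k ω) (fun k => W k ω) s) = 0 := by
  have hin := l2Vec_innov hstd K s
  have h1 := l2Vec_errState hstd K t
  have h1s := l2Vec_errState hstd K s
  have hξ := (hstd.memLp_ξ t).l2Vec
  have hξs := (hstd.memLp_ξ s).l2Vec
  have e1 : crossCov P (ξ t)
      (fun ω => g.innov K (X₀ ω) (fun k => ξ k ω) (fun k => W k ω) s) = 0 := by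
    simp only [innov]
    rw [crossCov_add_right (h1s.mulVec _) hξs hξ, crossCov_mulVec_right h1s hξ,
      ← crossCov_transpose, (crossCov_errState_noise hstd K s).2 t hst.le,
      crossCov_eq_zero_of_indepFun (hstd.indepFun_ξ_ξ hst.ne') hξ hξs]
    simp
  calc _ = g.Dc * crossCov P (fun ω => g.errState K (X₀ ω) (fun k => ξ k ω) (fun k => W k ω) t)
        (fun ω => g.innov K (X₀ ω) (fun k => ξ k ω) (fun k => W k ω) s) + crossCov P (ξ t)
        (fun ω => g.innov K (X₀ ω) (fun k => ξ k ω) (fun k => W k ω) s) := by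
        rw [← crossCov_mulVec_left h1 hin, ← crossCov_add_left (h1.mulVec _) hξ hin]
        rfl
    _ = 0 := by rw [crossCov_errState_innov hstd hK hcov hric hst, e1]; simp

end EstimationError

/-! ### From uncorrelated to independent in the Gaussian case. -/

section Gaussian

variable {g : LQGame} {Ω : Type*} [MeasurableSpace Ω] {P : Measure Ω} [IsProbabilityMeasure P]
  {X₀ : Ω → g.X} {ξ : ℕ → Ω → g.Y} {W : ℕ → Ω → g.X}

theorem errState_mem_span (K : Matrix g.SIdx (Fin g.ny) ℝ) (t : ℕ) (j : g.SIdx) :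
    (fun ω => g.errState K (X₀ ω) (fun k => ξ k ω) (fun k => W k ω) t j) ∈
      Submodule.span ℝ (Set.range (Sum.elim (fun (j : g.SIdx) ω => X₀ ω j)
        (Sum.elim (fun (q : ℕ × Fin g.ny) ω => ξ q.1 ω q.2)
          (fun (q : ℕ × g.SIdx) ω => W q.1 ω q.2)))) := by
  induction t generalizing j with
  | zero => exact Submodule.subset_span ⟨.inl j, rfl⟩
  | succ t ih =>
    have h1 : (fun ω => g.errState K (X₀ ω) (fun k => ξ k ω) (fun k => W k ω) (t + 1) j) =
        ∑ s, (g.Ac - K * g.Dc) j s •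
          (fun ω => g.errState K (X₀ ω) (fun k => ξ k ω) (fun k => W k ω) t s)
        + (fun ω => W t ω j) - ∑ s, K j s • fun ω => ξ t ω s := by
      funext ω
      simp [errState, Matrix.mulVec, dotProduct]
    rw [h1]
    refine Submodule.sub_mem _ (Submodule.add_mem _ (Submodule.sum_mem _ fun s _ =>
      Submodule.smul_mem _ _ (ih s)) (Submodule.subset_span ⟨.inr (.inr (t, j)), rfl⟩))
      (Submodule.sum_mem _ fun s _ =>
      Submodule.smul_mem _ _ (Submodule.subset_span ⟨.inr (.inl (t, s)), rfl⟩))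

theorem innov_mem_span (K : Matrix g.SIdx (Fin g.ny) ℝ) (t : ℕ) (j : Fin g.ny) :
    (fun ω => g.innov K (X₀ ω) (fun k => ξ k ω) (fun k => W k ω) t j) ∈
      Submodule.span ℝ (Set.range (Sum.elim (fun (j : g.SIdx) ω => X₀ ω j)
        (Sum.elim (fun (q : ℕ × Fin g.ny) ω => ξ q.1 ω q.2)
          (fun (q : ℕ × g.SIdx) ω => W q.1 ω q.2)))) := by
  have h1 : (fun ω => g.innov K (X₀ ω) (fun k => ξ k ω) (fun k => W k ω) t j) =
      ∑ s, g.Dc j s • (fun ω => g.errState K (X₀ ω) (fun k => ξ k ω) (fun k => W k ω) t s)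
      + (fun ω => ξ t ω j) := by
    funext ω
    simp [innov, Matrix.mulVec, dotProduct]
  rw [h1]
  exact Submodule.add_mem _ (Submodule.sum_mem _ fun s _ =>
    Submodule.smul_mem _ _ (errState_mem_span K t s))
    (Submodule.subset_span ⟨.inr (.inl (t, j)), rfl⟩)

variable (hstd : g.StandingAssumptions P X₀ ξ W) (hgauss : g.IsJointlyGaussian P X₀ ξ W)
  {K : Matrix g.SIdx (Fin g.ny) ℝ} {Sig : Matrix g.SIdx g.SIdx ℝ}
  (hK : K * (g.Dc * Sig * g.Dcᵀ + covMat P (ξ 0)) = g.Ac * Sig * g.Dcᵀ)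
  (hcov : covMat P X₀ = Sig)
  (hric : Sig = g.Ac * Sig * g.Acᵀ - K * g.Dc * Sig * g.Acᵀ + covMat P (W 0))
include hstd hgauss hK hcov hric

/-- Gaussianity enters here and in the next lemma: both families lie in the span of the primitives,
so zero covariance implies independence, and from all past innovations jointly. -/
theorem indepFun_errState_innov (t : ℕ) :
    IndepFun (fun ω => g.errState K (X₀ ω) (fun k => ξ k ω) (fun k => W k ω) t)
      (fun ω (k : Fin t) => g.innov K (X₀ ω) (fun k => ξ k ω) (fun k => W k ω) k) P := by
  have h := IsGaussianProcess.indepFun_of_covariance_eq_zero (P := P)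
    (X := fun (j : g.SIdx) ω => g.errState K (X₀ ω) (fun k => ξ k ω) (fun k => W k ω) t j)
    (Y := fun (q : Fin t × Fin g.ny) ω =>
      g.innov K (X₀ ω) (fun k => ξ k ω) (fun k => W k ω) q.1 q.2)
    (IsGaussianProcess.of_mem_span hgauss ?_) (fun j => (l2Vec_errState hstd K t j).1.aemeasurable)
    (fun q => (l2Vec_innov hstd K q.1 q.2).1.aemeasurable) ?_
  · exact h.comp measurable_id (ψ := fun v (k : Fin t) (j : Fin g.ny) => v (k, j))
      (measurable_pi_lambda _ fun k => measurable_pi_lambda _ fun j => measurable_pi_apply _)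
  · rintro (j | q)
    · exact errState_mem_span K t j
    · exact innov_mem_span K q.1 q.2
  · intro j q
    exact congrFun (congrFun (crossCov_errState_innov hstd hK hcov hric q.1.2) j) q.2

theorem indepFun_innov_innov (t : ℕ) :
    IndepFun (fun ω => g.innov K (X₀ ω) (fun k => ξ k ω) (fun k => W k ω) t)
      (fun ω (k : Fin t) => g.innov K (X₀ ω) (fun k => ξ k ω) (fun k => W k ω) k) P := by
  have h := IsGaussianProcess.indepFun_of_covariance_eq_zero (P := P)
    (X := fun (j : Fin g.ny) ω => g.innov K (X₀ ω) (fun k => ξ k ω) (fun k => W k ω) t j)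
    (Y := fun (q : Fin t × Fin g.ny) ω =>
      g.innov K (X₀ ω) (fun k => ξ k ω) (fun k => W k ω) q.1 q.2)
    (IsGaussianProcess.of_mem_span hgauss ?_) (fun j => (l2Vec_innov hstd K t j).1.aemeasurable)
    (fun q => (l2Vec_innov hstd K q.1 q.2).1.aemeasurable) ?_
  · exact h.comp measurable_id (ψ := fun v (k : Fin t) (j : Fin g.ny) => v (k, j))
      (measurable_pi_lambda _ fun k => measurable_pi_lambda _ fun j => measurable_pi_apply _)
  · rintro (j | q)
    · exact innov_mem_span K t j
    · exact innov_mem_span K q.1 q.2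
  · intro j q
    exact congrFun (congrFun (crossCov_innov_innov hstd hK hcov hric q.1.2) j) q.2

end Gaussian

end LQGame


namespace LQGame

/-! ### The time-invariant filter computes the conditional expectations -/

section Filter

variable {g : LQGame}

/-- Separates the one-step prediction from the correction by the innovation. The total gain is `𝒞 +
K` because the output also drives the state directly through `𝒞`. -/
theorem filterStep_eq (ξhat : g.Y) (Ŵ : g.X) (a : ℕ → Matrix (Fin g.ny) g.SIdx ℝ) (b : ℕ → g.Y)
    (K : Matrix g.SIdx (Fin g.ny) ℝ) (x : g.X) (y : g.Y) :
    g.filterStep ξhat Ŵ a b K x y = g.predState ξhat Ŵ a b x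
      + (g.Cc + K) *ᵥ (y - g.predOutput ξhat Ŵ a b x) := by
  rw [filterStep, predState, predOutput, Matrix.add_mulVec g.Cc, sub_sub y, sub_sub y,
    Matrix.mulVec_sub g.Cc]
  abel

theorem l2Vec_filterState {Ω : Type*} [MeasurableSpace Ω] {P : Measure Ω} [IsFiniteMeasure P]
    (m₀ ξhat Ŵ) (a : ℕ → Matrix (Fin g.ny) g.SIdx ℝ) (b : ℕ → g.Y)
    (K : Matrix g.SIdx (Fin g.ny) ℝ) {y : ℕ → Ω → g.Y} (hy : ∀ t, L2Vec P (y t)) (t : ℕ) :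
    L2Vec P fun ω => g.filterState m₀ ξhat Ŵ a b K t fun k => y k ω := by
  induction t with
  | zero => exact L2Vec.const _
  | succ t ih =>
    simp only [filterState, filterStep]
    exact (((((ih.mulVec _).add (ih.mulVec _)).add (L2Vec.const _)).add ((hy t).mulVec _)).add
      (L2Vec.const _)).add (((((hy t).sub (ih.mulVec _)).sub (L2Vec.const _)).sub
      (L2Vec.const _)).mulVec _)

theorem l2Vec_of_lintegral_le {Ω : Type*} [MeasurableSpace Ω] {P : Measure Ω} {ι : Type}
    [Fintype ι] {U : Ω → ι → ℝ} (hU : Measurable U) {c : ℝ≥0}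
    (h : ∫⁻ ω, ENNReal.ofReal (U ω ⬝ᵥ U ω) ∂P ≤ c) : L2Vec P U := by
  intro j
  have hm : Measurable fun ω => U ω j := (measurable_pi_apply j).comp hU
  refine (memLp_two_iff_integrable_sq hm.aestronglyMeasurable).2 ⟨(hm.pow_const 2).aestronglyMeasurable, ?_⟩
  rw [hasFiniteIntegral_iff_ofReal (ae_of_all _ fun ω => sq_nonneg _)]
  refine (lintegral_mono fun ω => ?_).trans_lt (h.trans_lt ENNReal.coe_lt_top)
  exact ENNReal.ofReal_le_ofReal (sq_le_dotProduct_self (U ω) j)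

end Filter

/-! ### The filter along the replica. -/

section ReplicaFilter

variable {g : LQGame} {Ω Ωbar : Type*} [MeasurableSpace Ω] [MeasurableSpace Ωbar]
  {P : Measure Ω} [IsProbabilityMeasure P] {Pbar : Measure Ωbar} [IsProbabilityMeasure Pbar]
  {X₀ : Ω → g.X} {ξ : ℕ → Ω → g.Y} {W : ℕ → Ω → g.X}
  (hstd : g.StandingAssumptions P X₀ ξ W) (hgauss : g.IsJointlyGaussian P X₀ ξ W)
  {K : Matrix g.SIdx (Fin g.ny) ℝ} {Sig : Matrix g.SIdx g.SIdx ℝ}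
  (hK : K * (g.Dc * Sig * g.Dcᵀ + covMat P (ξ 0)) = g.Ac * Sig * g.Dcᵀ)
  (hcov : covMat P X₀ = Sig)
  (hric : Sig = g.Ac * Sig * g.Acᵀ - K * g.Dc * Sig * g.Acᵀ + covMat P (W 0))
  {a : ℕ → Matrix (Fin g.ny) g.SIdx ℝ} {b : ℕ → g.Y}
  {X₀bar : Ωbar → g.X} {ξbar : ℕ → Ωbar → g.Y} {Wbar : ℕ → Ωbar → g.X}
  (hlaw : IdentDistrib
      (fun ω => (X₀bar ω, (fun t => ξbar t ω : ℕ → g.Y), (fun t => Wbar t ω : ℕ → g.X)))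
      (fun ω => (X₀ ω, (fun t => ξ t ω : ℕ → g.Y), (fun t => W t ω : ℕ → g.X))) Pbar P)
  {Xbar : ℕ → Ωbar → g.X} {ybar : ℕ → Ωbar → g.Y}
  (hrep : g.IsReplica Pbar (meanVec P (W 0)) a b X₀bar ξbar Wbar Xbar ybar)
  (hy2 : ∀ t, L2Vec Pbar (ybar t))
include hstd hgauss hK hcov hric hlaw hrep hy2

/-- Given the decomposition of the state into the filter state and an error that is a function of
the primitive random variables, the filter state is the conditional expectation. -/
theorem condExp_eq_filterState {t : ℕ}
    (hX : ∀ᵐ ω ∂Pbar, Xbar t ω =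
      g.filterState (meanVec P X₀) (meanVec P (ξ 0)) (meanVec P (W 0)) a b K t (fun k => ybar k ω)
      + (g.errState K (X₀bar ω) (fun k => ξbar k ω) (fun k => Wbar k ω) t
        - meanVec P fun ω => g.errState K (X₀ ω) (fun k => ξ k ω) (fun k => W k ω) t))
    {φ : (Fin t → g.Y) → (Fin t → g.Y)} (hφ : Measurable φ)
    (hy : ∀ᵐ ω ∂Pbar, (fun k : Fin t => ybar k ω) =
      φ fun k => g.innov K (X₀bar ω) (fun k => ξbar k ω) (fun k => Wbar k ω) k) :
    (fun ω => g.filterState (meanVec P X₀) (meanVec P (ξ 0)) (meanVec P (W 0)) a b K t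
      fun k => ybar k ω) =ᵐ[Pbar] Pbar[Xbar t | g.pastSigma ybar t] := by
  set f : (Fin t → g.Y) → g.X :=
    g.filterState (meanVec P X₀) (meanVec P (ξ 0)) (meanVec P (W 0)) a b K t with hf
  have hfm : Measurable f := (g.continuous_filterState _ _ _ a b K t).measurable
  set m : g.X := meanVec P fun ω => g.errState K (X₀ ω) (fun k => ξ k ω) (fun k => W k ω) t with hm
  have hYm : Measurable fun ω (k : Fin t) => ybar k ω :=
    measurable_pi_lambda _ fun k => hrep.measurable_y k
  have hle : g.pastSigma ybar t ≤ ‹MeasurableSpace Ωbar› := hYm.comap_le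
  -- Independence is a property of the joint law, so it passes from the primitives of the game to
  -- those of the replica.
  have hind : IndepFun (fun ω => g.errState K (X₀bar ω) (fun k => ξbar k ω) (fun k => Wbar k ω) t)
      (fun ω (k : Fin t) => g.innov K (X₀bar ω) (fun k => ξbar k ω) (fun k => Wbar k ω) k) Pbar :=
    indepFun_of_identDistrib_pair (indepFun_errState_innov hstd hgauss hK hcov hric t)
      (hlaw.symm.comp ((measurable_errState K t).prodMk
        (measurable_pi_lambda _ fun k : Fin t => measurable_innov K k)))
  have hid : IdentDistrib
      (fun ω => g.errState K (X₀bar ω) (fun k => ξbar k ω) (fun k => Wbar k ω) t)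
      (fun ω => g.errState K (X₀ ω) (fun k => ξ k ω) (fun k => W k ω) t) Pbar P :=
    hlaw.comp (measurable_errState K t)
  set d : Ωbar → g.X := fun ω => Xbar t ω - f fun k => ybar k ω with hd
  have hdm : Measurable d := (hrep.measurable_X t).sub (hfm.comp hYm)
  have hdae : (fun ω => g.errState K (X₀bar ω) (fun k => ξbar k ω) (fun k => Wbar k ω) t - m)
      =ᵐ[Pbar] d := by
    filter_upwards [hX] with ω hω
    rw [hd]
    simp only [hω, add_sub_cancel_left]
  -- Past outputs are a function of past innovations, so the error is independent of them as well;
  -- its conditional expectation is then its mean, which is zero.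
  have hdind : IndepFun d (fun ω (k : Fin t) => ybar k ω) Pbar :=
    (hind.comp (measurable_id.sub_const m) hφ).congr hdae
      (hy.mono fun ω hω => hω.symm)
  have herr2 : L2Vec Pbar
      fun ω => g.errState K (X₀bar ω) (fun k => ξbar k ω) (fun k => Wbar k ω) t := fun j =>
    ((hid.comp (measurable_pi_apply j)).memLp_iff).2 (l2Vec_errState hstd K t j)
  have hd2 : L2Vec Pbar d := (herr2.sub (L2Vec.const m)).congr hdae
  have hfi : Integrable (fun ω => f fun k => ybar k ω) Pbar :=
    (l2Vec_filterState _ _ _ a b K hy2 t).integrable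
  have hdmean : ∫ ω, d ω ∂Pbar = 0 := by
    funext j
    rw [eval_integral fun j => hd2.integrable_apply j]
    have h1 : ∫ ω, d ω j ∂Pbar = ∫ ω, (g.errState K (X₀bar ω) (fun k => ξbar k ω)
        (fun k => Wbar k ω) t j - m j) ∂Pbar :=
      integral_congr_ae (hdae.mono fun ω hω => (congrFun hω j).symm)
    have h2 := (hid.comp (measurable_pi_apply j)).integral_eq
    simp only [Function.comp_def] at h2
    rw [h1, integral_sub (herr2.integrable_apply j) (integrable_const _), h2]
    simp [hm, meanVec]
  have h1 : Pbar[d | g.pastSigma ybar t] =ᵐ[Pbar] fun _ => ∫ ω, d ω ∂Pbar :=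
    condExp_indep_eq hdm.comap_le hle (comap_measurable d).stronglyMeasurable
      ((IndepFun_iff_Indep _ _ _).1 hdind)
  have h2 : Pbar[fun ω => f fun k => ybar k ω | g.pastSigma ybar t] =
      fun ω => f fun k => ybar k ω :=
    condExp_of_stronglyMeasurable hle
      (hfm.comp (comap_measurable _)).stronglyMeasurable hfi
  have h3 : Xbar t = (fun ω => f fun k => ybar k ω) + d := by
    funext ω
    simp [hd]
  have h4 := condExp_add hfi hd2.integrable (g.pastSigma ybar t)
  rw [← h3, h2] at h4
  filter_upwards [h1, h4] with ω e1 e4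
  rw [e4, Pi.add_apply, e1, hdmean, add_zero]

/-- The output at `t` contains the conditional expectation at `t`, so correctness of the filter
cannot be deferred until the process is known. The induction carries the error decomposition and the
reconstruction of past outputs from past innovations; these yield the conditional expectation at
`t`, hence the output at `t` and both facts at `t + 1`. -/
theorem replica_filter_invariant (t : ℕ) :
    (∀ᵐ ω ∂Pbar, Xbar t ω =
      g.filterState (meanVec P X₀) (meanVec P (ξ 0)) (meanVec P (W 0)) a b K t (fun k => ybar k ω)
      + (g.errState K (X₀bar ω) (fun k => ξbar k ω) (fun k => Wbar k ω) t
        - meanVec P fun ω => g.errState K (X₀ ω) (fun k => ξ k ω) (fun k => W k ω) t)) ∧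
    (∃ φ : (Fin t → g.Y) → (Fin t → g.Y), Measurable φ ∧
      ∀ᵐ ω ∂Pbar, (fun k : Fin t => ybar k ω) =
        φ fun k => g.innov K (X₀bar ω) (fun k => ξbar k ω) (fun k => Wbar k ω) k) ∧
    ∀ᵐ ω ∂Pbar, ybar t ω = g.predOutput (meanVec P (ξ 0)) (meanVec P (W 0)) a b
        (g.filterState (meanVec P X₀) (meanVec P (ξ 0)) (meanVec P (W 0)) a b K t fun k => ybar k ω)
      + (g.innov K (X₀bar ω) (fun k => ξbar k ω) (fun k => Wbar k ω) t
        - meanVec P fun ω => g.innov K (X₀ ω) (fun k => ξ k ω) (fun k => W k ω) t) := by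
  have hinnov : ∀ t, meanVec P (fun ω => g.innov K (X₀ ω) (fun k => ξ k ω) (fun k => W k ω) t) =
      g.Dc *ᵥ meanVec P (fun ω => g.errState K (X₀ ω) (fun k => ξ k ω) (fun k => W k ω) t)
        + meanVec P (ξ 0) := by
    intro t
    have hξ : meanVec P (ξ t) = meanVec P (ξ 0) := funext fun j =>
      ((hstd.identDistrib_ξ t).comp (measurable_pi_apply j)).integral_eq
    have h1 := l2Vec_errState hstd K t
    simp only [innov]
    rw [meanVec_add (h1.mulVec _) (hstd.memLp_ξ t).l2Vec, meanVec_mulVec h1, hξ]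
  have hout : ∀ t, (∀ᵐ ω ∂Pbar, Xbar t ω =
      g.filterState (meanVec P X₀) (meanVec P (ξ 0)) (meanVec P (W 0)) a b K t (fun k => ybar k ω)
      + (g.errState K (X₀bar ω) (fun k => ξbar k ω) (fun k => Wbar k ω) t
        - meanVec P fun ω => g.errState K (X₀ ω) (fun k => ξ k ω) (fun k => W k ω) t)) →
    (∃ φ : (Fin t → g.Y) → (Fin t → g.Y), Measurable φ ∧
      ∀ᵐ ω ∂Pbar, (fun k : Fin t => ybar k ω) =
        φ fun k => g.innov K (X₀bar ω) (fun k => ξbar k ω) (fun k => Wbar k ω) k) →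
    ∀ᵐ ω ∂Pbar, ybar t ω = g.predOutput (meanVec P (ξ 0)) (meanVec P (W 0)) a b
        (g.filterState (meanVec P X₀) (meanVec P (ξ 0)) (meanVec P (W 0)) a b K t fun k => ybar k ω)
      + (g.innov K (X₀bar ω) (fun k => ξbar k ω) (fun k => Wbar k ω) t
        - meanVec P fun ω => g.innov K (X₀ ω) (fun k => ξ k ω) (fun k => W k ω) t) := by
    intro t hX hφ
    obtain ⟨φ, hφm, hφ⟩ := hφ
    have hc := condExp_eq_filterState hstd hgauss hK hcov hric hlaw hrep hy2 hX hφm hφ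
    filter_upwards [hX, hc, hrep.output t] with ω h1 h2 h3
    rw [h3, ← h2, h1, hinnov, predOutput, innov, Matrix.add_mulVec, Matrix.mulVec_add g.Dc,
      Matrix.mulVec_sub]
    abel
  have hinv : ∀ t, (∀ᵐ ω ∂Pbar, Xbar t ω =
      g.filterState (meanVec P X₀) (meanVec P (ξ 0)) (meanVec P (W 0)) a b K t (fun k => ybar k ω)
      + (g.errState K (X₀bar ω) (fun k => ξbar k ω) (fun k => Wbar k ω) t
        - meanVec P fun ω => g.errState K (X₀ ω) (fun k => ξ k ω) (fun k => W k ω) t)) ∧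
    (∃ φ : (Fin t → g.Y) → (Fin t → g.Y), Measurable φ ∧
      ∀ᵐ ω ∂Pbar, (fun k : Fin t => ybar k ω) =
        φ fun k => g.innov K (X₀bar ω) (fun k => ξbar k ω) (fun k => Wbar k ω) k) := by
    intro t
    induction t with
    | zero =>
      refine ⟨?_, id, measurable_id, ae_of_all _ fun ω => funext fun k => k.elim0⟩
      filter_upwards [hrep.init] with ω hω
      rw [hω]
      simp [filterState, errState]
    | succ t ih =>
      obtain ⟨hX, φ, hφm, hφ⟩ := ih
      have ho := hout t hX ⟨φ, hφm, hφ⟩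
      have hc := condExp_eq_filterState hstd hgauss hK hcov hric hlaw hrep hy2 hX hφm hφ
      constructor
      · filter_upwards [hX, ho, hc, hrep.step t] with ω h1 h2 h3 h4
        rw [h4, ← h3]
        conv_rhs => rw [filterState]
        simp only [Fin.val_castSucc, Fin.val_last]
        rw [filterStep_eq, h2, add_sub_cancel_left, predState, h1, meanVec_errState_succ hstd,
          errState, hinnov, innov]
        simp only [Matrix.mulVec_add, Matrix.mulVec_sub, Matrix.add_mulVec, Matrix.sub_mulVec,
          Matrix.mulVec_mulVec, Matrix.add_mul]
        abel
      -- The new output is rebuilt as the prediction from the already rebuilt past plus the centred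
      -- current innovation.
      · refine ⟨fun ν => Fin.snoc (α := fun _ => g.Y) (φ fun k => ν k.castSucc)
          (g.predOutput (meanVec P (ξ 0)) (meanVec P (W 0)) a b
            (g.filterState (meanVec P X₀) (meanVec P (ξ 0)) (meanVec P (W 0)) a b K t
              (φ fun k => ν k.castSucc)) + (ν (Fin.last t)
            - meanVec P fun ω => g.innov K (X₀ ω) (fun k => ξ k ω) (fun k => W k ω) t)), ?_, ?_⟩
        · have hcast : Measurable fun ν : Fin (t + 1) → g.Y => φ fun k : Fin t => ν k.castSucc :=
            hφm.comp (measurable_pi_lambda _ fun k => measurable_pi_apply _)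
          refine measurable_pi_lambda _ fun k => ?_
          refine Fin.lastCases ?_ (fun j => ?_) k
          · simp only [Fin.snoc_last, predOutput]
            refine Measurable.add (((Measurable.add_const ?_ _)).add_const _)
              ((measurable_pi_apply _).sub_const _)
            exact (Continuous.matrix_mulVec continuous_const continuous_id).measurable.comp
              ((g.continuous_filterState _ _ _ a b K t).measurable.comp hcast)
          · simpa only [Fin.snoc_castSucc, Function.comp_def] using (measurable_pi_apply j).comp hcast
        · filter_upwards [hφ, ho] with ω h1 h2
          funext k
          refine Fin.lastCases ?_ (fun j => ?_) k
          · simp only [Fin.snoc_last, Fin.val_last, Fin.val_castSucc]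
            rw [← h1]
            exact h2
          · simp only [Fin.snoc_castSucc, Fin.val_castSucc]
            exact congrFun h1 j
  exact ⟨(hinv t).1, (hinv t).2, hout t (hinv t).1 (hinv t).2⟩

theorem isStateEstimator_filterMap : g.IsStateEstimator Pbar Xbar ybar
    (g.filterMap (meanVec P X₀) (meanVec P (ξ 0)) (meanVec P (W 0)) a b K) := by
  intro t
  obtain ⟨hX, ⟨φ, hφm, hφ⟩, -⟩ :=
    replica_filter_invariant hstd hgauss hK hcov hric hlaw hrep hy2 t
  exact condExp_eq_filterState hstd hgauss hK hcov hric hlaw hrep hy2 hX hφm hφ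

/-- The innovations are centred and independent of the past environment variables. -/
theorem innovation_indepFun (t : ℕ) :
    IndepFun (fun ω (k : Fin t) => ybar k ω)
      (fun ω => ybar t ω - g.predOutput (meanVec P (ξ 0)) (meanVec P (W 0)) a b
        (g.filterState (meanVec P X₀) (meanVec P (ξ 0)) (meanVec P (W 0)) a b K t fun k => ybar k ω))
      Pbar ∧
    ∀ j, ∫ ω, (ybar t ω - g.predOutput (meanVec P (ξ 0)) (meanVec P (W 0)) a b
        (g.filterState (meanVec P X₀) (meanVec P (ξ 0)) (meanVec P (W 0)) a b K t
          fun k => ybar k ω)) j ∂Pbar = 0 := by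
  obtain ⟨-, ⟨φ, hφm, hφ⟩, hy⟩ :=
    replica_filter_invariant hstd hgauss hK hcov hric hlaw hrep hy2 t
  set m := meanVec P fun ω => g.innov K (X₀ ω) (fun k => ξ k ω) (fun k => W k ω) t with hm
  have hae : (fun ω => g.innov K (X₀bar ω) (fun k => ξbar k ω) (fun k => Wbar k ω) t - m)
      =ᵐ[Pbar] fun ω => ybar t ω - g.predOutput (meanVec P (ξ 0)) (meanVec P (W 0)) a b
        (g.filterState (meanVec P X₀) (meanVec P (ξ 0)) (meanVec P (W 0)) a b K t
          fun k => ybar k ω) := by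
    filter_upwards [hy] with ω hω
    rw [eq_sub_iff_add_eq, add_comm]
    exact hω.symm
  have hid : IdentDistrib
      (fun ω => g.innov K (X₀bar ω) (fun k => ξbar k ω) (fun k => Wbar k ω) t)
      (fun ω => g.innov K (X₀ ω) (fun k => ξ k ω) (fun k => W k ω) t) Pbar P :=
    hlaw.comp (measurable_innov K t)
  constructor
  · have hind : IndepFun
        (fun ω => g.innov K (X₀bar ω) (fun k => ξbar k ω) (fun k => Wbar k ω) t)
        (fun ω (k : Fin t) => g.innov K (X₀bar ω) (fun k => ξbar k ω) (fun k => Wbar k ω) k) Pbar :=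
      indepFun_of_identDistrib_pair (indepFun_innov_innov hstd hgauss hK hcov hric t)
        (hlaw.symm.comp ((measurable_innov K t).prodMk
          (measurable_pi_lambda _ fun k : Fin t => measurable_innov K k)))
    exact (hind.symm.comp hφm (measurable_id.sub_const m)).congr (hφ.mono fun ω hω => hω.symm) hae
  · intro j
    have h2 : Integrable (fun ω => g.innov K (X₀bar ω) (fun k => ξbar k ω)
        (fun k => Wbar k ω) t j) Pbar :=
      ((hid.comp (measurable_pi_apply j)).integrable_iff).2
        ((l2Vec_innov hstd K t).integrable_apply j)
    rw [← integral_congr_ae (hae.mono fun ω hω => congrFun hω j)]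
    simp only [Pi.sub_apply]
    have h3 := (hid.comp (measurable_pi_apply j)).integral_eq
    simp only [Function.comp_def] at h3
    rw [integral_sub h2 (integrable_const _), h3]
    simp [hm, meanVec]

end ReplicaFilter

end LQGame


/-! ### Extended-real expectations -/

section ExtendedExpectation

theorem posMinusNeg_eq_sub {p q : ℝ≥0∞} (hq : q ≠ ⊤) : posMinusNeg p q = (p : EReal) - q := by
  rw [posMinusNeg, EReal.neg_sub (Or.inl (EReal.coe_ennreal_ne_bot q))
    (Or.inl (mt EReal.coe_ennreal_eq_top_iff.1 hq)), add_comm, sub_eq_add_neg]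

theorem posMinusNeg_top (q : ℝ≥0∞) : posMinusNeg ⊤ q = ⊤ := by
  rw [posMinusNeg, EReal.coe_ennreal_top, EReal.sub_top, EReal.neg_bot]

theorem le_toENNReal_posMinusNeg_add (p q : ℝ≥0∞) : p ≤ (posMinusNeg p q).toENNReal + q := by
  rcases eq_or_ne q ⊤ with rfl | hq
  · simp
  · rw [posMinusNeg_eq_sub hq, EReal.toENNReal_sub (EReal.coe_ennreal_nonneg q),
      EReal.toENNReal_coe, EReal.toENNReal_coe]
    exact le_tsub_add

/-- Since `∞ - ∞` is read as `+∞`, an infinite positive part forces the value `⊤` whatever the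
negative part is. -/
theorem lintegral_toENNReal_ne_top {Ω : Type*} [MeasurableSpace Ω] {P : Measure Ω} {f : Ω → EReal}
    (h : extExp P f ≠ ⊤) : ∫⁻ ω, (f ω).toENNReal ∂P ≠ ⊤ := fun h' => h (by
  rw [extExp, h', posMinusNeg_top])

theorem extExp_congr {Ω : Type*} [MeasurableSpace Ω] {P : Measure Ω} {f f' : Ω → EReal}
    (h : f =ᵐ[P] f') : extExp P f = extExp P f' := by
  rw [extExp, extExp, lintegral_congr_ae (h.mono fun ω hω => congrArg EReal.toENNReal hω),
    lintegral_congr_ae (h.mono fun ω hω => congrArg (fun x => (-x).toENNReal) hω)]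

theorem extExp_coe {Ω : Type*} [MeasurableSpace Ω] {P : Measure Ω} {r : Ω → ℝ}
    (hr : Integrable r P) : extExp P (fun ω => (r ω : EReal)) = ((∫ ω, r ω ∂P : ℝ) : EReal) := by
  have h1 : ∀ ω, ((r ω : EReal)).toENNReal = ENNReal.ofReal (r ω) := fun ω =>
    EReal.toENNReal_of_ne_top (EReal.coe_ne_top _)
  have h2 : ∀ ω, (-(r ω : EReal)).toENNReal = ENNReal.ofReal (-r ω) := fun ω => by
    rw [← EReal.coe_neg]
    exact EReal.toENNReal_of_ne_top (EReal.coe_ne_top _)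
  have hp : ∫⁻ ω, ENNReal.ofReal (r ω) ∂P ≠ ⊤ := hr.lintegral_lt_top.ne
  have hn : ∫⁻ ω, ENNReal.ofReal (-r ω) ∂P ≠ ⊤ := hr.neg.lintegral_lt_top.ne
  rw [extExp]
  simp only [h1, h2]
  rw [posMinusNeg_eq_sub hn, integral_eq_lintegral_pos_part_sub_lintegral_neg_part hr,
    EReal.coe_sub, EReal.coe_ennreal_toReal hp, EReal.coe_ennreal_toReal hn]

theorem extSum_of_summable {c : ℕ → ℝ} (hc : Summable fun t => |c t|) :
    extSum c = ((∑' t, c t : ℝ) : EReal) := by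
  have hp : Summable fun t => max (c t) 0 := Summable.of_nonneg_of_le (fun t => le_max_right _ _)
    (fun t => max_le (le_abs_self _) (abs_nonneg _)) hc
  have hn : Summable fun t => max (-(c t)) 0 := Summable.of_nonneg_of_le
    (fun t => le_max_right _ _) (fun t => max_le (neg_le_abs _) (abs_nonneg _)) hc
  have e1 : ∑' t, ENNReal.ofReal (c t) = ENNReal.ofReal (∑' t, max (c t) 0) := by
    rw [ENNReal.ofReal_tsum_of_nonneg (fun t => le_max_right _ _) hp]
    exact tsum_congr fun t => by simp [ENNReal.ofReal_max]
  have e2 : ∑' t, ENNReal.ofReal (-(c t)) = ENNReal.ofReal (∑' t, max (-(c t)) 0) := by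
    rw [ENNReal.ofReal_tsum_of_nonneg (fun t => le_max_right _ _) hn]
    exact tsum_congr fun t => by simp [ENNReal.ofReal_max]
  have e3 : ∑' t, c t = ∑' t, max (c t) 0 - ∑' t, max (-(c t)) 0 := by
    rw [← hp.tsum_sub hn]
    exact tsum_congr fun t => by
      rcases le_total (c t) 0 with h | h
      · rw [max_eq_right h, max_eq_left (by linarith)]; ring
      · rw [max_eq_left h, max_eq_right (by linarith)]; ring
  rw [extSum, e1, e2, posMinusNeg_eq_sub ENNReal.ofReal_ne_top, e3, EReal.coe_sub,
    EReal.coe_ennreal_ofReal, EReal.coe_ennreal_ofReal,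
    max_eq_left (tsum_nonneg fun t => le_max_right _ _),
    max_eq_left (tsum_nonneg fun t => le_max_right _ _)]

variable {Z Ω : Type*} [MeasurableSpace Z] [MeasurableSpace Ω] {ζ : Measure Z} {P : Measure Ω}
  [IsProbabilityMeasure ζ] [IsProbabilityMeasure P] {f : ℕ → Z × Ω → ℝ}

/-- If the iterated extended expectation of the series is not `+∞`, and the negative parts are
dominated by an integrable series that does not depend on the inner variable, the positive parts
are integrable. -/
theorem tsum_lintegral_ofReal_ne_top (hf : ∀ t, Measurable (f t)) {n : ℕ → Z → ℝ≥0∞}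
    (hn : ∀ t, Measurable (n t)) (hfn : ∀ t z ω, ENNReal.ofReal (-(f t (z, ω))) ≤ n t z)
    (hsum : ∑' t, ∫⁻ z, n t z ∂ζ ≠ ⊤)
    (h : extExp ζ (fun z => extExp P fun ω => extSum fun t => f t (z, ω)) ≠ ⊤) :
    ∑' t, ∫⁻ q, ENNReal.ofReal (f t q) ∂ζ.prod P ≠ ⊤ := by
  set N : Z → ℝ≥0∞ := fun z => ∑' t, n t z with hN
  have hNm : Measurable N := Measurable.tsum hn
  have hNi : ∫⁻ z, N z ∂ζ ≠ ⊤ := by rwa [hN, lintegral_tsum fun t => (hn t).aemeasurable]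
  set J : Z → EReal := fun z => extExp P fun ω => extSum fun t => f t (z, ω) with hJ
  have hq : ∀ z ω, ∑' t, ENNReal.ofReal (-(f t (z, ω))) ≤ N z := fun z ω =>
    ENNReal.tsum_le_tsum fun t => hfn t z ω
  -- `N z` is paid twice: once to recover the positive part of the series from its extended sum,
  -- once to recover that of the expectation over `ω`.
  have key : ∀ z, ∫⁻ ω, ∑' t, ENNReal.ofReal (f t (z, ω)) ∂P ≤ (J z).toENNReal + (N z + N z) := by
    intro z
    have h1 : ∀ ω, ∑' t, ENNReal.ofReal (f t (z, ω)) ≤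
        (extSum fun t => f t (z, ω)).toENNReal + N z := fun ω =>
      (le_toENNReal_posMinusNeg_add _ _).trans (add_le_add le_rfl (hq z ω))
    have h2 : ∀ ω, (-(extSum fun t => f t (z, ω))).toENNReal ≤ N z := fun ω => by
      rw [extSum, posMinusNeg, neg_neg, EReal.toENNReal_sub (EReal.coe_ennreal_nonneg _),
        EReal.toENNReal_coe, EReal.toENNReal_coe]
      exact tsub_le_self.trans (hq z ω)
    calc ∫⁻ ω, ∑' t, ENNReal.ofReal (f t (z, ω)) ∂P
        ≤ ∫⁻ ω, ((extSum fun t => f t (z, ω)).toENNReal + N z) ∂P := lintegral_mono h1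
      _ = ∫⁻ ω, (extSum fun t => f t (z, ω)).toENNReal ∂P + N z := by
        rw [lintegral_add_right _ measurable_const]; simp
      _ ≤ ((J z).toENNReal + ∫⁻ ω, (-(extSum fun t => f t (z, ω))).toENNReal ∂P) + N z :=
        add_le_add (le_toENNReal_posMinusNeg_add _ _) le_rfl
      _ ≤ ((J z).toENNReal + N z) + N z := by
        gcongr
        exact (lintegral_mono h2).trans (by simp)
      _ = _ := add_assoc _ _ _
  have hm : ∀ t, Measurable fun q => ENNReal.ofReal (f t q) := fun t => (hf t).ennreal_ofReal
  rw [← lintegral_tsum fun t => (hm t).aemeasurable,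
    lintegral_prod _ (Measurable.tsum hm).aemeasurable]
  refine ne_top_of_le_ne_top ?_ (lintegral_mono key)
  -- Only the dominating term on the right has to be measurable; nothing is required of `J`.
  rw [lintegral_add_right _ (by fun_prop), lintegral_add_right _ hNm]
  exact ENNReal.add_ne_top.2 ⟨lintegral_toENNReal_ne_top h, ENNReal.add_ne_top.2 ⟨hNi, hNi⟩⟩

/-- Fubini's theorem for the iterated extended expectation of an absolutely convergent series. -/
theorem extExp_extExp_extSum (hfi : ∀ t, Integrable (f t) (ζ.prod P))
    (hs : Summable fun t => ∫ q, |f t q| ∂ζ.prod P) :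
    extExp ζ (fun z => extExp P fun ω => extSum fun t => f t (z, ω)) =
      ((∑' t, ∫ q, f t q ∂ζ.prod P : ℝ) : EReal) := by
  have hm : ∀ t, AEMeasurable (fun q => ENNReal.ofReal |f t q|) (ζ.prod P) := fun t =>
    (hfi t).abs.aestronglyMeasurable.aemeasurable.ennreal_ofReal
  have h1 : ∫⁻ q, ∑' t, ENNReal.ofReal |f t q| ∂ζ.prod P ≠ ⊤ := by
    have h0 : ∀ t, ∫⁻ q, ENNReal.ofReal |f t q| ∂ζ.prod P = ENNReal.ofReal (∫ q, |f t q| ∂ζ.prod P) :=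
      fun t => (ofReal_integral_eq_lintegral_ofReal (hfi t).abs
        (ae_of_all _ fun q => abs_nonneg _)).symm
    rw [lintegral_tsum hm]
    simp_rw [h0]
    rw [← ENNReal.ofReal_tsum_of_nonneg (fun t => integral_nonneg fun q => abs_nonneg _) hs]
    exact ENNReal.ofReal_ne_top
  have hae : ∀ᵐ q ∂ζ.prod P, Summable fun t => |f t q| := by
    filter_upwards [ae_lt_top' (AEMeasurable.tsum hm) h1] with q hq
    have := ENNReal.summable_toReal hq.ne
    simpa using this
  have hint : Integrable (fun q => ∑' t, f t q) (ζ.prod P) := by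
    refine ⟨aestronglyMeasurable_of_tendsto_ae atTop
      (f := fun n q => ∑ t ∈ Finset.range n, f t q)
      (fun n => (integrable_finsetSum _ fun t _ => hfi t).aestronglyMeasurable)
      (hae.mono fun q hq => (summable_abs_iff.1 hq).hasSum.tendsto_sum_nat), ?_⟩
    refine (lintegral_mono_ae (hae.mono fun q hq => ?_)).trans_lt (lt_top_iff_ne_top.2 h1)
    rw [← ENNReal.ofReal_tsum_of_nonneg (fun t => abs_nonneg _) hq, ← ofReal_norm]
    exact ENNReal.ofReal_le_ofReal (norm_tsum_le_tsum_norm (by simpa using hq))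
  have hval : ∫ q, ∑' t, f t q ∂ζ.prod P = ∑' t, ∫ q, f t q ∂ζ.prod P :=
    (hasSum_integral_of_summable_integral_norm hfi (by simpa using hs)).tsum_eq.symm
  -- Absolute convergence and integrability in `ω` hold for almost every `z` only, which suffices
  -- because extended expectations ignore null sets.
  have hz : (fun z => extExp P fun ω => extSum fun t => f t (z, ω)) =ᵐ[ζ]
      fun z => ((∫ ω, ∑' t, f t (z, ω) ∂P : ℝ) : EReal) := by
    filter_upwards [Measure.ae_ae_of_ae_prod hae, hint.prod_right_ae] with z h1 h2
    rw [← extExp_coe h2]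
    exact extExp_congr (h1.mono fun ω hω => extSum_of_summable hω)
  rw [extExp_congr hz, extExp_coe hint.integral_prod_left, ← integral_prod _ hint, hval]

end ExtendedExpectation


/-! ### Completion of squares -/

section CompletionOfSquares

variable {n m l : Type} [Fintype n] [DecidableEq n] [Fintype m] [DecidableEq m] [Fintype l]
  {β : ℝ} {A : Matrix n n ℝ} {B : Matrix n m ℝ} {Q : Matrix n n ℝ} {R : Matrix m m ℝ}
  {F : Matrix m n ℝ} {M : Matrix n n ℝ} {S : Matrix m m ℝ}

theorem quadForm_add {M : Matrix n n ℝ} (hM : M.IsHermitian) (x y : n → ℝ) :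
    (x + y) ⬝ᵥ (M *ᵥ (x + y)) = x ⬝ᵥ (M *ᵥ x) + 2 * (x ⬝ᵥ (M *ᵥ y)) + y ⬝ᵥ (M *ᵥ y) := by
  rw [Matrix.mulVec_add, add_dotProduct, dotProduct_add, dotProduct_add,
    dotProduct_mulVec_comm hM y x]
  ring

/-- With `u = F x + v` the mixed terms in `x` and `v` cancel by `S F = -β B' M A`; what remains is
the policy identity for `M` and a form in `v` with weight `S`. -/
theorem quadForm_stage_add_next (hM : M.IsHermitian) (hR : R.IsHermitian)
    (hS : S = R + β • (Bᵀ * M * B)) (hSF : S * F = -(β • (Bᵀ * M * A)))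
    (hMp : M = policyMap β A B Q R F M) (x : n → ℝ) (u : m → ℝ) :
    x ⬝ᵥ (Q *ᵥ x) + u ⬝ᵥ (R *ᵥ u) + β * ((A *ᵥ x + B *ᵥ u) ⬝ᵥ (M *ᵥ (A *ᵥ x + B *ᵥ u))) =
      x ⬝ᵥ (M *ᵥ x) + (u - F *ᵥ x) ⬝ᵥ (S *ᵥ (u - F *ᵥ x)) := by
  obtain ⟨v, rfl⟩ : ∃ v, u = F *ᵥ x + v := ⟨u - F *ᵥ x, by abel⟩
  have h1 : A *ᵥ x + B *ᵥ (F *ᵥ x + v) = (A + B * F) *ᵥ x + B *ᵥ v := by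
    rw [Matrix.mulVec_add, Matrix.add_mulVec, Matrix.mulVec_mulVec, add_assoc]
  have h2 : v ⬝ᵥ (R *ᵥ (F *ᵥ x)) + β * ((B *ᵥ v) ⬝ᵥ (M *ᵥ ((A + B * F) *ᵥ x))) = 0 := by
    have h3 : R * F + β • (Bᵀ * M * (A + B * F)) = 0 := by
      have h4 : R * F + β • (Bᵀ * M * (A + B * F)) = S * F + β • (Bᵀ * M * A) := by
        rw [hS]
        simp only [Matrix.mul_add, Matrix.add_mul, Matrix.smul_mul, Matrix.mul_assoc, smul_add]
        abel
      rw [h4, hSF, neg_add_cancel]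
    have h5 := congrArg (fun N => v ⬝ᵥ (N *ᵥ x)) h3
    simp only [Matrix.zero_mulVec, dotProduct_zero] at h5
    rw [Matrix.add_mulVec, dotProduct_add, Matrix.smul_mulVec, dotProduct_smul, smul_eq_mul,
      Matrix.mul_assoc, ← Matrix.mulVec_mulVec x Bᵀ, dotProduct_comm v (Bᵀ *ᵥ _),
      transpose_mulVec_dotProduct, dotProduct_comm _ (B *ᵥ v), ← Matrix.mulVec_mulVec,
      ← Matrix.mulVec_mulVec] at h5
    exact h5
  have h8 : x ⬝ᵥ ((Q + Fᵀ * R * F) *ᵥ x) = x ⬝ᵥ (Q *ᵥ x) + (F *ᵥ x) ⬝ᵥ (R *ᵥ (F *ᵥ x)) := by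
    rw [Matrix.add_mulVec, dotProduct_add, Matrix.mul_assoc, ← Matrix.mulVec_mulVec x Fᵀ,
      dotProduct_comm x (Fᵀ *ᵥ _), transpose_mulVec_dotProduct, dotProduct_comm _ (F *ᵥ x),
      ← Matrix.mulVec_mulVec]
  have h6 : x ⬝ᵥ (M *ᵥ x) = x ⬝ᵥ (policyMap β A B Q R F M *ᵥ x) := by rw [← hMp]
  have h7 : v ⬝ᵥ (S *ᵥ v) = v ⬝ᵥ (R *ᵥ v) + β * ((B *ᵥ v) ⬝ᵥ (M *ᵥ (B *ᵥ v))) := by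
    rw [hS, Matrix.add_mulVec, dotProduct_add, Matrix.smul_mulVec, dotProduct_smul, smul_eq_mul,
      Matrix.mul_assoc, ← Matrix.mulVec_mulVec v Bᵀ, dotProduct_comm v (Bᵀ *ᵥ _),
      transpose_mulVec_dotProduct, dotProduct_comm _ (B *ᵥ v), ← Matrix.mulVec_mulVec]
  rw [h1, add_sub_cancel_left, h6, h7, policyMap_quadForm, h8, quadForm_add hM, quadForm_add hR,
    dotProduct_mulVec_comm hM _ (B *ᵥ v), dotProduct_mulVec_comm hR _ v]
  linear_combination 2 * h2

/-- Completion of squares in the one-step dynamic programming identity with linear terms. -/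
theorem stage_add_next_eq {K : Matrix l m ℝ} {L : Matrix l n ℝ}
    (hM : M.IsHermitian) (hR : R.IsHermitian)
    (hS : S = R + β • (Bᵀ * M * B)) (hSF : S * F = -(β • (Bᵀ * M * A)))
    (hMp : M = policyMap β A B Q R F M) {x f p p' lx N2 : n → ℝ} {u q lu N1 : m → ℝ} {z : l → ℝ}
    (hlu : lu + N1 = Kᵀ *ᵥ z + β • (Bᵀ *ᵥ (M *ᵥ f + p')))
    (hlx : lx + N2 = Lᵀ *ᵥ z + β • (Aᵀ *ᵥ (M *ᵥ f + p')))
    (hq : S *ᵥ q = -lu) (hp : p = Fᵀ *ᵥ lu + lx) :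
    x ⬝ᵥ (Q *ᵥ x) + u ⬝ᵥ (R *ᵥ u) + 2 * (z ⬝ᵥ (K *ᵥ u + L *ᵥ x))
      + β * ((A *ᵥ x + B *ᵥ u + f) ⬝ᵥ (M *ᵥ (A *ᵥ x + B *ᵥ u + f))
        + 2 * (p' ⬝ᵥ (A *ᵥ x + B *ᵥ u + f))) =
    x ⬝ᵥ (M *ᵥ x) + 2 * (p ⬝ᵥ x) + (u - F *ᵥ x - q) ⬝ᵥ (S *ᵥ (u - F *ᵥ x - q))
      + (β * (f ⬝ᵥ (M *ᵥ f) + 2 * (p' ⬝ᵥ f)) - q ⬝ᵥ (S *ᵥ q))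
      + 2 * (u ⬝ᵥ N1) + 2 * (x ⬝ᵥ N2) := by
  have hSh : S.IsHermitian := by
    rw [hS]
    refine hR.add ?_
    have h := (Matrix.isHermitian_conjTranspose_mul_mul B hM)
    rw [Matrix.conjTranspose_eq_transpose_of_trivial] at h
    exact h.smul (IsSelfAdjoint.all β)
  have h1 := quadForm_stage_add_next hM hR hS hSF hMp x u
  set y := A *ᵥ x + B *ᵥ u with hy
  -- Since `S q = -lu`, centring the square at `q` absorbs the linear term in `u - F x`; the part
  -- left over in `x` is `F' lu + lx = p`.
  have h2 : (u - F *ᵥ x - q) ⬝ᵥ (S *ᵥ (u - F *ᵥ x - q)) =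
      (u - F *ᵥ x) ⬝ᵥ (S *ᵥ (u - F *ᵥ x)) + 2 * ((u - F *ᵥ x) ⬝ᵥ lu) + q ⬝ᵥ (S *ᵥ q) := by
    rw [sub_eq_add_neg (u - F *ᵥ x), quadForm_add hSh, Matrix.mulVec_neg, hq, neg_neg,
      neg_dotProduct, dotProduct_neg]
  have h3 : p ⬝ᵥ x = (F *ᵥ x) ⬝ᵥ lu + x ⬝ᵥ lx := by
    rw [hp, add_dotProduct, transpose_mulVec_dotProduct, dotProduct_comm lu, dotProduct_comm lx]
  have h4 : u ⬝ᵥ lu + u ⬝ᵥ N1 = z ⬝ᵥ (K *ᵥ u) + β * ((B *ᵥ u) ⬝ᵥ (M *ᵥ f + p')) := by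
    rw [← dotProduct_add, hlu, dotProduct_add, dotProduct_smul, smul_eq_mul, dotProduct_comm u,
      transpose_mulVec_dotProduct, dotProduct_comm u, transpose_mulVec_dotProduct,
      dotProduct_comm (B *ᵥ u)]
  have h5 : x ⬝ᵥ lx + x ⬝ᵥ N2 = z ⬝ᵥ (L *ᵥ x) + β * ((A *ᵥ x) ⬝ᵥ (M *ᵥ f + p')) := by
    rw [← dotProduct_add, hlx, dotProduct_add, dotProduct_smul, smul_eq_mul, dotProduct_comm x,
      transpose_mulVec_dotProduct, dotProduct_comm x, transpose_mulVec_dotProduct,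
      dotProduct_comm (A *ᵥ x)]
  have h6 : y ⬝ᵥ (M *ᵥ f) + p' ⬝ᵥ y =
      (A *ᵥ x) ⬝ᵥ (M *ᵥ f + p') + (B *ᵥ u) ⬝ᵥ (M *ᵥ f + p') := by
    rw [dotProduct_comm p', ← dotProduct_add, hy, add_dotProduct]
  rw [quadForm_add hM y f, h2, h3, dotProduct_add p' y, dotProduct_add z, sub_dotProduct u _ lu]
  linear_combination h1 - 2 * h4 - 2 * h5 + 2 * β * h6

end CompletionOfSquares


/-- Independence factorizes each product and the centred factor integrates to zero. This removes the
interaction of non-anticipating decisions with the noise. -/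
theorem integral_dotProduct_mulVec_eq_zero {Ω : Type*} [MeasurableSpace Ω] {μ : Measure Ω}
    [IsProbabilityMeasure μ] {ι κ : Type} [Fintype ι] [Fintype κ] {U : Ω → ι → ℝ} {V : Ω → κ → ℝ}
    (h : IndepFun U V μ) (hU : L2Vec μ U) (hV : L2Vec μ V) (hV0 : meanVec μ V = 0)
    (G : Matrix ι κ ℝ) : ∫ ω, U ω ⬝ᵥ (G *ᵥ V ω) ∂μ = 0 := by
  have hGV := hV.mulVec G
  have h1 : meanVec μ (fun ω => G *ᵥ V ω) = 0 := by rw [meanVec_mulVec hV, hV0, Matrix.mulVec_zero]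
  simp only [dotProduct]
  have hi : ∀ j, Integrable (fun ω => U ω j * (G *ᵥ V ω) j) μ := fun j =>
    (hU j).integrable_mul (hGV j)
  rw [integral_finsetSum _ fun j _ => hi j]
  refine Finset.sum_eq_zero fun j _ => ?_
  have h2 : IndepFun (fun ω => U ω j) (fun ω => (G *ᵥ V ω) j) μ :=
    h.comp (measurable_pi_apply j) (ψ := fun v => (G *ᵥ v) j)
      ((measurable_pi_apply j).comp
        (Continuous.matrix_mulVec continuous_const continuous_id).measurable)
  rw [h2.integral_fun_mul_eq_mul_integral (hU j).aestronglyMeasurable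
    (hGV j).aestronglyMeasurable]
  rw [show ∫ ω, (G *ᵥ V ω) j ∂μ = 0 from congrFun h1 j, mul_zero]

namespace LQGame

/-! ### Expected costs against an exogenous process with independent innovations -/

section Response

variable (g : LQGame)

/-- An exogenous process `z` predicted by the affine filter with state `Xh`, innovations `ν` and
gain `N`, together with the disturbances `w` of decision maker `i`. -/
structure InnovationModel (i : Fin g.N) {Ω : Type*} [MeasurableSpace Ω] (μ : Measure Ω)
    (ξhat : g.Y) (Ŵ : g.X) (a : ℕ → Matrix (Fin g.ny) g.SIdx ℝ) (b : ℕ → g.Y)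
    (N : Matrix g.SIdx (Fin g.ny) ℝ) (Xh : ℕ → Ω → g.X) (ν z : ℕ → Ω → g.Y)
    (w : ℕ → Ω → Fin (g.nx i) → ℝ) : Prop where
  output : ∀ t ω, z t ω = g.predOutput ξhat Ŵ a b (Xh t ω) + ν t ω
  step : ∀ t ω, Xh (t + 1) ω = g.predState ξhat Ŵ a b (Xh t ω) + N *ᵥ ν t ω
  l2_state : ∀ t, L2Vec μ (Xh t)
  l2_innovation : ∀ t, L2Vec μ (ν t)
  l2_disturbance : ∀ t, L2Vec μ (w t)
  mean_innovation : ∀ t, meanVec μ (ν t) = 0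
  mean_disturbance : ∀ t, meanVec μ (w t) = g.ownPart i Ŵ
  indep : ∀ t, IndepFun (Xh t) (ν t) μ
  bounded : ∃ c : ℝ, ∀ t j, ∫ ω, z t ω j ^ 2 ∂μ ≤ c

/-- States and controls of decision maker `i` responding to `z` and `w` without anticipation. -/
structure IsResponse (i : Fin g.N) {Ω : Type*} [MeasurableSpace Ω] (μ : Measure Ω)
    (ν z : ℕ → Ω → g.Y) (w x : ℕ → Ω → Fin (g.nx i) → ℝ) (u : ℕ → Ω → Fin (g.nu i) → ℝ) :
    Prop where
  step : ∀ t ω, x (t + 1) ω = g.A i *ᵥ x t ω + g.B i *ᵥ u t ω + g.C i *ᵥ z t ω + w t ω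
  l2_init : L2Vec μ (x 0)
  indep_state_innovation : ∀ t, IndepFun (x t) (ν t) μ
  indep_control_innovation : ∀ t, IndepFun (u t) (ν t) μ
  indep_state_disturbance : ∀ t, IndepFun (x t) (w t) μ
  indep_control_disturbance : ∀ t, IndepFun (u t) (w t) μ

/-- Value function of decision maker `i`, up to a term that is independent of the own state. -/
def value (Ŵ : g.X) (a : ℕ → Matrix (Fin g.ny) g.SIdx ℝ) (b : ℕ → g.Y) (i : Fin g.N)
    (Xh : g.X) (x : Fin (g.nx i) → ℝ) : ℝ :=
  x ⬝ᵥ (g.M i *ᵥ x) + 2 * (g.costate Ŵ a b i Xh ⬝ᵥ x)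

/-- Deviation of a control from the affine decision. -/
def deviation (Ŵ : g.X) (a : ℕ → Matrix (Fin g.ny) g.SIdx ℝ) (b : ℕ → g.Y) (i : Fin g.N)
    (Xh : g.X) (x : Fin (g.nx i) → ℝ) (u : Fin (g.nu i) → ℝ) : Fin (g.nu i) → ℝ :=
  u - g.F i *ᵥ x - (g.Gi a i *ᵥ Xh + g.Hi Ŵ b i)

/-- The part of the stage cost that decision maker `i` cannot influence. -/
def exogenousCost (Ŵ : g.X) (a : ℕ → Matrix (Fin g.ny) g.SIdx ℝ) (b : ℕ → g.Y) (i : Fin g.N)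
    (Xh Xh' : g.X) (z : g.Y) (w : Fin (g.nx i) → ℝ) : ℝ :=
  g.β i * ((g.C i *ᵥ z + w) ⬝ᵥ (g.M i *ᵥ (g.C i *ᵥ z + w))
      + 2 * (g.costate Ŵ a b i Xh' ⬝ᵥ (g.C i *ᵥ z + w)))
    - (g.Gi a i *ᵥ Xh + g.Hi Ŵ b i) ⬝ᵥ (g.S i *ᵥ (g.Gi a i *ᵥ Xh + g.Hi Ŵ b i))

variable {g} {i : Fin g.N} {ξhat : g.Y} {Ŵ : g.X} {a : ℕ → Matrix (Fin g.ny) g.SIdx ℝ}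
  {b : ℕ → g.Y} (hst : ∀ i, IsStabilizable (g.A i) (g.B i))
  (hsol : g.UniquelySolvable ξhat Ŵ a b)
include hst hsol

/-- One-step dynamic programming identity along a realization. -/
theorem stageCost_add_value (N : Matrix g.SIdx (Fin g.ny) ℝ) (Xh : g.X) (ν : g.Y)
    (w x : Fin (g.nx i) → ℝ) (u : Fin (g.nu i) → ℝ) :
    g.stageCost i x u (g.predOutput ξhat Ŵ a b Xh + ν)
      + g.β i * g.value Ŵ a b i (g.predState ξhat Ŵ a b Xh + N *ᵥ ν)
        (g.A i *ᵥ x + g.B i *ᵥ u + g.C i *ᵥ (g.predOutput ξhat Ŵ a b Xh + ν) + w) =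
    g.value Ŵ a b i Xh x
      + g.deviation Ŵ a b i Xh x u ⬝ᵥ (g.S i *ᵥ g.deviation Ŵ a b i Xh x u)
      + g.exogenousCost Ŵ a b i Xh (g.predState ξhat Ŵ a b Xh + N *ᵥ ν)
        (g.predOutput ξhat Ŵ a b Xh + ν) w
      + 2 * (u ⬝ᵥ (((g.K i)ᵀ + g.β i • ((g.B i)ᵀ * (g.M i * g.C i + g.costateMat a i * N))) *ᵥ ν)
        + u ⬝ᵥ ((g.β i • ((g.B i)ᵀ * g.M i)) *ᵥ (w - g.ownPart i Ŵ)))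
      + 2 * (x ⬝ᵥ (((g.L i)ᵀ + g.β i • ((g.A i)ᵀ * (g.M i * g.C i + g.costateMat a i * N))) *ᵥ ν)
        + x ⬝ᵥ ((g.β i • ((g.A i)ᵀ * g.M i)) *ᵥ (w - g.ownPart i Ŵ))) := by
  obtain ⟨h0, hx⟩ := SolvesMeanSystem.eq_pred hsol hst Xh
  have hM := (M_posSemidef (hst i)).isHermitian
  set X' := g.predState ξhat Ŵ a b Xh with hX'
  set zh := g.predOutput ξhat Ŵ a b Xh with hzh
  have hq := S_mulVec_decision (Ŵ := Ŵ) (hst i) hsol.bounded_a hsol.bounded_b hx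
  have hp := costate_step (Ŵ := Ŵ) (hst i) hsol.bounded_a hsol.bounded_b hx
  rw [h0] at hq hp
  have hcos : g.costate Ŵ a b i (X' + N *ᵥ ν) =
      g.costate Ŵ a b i X' + (g.costateMat a i * N) *ᵥ ν := by
    rw [costate, costate, Matrix.mulVec_add, Matrix.mulVec_mulVec]
    abel
  rw [← dotProduct_add u, ← dotProduct_add x, add_assoc (g.A i *ᵥ x + g.B i *ᵥ u)]
  -- `lu` and `lx` are the linear coefficients with output, disturbance and costate replaced by
  -- their predictions; the innovation and the centred disturbance go into `N1` and `N2`.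
  refine stage_add_next_eq hM (g.R_posDef i).isHermitian rfl (S_mul_F (hst i))
    (M_eq_policyMap (hst i)) (lu := (g.K i)ᵀ *ᵥ zh + g.β i • ((g.B i)ᵀ *ᵥ (g.M i *ᵥ (g.C i *ᵥ zh
      + g.ownPart i Ŵ) + g.costate Ŵ a b i X')))
    (lx := (g.L i)ᵀ *ᵥ zh + g.β i • ((g.A i)ᵀ *ᵥ (g.M i *ᵥ (g.C i *ᵥ zh
      + g.ownPart i Ŵ) + g.costate Ŵ a b i X'))) ?_ ?_ hq ?_
  · rw [hcos]
    simp only [Matrix.mulVec_add, Matrix.add_mulVec, Matrix.smul_mulVec, Matrix.mulVec_sub,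
      ← Matrix.mulVec_mulVec, smul_add, Matrix.mul_add]
    abel
  · rw [hcos]
    simp only [Matrix.mulVec_add, Matrix.add_mulVec, Matrix.smul_mulVec, Matrix.mulVec_sub,
      ← Matrix.mulVec_mulVec, smul_add, Matrix.mul_add]
    abel
  · rw [hp, costateSource, Φ, Matrix.transpose_add, Matrix.transpose_mul]
    simp only [Matrix.mulVec_add, Matrix.add_mulVec, Matrix.smul_mulVec, Matrix.mulVec_smul,
      ← Matrix.mulVec_mulVec, smul_add, Matrix.mul_assoc]
    abel

end Response

end LQGame


/-- Integrated form of the one-step identity; `p`, `q`, `r`, `s` stand for the four products of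
control or state with noise. -/
theorem integral_add_eq_of_forall {Ω : Type*} [MeasurableSpace Ω] {μ : Measure Ω} {β : ℝ}
    {c v' v d e p q r s : Ω → ℝ} (hc : Integrable c μ) (hv' : Integrable v' μ)
    (hv : Integrable v μ) (hd : Integrable d μ) (he : Integrable e μ) (hp : Integrable p μ)
    (hq : Integrable q μ) (hr : Integrable r μ) (hs : Integrable s μ) (hp0 : ∫ ω, p ω ∂μ = 0)
    (hq0 : ∫ ω, q ω ∂μ = 0) (hr0 : ∫ ω, r ω ∂μ = 0) (hs0 : ∫ ω, s ω ∂μ = 0)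
    (h : ∀ ω, c ω + β * v' ω = v ω + d ω + e ω + 2 * (p ω + q ω) + 2 * (r ω + s ω)) :
    ∫ ω, c ω ∂μ + β * ∫ ω, v' ω ∂μ = ∫ ω, v ω ∂μ + ∫ ω, d ω ∂μ + ∫ ω, e ω ∂μ := by
  have h1 : c + β • v' = v + d + e + (p + q + (p + q) + (r + s + (r + s))) := by
    funext ω
    have := h ω
    simp only [Pi.add_apply, Pi.smul_apply, smul_eq_mul]
    linarith
  have h2 := congrArg (fun f => ∫ ω, f ω ∂μ) h1
  have h3 : ∫ ω, (β • v') ω ∂μ = β * ∫ ω, v' ω ∂μ := integral_smul β v'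
  have hpq := hp.add hq
  have hrs := hr.add hs
  rw [integral_add' hc (hv'.smul β), h3,
    integral_add' ((hv.add hd).add he) ((hpq.add hpq).add (hrs.add hrs)),
    integral_add' (hpq.add hpq) (hrs.add hrs), integral_add' hpq hpq, integral_add' hrs hrs,
    integral_add' hp hq, integral_add' hr hs, integral_add' (hv.add hd) he, integral_add' hv hd,
    hp0, hq0, hr0, hs0] at h2
  simpa using h2

namespace LQGame

/-! ### Comparison of expected costs -/

section Comparison

variable {g : LQGame} {i : Fin g.N} {ξhat : g.Y} {Ŵ : g.X} {a : ℕ → Matrix (Fin g.ny) g.SIdx ℝ}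
  {b : ℕ → g.Y} {Ω : Type*} [MeasurableSpace Ω] {μ : Measure Ω} [IsProbabilityMeasure μ]
  {N : Matrix g.SIdx (Fin g.ny) ℝ} {Xh : ℕ → Ω → g.X} {ν z : ℕ → Ω → g.Y}
  {w x x' : ℕ → Ω → Fin (g.nx i) → ℝ} {u u' : ℕ → Ω → Fin (g.nu i) → ℝ}

theorem InnovationModel.l2_output (E : g.InnovationModel i μ ξhat Ŵ a b N Xh ν z w) (t : ℕ) :
    L2Vec μ (z t) := by
  rw [funext (E.output t)]
  exact ((((E.l2_state t).mulVec _).add (L2Vec.const _)).add (L2Vec.const _)).add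
    (E.l2_innovation t)

theorem integrable_stageCost {x : Ω → Fin (g.nx i) → ℝ} {u : Ω → Fin (g.nu i) → ℝ} {z : Ω → g.Y}
    (hx : L2Vec μ x) (hu : L2Vec μ u) (hz : L2Vec μ z) :
    Integrable (fun ω => g.stageCost i (x ω) (u ω) (z ω)) μ :=
  ((hx.integrable_dotProduct (hx.mulVec _)).add (hu.integrable_dotProduct (hu.mulVec _))).add
    ((hz.integrable_dotProduct ((hu.mulVec _).add (hx.mulVec _))).const_mul 2)

theorem l2Vec_costate {X : Ω → g.X} (hX : L2Vec μ X) :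
    L2Vec μ fun ω => g.costate Ŵ a b i (X ω) := (hX.mulVec _).add (L2Vec.const _)

theorem integrable_value {X : Ω → g.X} {x : Ω → Fin (g.nx i) → ℝ} (hX : L2Vec μ X)
    (hx : L2Vec μ x) : Integrable (fun ω => g.value Ŵ a b i (X ω) (x ω)) μ :=
  (hx.integrable_dotProduct (hx.mulVec _)).add
    (((l2Vec_costate hX).integrable_dotProduct hx).const_mul 2)

theorem l2Vec_deviation {X : Ω → g.X} {x : Ω → Fin (g.nx i) → ℝ} {u : Ω → Fin (g.nu i) → ℝ}
    (hX : L2Vec μ X) (hx : L2Vec μ x) (hu : L2Vec μ u) :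
    L2Vec μ fun ω => g.deviation Ŵ a b i (X ω) (x ω) (u ω) :=
  (hu.sub (hx.mulVec _)).sub ((hX.mulVec _).add (L2Vec.const _))

theorem integrable_exogenousCost {X X' : Ω → g.X} {z : Ω → g.Y} {w : Ω → Fin (g.nx i) → ℝ}
    (hX : L2Vec μ X) (hX' : L2Vec μ X') (hz : L2Vec μ z) (hw : L2Vec μ w) :
    Integrable (fun ω => g.exogenousCost Ŵ a b i (X ω) (X' ω) (z ω) (w ω)) μ := by
  have h1 : L2Vec μ fun ω => g.C i *ᵥ z ω + w ω := (hz.mulVec _).add hw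
  have h2 : L2Vec μ fun ω => g.Gi a i *ᵥ X ω + g.Hi Ŵ b i := (hX.mulVec _).add (L2Vec.const _)
  exact (((h1.integrable_dotProduct (h1.mulVec _)).add
    (((l2Vec_costate hX').integrable_dotProduct h1).const_mul 2)).const_mul _).sub
    (h2.integrable_dotProduct (h2.mulVec _))

theorem IsResponse.l2_state (E : g.InnovationModel i μ ξhat Ŵ a b N Xh ν z w)
    (R : g.IsResponse i μ ν z w x u) {T : ℕ} (hu : ∀ t < T, L2Vec μ (u t)) :
    ∀ t ≤ T, L2Vec μ (x t) := by
  intro t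
  induction t with
  | zero => exact fun _ => R.l2_init
  | succ t ih =>
    intro ht
    rw [funext (R.step t)]
    exact ((((ih (by omega)).mulVec _).add ((hu t (by omega)).mulVec _)).add
      ((E.l2_output t).mulVec _)).add (E.l2_disturbance t)

variable (hst : ∀ i, IsStabilizable (g.A i) (g.B i)) (hsol : g.UniquelySolvable ξhat Ŵ a b)
  (E : g.InnovationModel i μ ξhat Ŵ a b N Xh ν z w)
include hst hsol E

/-- State and control at `t` are each independent of the innovation and of the disturbance at `t`,
so the four noise terms of `stageCost_add_value` have zero expectation. -/
theorem IsResponse.integral_step (R : g.IsResponse i μ ν z w x u) {t : ℕ} (hx : L2Vec μ (x t))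
    (hu : L2Vec μ (u t)) :
    ∫ ω, g.stageCost i (x t ω) (u t ω) (z t ω) ∂μ
      + g.β i * ∫ ω, g.value Ŵ a b i (Xh (t + 1) ω) (x (t + 1) ω) ∂μ =
    ∫ ω, g.value Ŵ a b i (Xh t ω) (x t ω) ∂μ
      + ∫ ω, g.deviation Ŵ a b i (Xh t ω) (x t ω) (u t ω) ⬝ᵥ
          (g.S i *ᵥ g.deviation Ŵ a b i (Xh t ω) (x t ω) (u t ω)) ∂μ
      + ∫ ω, g.exogenousCost Ŵ a b i (Xh t ω) (Xh (t + 1) ω) (z t ω) (w t ω) ∂μ := by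
  have hz := E.l2_output t
  have hν := E.l2_innovation t
  have hw := E.l2_disturbance t
  have hX := E.l2_state t
  have hX' := E.l2_state (t + 1)
  have hx' : L2Vec μ (x (t + 1)) := by
    rw [funext (R.step t)]
    exact (((hx.mulVec _).add (hu.mulVec _)).add (hz.mulVec _)).add hw
  have hd := l2Vec_deviation (Ŵ := Ŵ) (a := a) (b := b) hX hx hu
  have hwc : L2Vec μ fun ω => w t ω - g.ownPart i Ŵ := hw.sub (L2Vec.const _)
  have hwc0 : meanVec μ (fun ω => w t ω - g.ownPart i Ŵ) = 0 := by
    rw [meanVec_sub hw (L2Vec.const _), E.mean_disturbance t]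
    funext j
    simp [meanVec]
  have hsub : Measurable fun v : Fin (g.nx i) → ℝ => v - g.ownPart i Ŵ :=
    measurable_id.sub_const _
  have n1 := integral_dotProduct_mulVec_eq_zero (R.indep_control_innovation t) hu hν
    (E.mean_innovation t)
    ((g.K i)ᵀ + g.β i • ((g.B i)ᵀ * (g.M i * g.C i + g.costateMat a i * N)))
  have n2 := integral_dotProduct_mulVec_eq_zero
    ((R.indep_control_disturbance t).comp measurable_id hsub) hu hwc hwc0
    (g.β i • ((g.B i)ᵀ * g.M i))
  have n3 := integral_dotProduct_mulVec_eq_zero (R.indep_state_innovation t) hx hν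
    (E.mean_innovation t)
    ((g.L i)ᵀ + g.β i • ((g.A i)ᵀ * (g.M i * g.C i + g.costateMat a i * N)))
  have n4 := integral_dotProduct_mulVec_eq_zero
    ((R.indep_state_disturbance t).comp measurable_id hsub) hx hwc hwc0
    (g.β i • ((g.A i)ᵀ * g.M i))
  simp only [Function.comp_def, id] at n2 n4
  have i1 := hu.integrable_dotProduct (hν.mulVec
    ((g.K i)ᵀ + g.β i • ((g.B i)ᵀ * (g.M i * g.C i + g.costateMat a i * N))))
  have i2 := hu.integrable_dotProduct (hwc.mulVec (g.β i • ((g.B i)ᵀ * g.M i)))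
  have i3 := hx.integrable_dotProduct (hν.mulVec
    ((g.L i)ᵀ + g.β i • ((g.A i)ᵀ * (g.M i * g.C i + g.costateMat a i * N))))
  have i4 := hx.integrable_dotProduct (hwc.mulVec (g.β i • ((g.A i)ᵀ * g.M i)))
  have iv := integrable_value (Ŵ := Ŵ) (a := a) (b := b) hX hx
  have iv' := integrable_value (Ŵ := Ŵ) (a := a) (b := b) hX' hx'
  have ic := integrable_stageCost hx hu hz
  have ie := integrable_exogenousCost (Ŵ := Ŵ) (a := a) (b := b) hX hX' hz hw
  have id := hd.integrable_dotProduct (hd.mulVec (g.S i))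
  have key := fun ω => stageCost_add_value (i := i) hst hsol N (Xh t ω) (ν t ω) (w t ω) (x t ω)
    (u t ω)
  simp only [← E.output, ← E.step, ← R.step] at key
  exact integral_add_eq_of_forall ic iv' iv id ie i1 i2 i3 i4 n1 n2 n3 n4 key

/-- The discounted one-step identities telescope. -/
theorem IsResponse.sum_integral_add_value (R : g.IsResponse i μ ν z w x u) {T : ℕ}
    (hu : ∀ t < T, L2Vec μ (u t)) :
    ∑ t ∈ Finset.range T, g.β i ^ t * ∫ ω, g.stageCost i (x t ω) (u t ω) (z t ω) ∂μ
      + g.β i ^ T * ∫ ω, g.value Ŵ a b i (Xh T ω) (x T ω) ∂μ =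
    ∫ ω, g.value Ŵ a b i (Xh 0 ω) (x 0 ω) ∂μ
      + ∑ t ∈ Finset.range T, g.β i ^ t *
        (∫ ω, g.deviation Ŵ a b i (Xh t ω) (x t ω) (u t ω) ⬝ᵥ
          (g.S i *ᵥ g.deviation Ŵ a b i (Xh t ω) (x t ω) (u t ω)) ∂μ
        + ∫ ω, g.exogenousCost Ŵ a b i (Xh t ω) (Xh (t + 1) ω) (z t ω) (w t ω) ∂μ) := by
  induction T with
  | zero => simp
  | succ T ih =>
    have h1 := ih fun t ht => hu t (by omega)
    have h2 := R.integral_step hst hsol E (R.l2_state E hu T (by omega)) (hu T (by omega))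
    rw [Finset.sum_range_succ, Finset.sum_range_succ, pow_succ]
    linear_combination h1 + g.β i ^ T * h2

/-- Among the responses with square integrable controls, the affine one minimizes the expected
cost over a finite horizon with terminal cost given by the value function. -/
theorem IsResponse.sum_integral_le (R : g.IsResponse i μ ν z w x u)
    (R' : g.IsResponse i μ ν z w x' u') (h0 : x 0 = x' 0)
    (hdev : ∀ t ω, u t ω = g.F i *ᵥ x t ω + g.Gi a i *ᵥ Xh t ω + g.Hi Ŵ b i) {T : ℕ}
    (hu : ∀ t < T, L2Vec μ (u t)) (hu' : ∀ t < T, L2Vec μ (u' t)) :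
    ∑ t ∈ Finset.range T, g.β i ^ t * ∫ ω, g.stageCost i (x t ω) (u t ω) (z t ω) ∂μ
      + g.β i ^ T * ∫ ω, g.value Ŵ a b i (Xh T ω) (x T ω) ∂μ ≤
    ∑ t ∈ Finset.range T, g.β i ^ t * ∫ ω, g.stageCost i (x' t ω) (u' t ω) (z t ω) ∂μ
      + g.β i ^ T * ∫ ω, g.value Ŵ a b i (Xh T ω) (x' T ω) ∂μ := by
  rw [R.sum_integral_add_value hst hsol E hu, R'.sum_integral_add_value hst hsol E hu', h0]
  -- Initial values and exogenous costs are common to both responses. Only the squared deviations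
  -- differ, and those of the affine response vanish.
  refine add_le_add le_rfl (Finset.sum_le_sum fun t _ => mul_le_mul_of_nonneg_left
    (add_le_add ?_ le_rfl) (pow_nonneg (g.β_nonneg i) t))
  have hd : ∀ ω, g.deviation Ŵ a b i (Xh t ω) (x t ω) (u t ω) = 0 := fun ω => by
    rw [deviation, hdev]
    abel
  simp only [hd, zero_dotProduct, integral_zero]
  exact integral_nonneg fun ω => (S_posDef (hst i)).posSemidef.quadForm_nonneg _

end Comparison

end LQGame


/-! ### Second moments of convergent series and of orthogonal sums. -/

section SquareIntegrableSeries

variable {Ω : Type*} [MeasurableSpace Ω] {μ : Measure Ω}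

theorem eLpNorm_two_eq_ofReal_sqrt {f : Ω → ℝ} (hf : MemLp f 2 μ) :
    eLpNorm f 2 μ = ENNReal.ofReal (√(∫ ω, f ω ^ 2 ∂μ)) := by
  rw [hf.eLpNorm_eq_integral_rpow_norm two_ne_zero ENNReal.ofNat_ne_top, Real.sqrt_eq_rpow]
  simp

theorem eLpNorm_two_le_iff {f : Ω → ℝ} (hf : MemLp f 2 μ) {c : ℝ} (hc : 0 ≤ c) :
    eLpNorm f 2 μ ≤ ENNReal.ofReal c ↔ ∫ ω, f ω ^ 2 ∂μ ≤ c ^ 2 := by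
  rw [eLpNorm_two_eq_ofReal_sqrt hf, ENNReal.ofReal_le_ofReal_iff hc, Real.sqrt_le_left hc]

/-- Second moment of an absolutely convergent combination of random vectors with uniformly bounded
second moments. -/
theorem integral_sq_le_of_hasSum {m n : Type} [Fintype n] {G : ℕ → Matrix m n ℝ}
    (hG : EntrySummable G) {r : ℕ → Ω → n → ℝ} (hr : ∀ k, L2Vec μ (r k)) {c : ℝ} (hc : 0 ≤ c)
    (hrc : ∀ k j, ∫ ω, r k ω j ^ 2 ∂μ ≤ c ^ 2) {p : Ω → m → ℝ} (hp : L2Vec μ p)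
    (hsum : ∀ ω, HasSum (fun k => G k *ᵥ r k ω) (p ω)) (i : m) :
    ∫ ω, p ω i ^ 2 ∂μ ≤ (∑ j, (∑' k, |G k i j|) * c) ^ 2 := by
  have hpos : 0 ≤ ∑ j, (∑' k, |G k i j|) * c :=
    Finset.sum_nonneg fun j _ => mul_nonneg (tsum_nonneg fun k => abs_nonneg _) hc
  rw [← eLpNorm_two_le_iff (hp i) hpos]
  have hterm : ∀ k, MemLp (fun ω => (G k *ᵥ r k ω) i) 2 μ := fun k => (hr k).mulVec (G k) i
  have hlim : ∀ ω, Tendsto (fun K => ∑ k ∈ Finset.range K, (G k *ᵥ r k ω) i) atTop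
      (𝓝 (p ω i)) := fun ω => (Pi.hasSum.1 (hsum ω) i).tendsto_sum_nat
  -- Minkowski's inequality bounds the partial sums uniformly, and Fatou's lemma passes the bound to
  -- the limit.
  refine (Lp.eLpNorm_lim_le_liminf_eLpNorm
    (f := fun K ω => ∑ k ∈ Finset.range K, (G k *ᵥ r k ω) i)
    (fun K => (memLp_finsetSum _ fun k _ => hterm k).aestronglyMeasurable) _
    (ae_of_all _ hlim)).trans ?_
  refine liminf_le_of_le (by isBoundedDefault) fun y hy => ?_
  obtain ⟨K, hK⟩ := hy.exists
  refine hK.trans ?_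
  have h1 : ∀ k j, eLpNorm (fun ω => G k i j * r k ω j) 2 μ ≤ ENNReal.ofReal (|G k i j| * c) := by
    intro k j
    have h2 := (eLpNorm_two_le_iff (hr k j) hc).2 (hrc k j)
    have h3 := eLpNorm_const_smul (G k i j) (fun ω => r k ω j) 2 μ
    rw [show (fun ω => G k i j * r k ω j) = G k i j • fun ω => r k ω j from rfl, h3,
      ENNReal.ofReal_mul (abs_nonneg _), ← Real.norm_eq_abs, ofReal_norm]
    gcongr
  have h4 : ∀ k, eLpNorm (fun ω => (G k *ᵥ r k ω) i) 2 μ ≤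
      ∑ j, ENNReal.ofReal (|G k i j| * c) := by
    intro k
    have h5 : (fun ω => (G k *ᵥ r k ω) i) = ∑ j, fun ω => G k i j * r k ω j := by
      funext ω
      simp [Matrix.mulVec, dotProduct]
    rw [h5]
    exact (eLpNorm_sum_le (fun j _ => ((hr k j).const_mul _).aestronglyMeasurable)
      (by norm_num)).trans (Finset.sum_le_sum fun j _ => h1 k j)
  have h6 : (fun ω => ∑ k ∈ Finset.range K, (G k *ᵥ r k ω) i) =
      ∑ k ∈ Finset.range K, fun ω => (G k *ᵥ r k ω) i := by
    funext ω
    simp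
  rw [h6]
  refine (eLpNorm_sum_le (fun k _ => (hterm k).aestronglyMeasurable) (by norm_num)).trans
    ((Finset.sum_le_sum fun k _ => h4 k).trans ?_)
  have h7 : ∀ k, ∑ j, ENNReal.ofReal (|G k i j| * c) =
      ENNReal.ofReal (∑ j, |G k i j| * c) := fun k =>
    (ENNReal.ofReal_sum_of_nonneg fun j _ => mul_nonneg (abs_nonneg _) hc).symm
  simp_rw [h7]
  rw [← ENNReal.ofReal_sum_of_nonneg fun k _ =>
    Finset.sum_nonneg fun j _ => mul_nonneg (abs_nonneg _) hc, Finset.sum_comm]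
  refine ENNReal.ofReal_le_ofReal (Finset.sum_le_sum fun j _ => ?_)
  rw [← Finset.sum_mul]
  exact mul_le_mul_of_nonneg_right ((hG i j).sum_le_tsum _ fun k _ => abs_nonneg _) hc

theorem integral_sq_le_integral_add_sq {f h : Ω → ℝ} (hf : MemLp f 2 μ) (hh : MemLp h 2 μ)
    (h0 : ∫ ω, f ω * h ω ∂μ = 0) : ∫ ω, f ω ^ 2 ∂μ ≤ ∫ ω, (f ω + h ω) ^ 2 ∂μ := by
  have e : ∀ ω, (f ω + h ω) ^ 2 = f ω ^ 2 + (f ω * h ω + f ω * h ω) + h ω ^ 2 := fun ω => by ring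
  have hfh : Integrable (fun ω => f ω * h ω) μ := hf.integrable_mul hh
  have hfh2 : Integrable (fun ω => f ω * h ω + f ω * h ω) μ := hfh.add hfh
  have hs : Integrable (fun ω => f ω ^ 2 + (f ω * h ω + f ω * h ω)) μ :=
    hf.integrable_sq.add hfh2
  simp_rw [e]
  rw [integral_add hs hh.integrable_sq, integral_add hf.integrable_sq hfh2, integral_add hfh hfh,
    h0]
  have : 0 ≤ ∫ ω, h ω ^ 2 ∂μ := integral_nonneg fun ω => sq_nonneg _
  linarith

end SquareIntegrableSeries

namespace LQGame

/-! ### Uniform second-moment bounds for predictions and costates. -/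

section CostateBound

variable {g : LQGame} {i : Fin g.N} {ξhat : g.Y} {Ŵ : g.X} {a : ℕ → Matrix (Fin g.ny) g.SIdx ℝ}
  {b : ℕ → g.Y} {Ω : Type*} [MeasurableSpace Ω] {μ : Measure Ω} [IsProbabilityMeasure μ]
  {N : Matrix g.SIdx (Fin g.ny) ℝ} {Xh : ℕ → Ω → g.X} {ν z : ℕ → Ω → g.Y}
  {w : ℕ → Ω → Fin (g.nx i) → ℝ}
  (hst : ∀ i, IsStabilizable (g.A i) (g.B i)) (hsol : g.UniquelySolvable ξhat Ŵ a b)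
  (E : g.InnovationModel i μ ξhat Ŵ a b N Xh ν z w)
include hst hsol E

theorem InnovationModel.integral_coord_mul_innovation (t : ℕ) {p : Type} [Fintype p]
    (A : Matrix p g.SIdx ℝ) (c : p → ℝ) (G : Matrix p (Fin g.ny) ℝ) (j : p) :
    ∫ ω, (A *ᵥ Xh t ω + c) j * (G *ᵥ ν t ω) j ∂μ = 0 := by
  have hm : Measurable fun v : g.X => fun _ : Unit => (A *ᵥ v + c) j :=
    measurable_pi_lambda _ fun _ => (measurable_pi_apply j).comp
      ((Continuous.matrix_mulVec continuous_const continuous_id).measurable.add_const c)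
  have hU : L2Vec μ fun ω (_ : Unit) => (A *ᵥ Xh t ω + c) j := fun _ =>
    (((E.l2_state t).mulVec A).add (L2Vec.const c)) j
  have h := integral_dotProduct_mulVec_eq_zero ((E.indep t).comp hm measurable_id) hU
    (E.l2_innovation t) (E.mean_innovation t) (Matrix.of fun (_ : Unit) k => G j k)
  simpa [dotProduct, Matrix.mulVec] using h

/-- The prediction of a future environment variable has at most its second moment. -/
theorem InnovationModel.integral_prediction_sq_le (k : ℕ) (j : Fin g.ny) : ∀ t,
    ∫ ω, (a k *ᵥ Xh t ω + b k) j ^ 2 ∂μ ≤ ∫ ω, z (t + k) ω j ^ 2 ∂μ := by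
  have hl2 : ∀ k t, L2Vec μ fun ω => a k *ᵥ Xh t ω + b k := fun k t =>
    ((E.l2_state t).mulVec _).add (L2Vec.const _)
  induction k with
  | zero =>
    intro t
    have h := integral_sq_le_integral_add_sq (hl2 0 t j) ((E.l2_innovation t).mulVec 1 j)
      (E.integral_coord_mul_innovation hst hsol t (a 0) (b 0) 1 j)
    refine h.trans (le_of_eq (integral_congr_ae (ae_of_all _ fun ω => ?_)))
    simp only [add_zero]
    rw [E.output, (SolvesMeanSystem.eq_pred hsol hst (Xh t ω)).1, Matrix.one_mulVec, Pi.add_apply]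
  | succ k ih =>
    intro t
    -- The prediction made one step later is the present one plus the update `aₖ N νₜ`, which is
    -- orthogonal to it; the second moment can only grow with the information.
    have h := integral_sq_le_integral_add_sq (hl2 (k + 1) t j)
      ((E.l2_innovation t).mulVec (a k * N) j)
      (E.integral_coord_mul_innovation hst hsol t (a (k + 1)) (b (k + 1)) (a k * N) j)
    have h2 := ih (t + 1)
    rw [add_right_comm, add_assoc] at h2
    refine h.trans (le_trans (le_of_eq (integral_congr_ae (ae_of_all _ fun ω => ?_))) h2)
    simp only []
    rw [E.step, (SolvesMeanSystem.eq_pred hsol hst (Xh t ω)).2 k, ← Pi.add_apply,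
      Matrix.mulVec_add, Matrix.mulVec_mulVec]
    rw [add_right_comm]

/-- Up to a constant the costate is an absolutely summable combination of predictions, whose second
moments are bounded by those of `z`. The bound is uniform in time even though none is assumed for
the filter state. -/
theorem InnovationModel.exists_costate_bound :
    ∃ C : ℝ, ∀ t, ∫ ω, g.costate Ŵ a b i (Xh t ω) ⬝ᵥ g.costate Ŵ a b i (Xh t ω) ∂μ ≤ C := by
  obtain ⟨c, hc⟩ := E.bounded
  -- The given bound may be negative when there are no environment variables.
  set c' := √(max c 0) with hc'
  have hc2 : c ≤ c' ^ 2 := by rw [hc', Real.sq_sqrt (le_max_right _ _)]; exact le_max_left _ _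
  set v := (g.Φ i * (1 - g.Φ i)⁻¹ * g.M i) *ᵥ g.ownPart i Ŵ with hv
  set G : ℕ → Matrix (Fin (g.nx i)) (Fin g.ny) ℝ := fun n => g.Φ i ^ n * g.costateSource i with hG
  have hb : ∀ t j, ∫ ω, (g.costate Ŵ a b i (Xh t ω) - v) j ^ 2 ∂μ ≤
      (∑ k, (∑' n, |G n j k|) * c') ^ 2 := fun t j =>
    integral_sq_le_of_hasSum ((Φ_pow_entrySummable (hst i)).mul_right _)
      (fun k => ((E.l2_state t).mulVec (a k)).add (L2Vec.const (b k))) (Real.sqrt_nonneg _)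
      (fun k l => (E.integral_prediction_sq_le hst hsol k l t).trans ((hc _ _).trans hc2))
      ((l2Vec_costate (E.l2_state t)).sub (L2Vec.const v))
      (fun ω => hasSum_costate (hst i) hsol.bounded_a hsol.bounded_b (Xh t ω)) j
  refine ⟨∑ j, (2 * (∑ k, (∑' n, |G n j k|) * c') ^ 2 + 2 * v j ^ 2), fun t => ?_⟩
  have hp := l2Vec_costate (Ŵ := Ŵ) (a := a) (b := b) (i := i) (E.l2_state t)
  have hd : L2Vec μ fun ω => g.costate Ŵ a b i (Xh t ω) - v := hp.sub (L2Vec.const v)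
  simp only [dotProduct]
  have hi : ∀ j, Integrable (fun ω => g.costate Ŵ a b i (Xh t ω) j
      * g.costate Ŵ a b i (Xh t ω) j) μ := fun j => (hp j).integrable_mul (hp j)
  rw [integral_finsetSum _ fun j _ => hi j]
  refine Finset.sum_le_sum fun j _ => ?_
  calc ∫ ω, g.costate Ŵ a b i (Xh t ω) j * g.costate Ŵ a b i (Xh t ω) j ∂μ
      ≤ ∫ ω, (2 * (g.costate Ŵ a b i (Xh t ω) - v) j ^ 2 + 2 * v j ^ 2) ∂μ := by
        refine integral_mono (hi j) (((hd j).integrable_sq.const_mul 2).add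
          (integrable_const _)) fun ω => ?_
        simp only [Pi.sub_apply]
        nlinarith [sq_nonneg (g.costate Ŵ a b i (Xh t ω) j - 2 * v j)]
    _ = 2 * ∫ ω, (g.costate Ŵ a b i (Xh t ω) - v) j ^ 2 ∂μ + 2 * v j ^ 2 := by
        rw [integral_add ((hd j).integrable_sq.const_mul 2) (integrable_const _),
          integral_const_mul]
        simp
    _ ≤ _ := by linarith [hb t j]

end CostateBound

end LQGame


/-- Young's inequality, from the nonnegativity of the square of `e x + y`. -/
theorem neg_le_two_mul_dotProduct {n : Type} [Fintype n] {e : ℝ} (he : 0 < e) (x y : n → ℝ) :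
    -(e * (x ⬝ᵥ x) + e⁻¹ * (y ⬝ᵥ y)) ≤ 2 * (x ⬝ᵥ y) := by
  have h := dotProduct_self_nonneg' (e • x + y)
  rw [add_dotProduct, dotProduct_add, dotProduct_add, smul_dotProduct, smul_dotProduct,
    dotProduct_smul, dotProduct_smul, dotProduct_comm y x] at h
  simp only [smul_eq_mul] at h
  have h2 := mul_nonneg (inv_nonneg.2 he.le) h
  have h3 : e⁻¹ * (e * (e * x ⬝ᵥ x) + e * x ⬝ᵥ y + (e * x ⬝ᵥ y + y ⬝ᵥ y)) =
      e * x ⬝ᵥ x + 2 * x ⬝ᵥ y + e⁻¹ * (y ⬝ᵥ y) := by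
    field_simp
    ring
  linarith

theorem exists_mulVec_dotProduct_self_le {m n : Type} [Fintype m] [Fintype n]
    (K : Matrix m n ℝ) : ∃ C : ℝ, 0 ≤ C ∧ ∀ z, (K *ᵥ z) ⬝ᵥ (K *ᵥ z) ≤ C * (z ⬝ᵥ z) := by
  refine ⟨2 * ∑ i, ∑ j, |(Kᵀ * K) i j|, by positivity, fun z => ?_⟩
  have h := (le_abs_self _).trans (abs_dotProduct_mulVec_le (Kᵀ * K) z z)
  rw [← Matrix.mulVec_mulVec, dotProduct_comm, transpose_mulVec_dotProduct] at h
  linarith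

theorem l2Vec_of_integrable_dotProduct {Ω : Type*} [MeasurableSpace Ω] {μ : Measure Ω} {n : Type}
    [Fintype n] {U : Ω → n → ℝ} (hU : Measurable U) {f : Ω → ℝ} (hf : Integrable f μ)
    (h : ∀ ω, U ω ⬝ᵥ U ω ≤ f ω) : L2Vec μ U := fun j =>
  have hm : Measurable fun ω => U ω j := (measurable_pi_apply j).comp hU
  (memLp_two_iff_integrable_sq hm.aestronglyMeasurable).2
    (hf.mono' (hm.pow_const 2).aestronglyMeasurable (ae_of_all _ fun ω => by
      rw [Real.norm_of_nonneg (sq_nonneg _)]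
      exact (sq_le_dotProduct_self (U ω) j).trans (h ω)))

namespace LQGame

/-! ### Optimality of the affine response over the infinite horizon -/

section InfiniteHorizon

variable {g : LQGame} {i : Fin g.N}

/-- The stage cost is coercive, up to a multiple of the environment variable. -/
theorem exists_stageCost_coercive : ∃ l C : ℝ, 0 < l ∧ 0 ≤ C ∧ ∀ x u z,
    l * (x ⬝ᵥ x + u ⬝ᵥ u) - C * (z ⬝ᵥ z) ≤ g.stageCost i x u z := by
  obtain ⟨l1, h1, hQ⟩ := (g.Q_posDef i).exists_pos_le_quadForm
  obtain ⟨l2, h2, hR⟩ := (g.R_posDef i).exists_pos_le_quadForm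
  obtain ⟨C1, hC1, hL⟩ := exists_mulVec_dotProduct_self_le (g.L i)ᵀ
  obtain ⟨C2, hC2, hK⟩ := exists_mulVec_dotProduct_self_le (g.K i)ᵀ
  -- Half of the definiteness is kept; the other half absorbs the cross terms with `z`.
  set l := min l1 l2 / 2 with hl
  have hl0 : 0 < l := by positivity
  have e1 : 2 * l ≤ l1 := by rw [hl]; linarith [min_le_left l1 l2]
  have e2 : 2 * l ≤ l2 := by rw [hl]; linarith [min_le_right l1 l2]
  refine ⟨l, l⁻¹ * (C1 + C2), hl0, by positivity, fun x u z => ?_⟩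
  have f1 := neg_le_two_mul_dotProduct hl0 x ((g.L i)ᵀ *ᵥ z)
  have f2 := neg_le_two_mul_dotProduct hl0 u ((g.K i)ᵀ *ᵥ z)
  rw [dotProduct_comm x ((g.L i)ᵀ *ᵥ z), transpose_mulVec_dotProduct (g.L i) z x] at f1
  rw [dotProduct_comm u ((g.K i)ᵀ *ᵥ z), transpose_mulVec_dotProduct (g.K i) z u] at f2
  have f3 := mul_le_mul_of_nonneg_left (hL z) (inv_nonneg.2 hl0.le)
  have f4 := mul_le_mul_of_nonneg_left (hK z) (inv_nonneg.2 hl0.le)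
  have f5 := mul_le_mul_of_nonneg_right e1 (dotProduct_self_nonneg' x)
  have f6 := mul_le_mul_of_nonneg_right e2 (dotProduct_self_nonneg' u)
  rw [stageCost, dotProduct_add]
  linarith [hQ x, hR u]

theorem exists_value_bounds (hst : IsStabilizable (g.A i) (g.B i)) (Ŵ : g.X)
    (a : ℕ → Matrix (Fin g.ny) g.SIdx ℝ) (b : ℕ → g.Y) : ∃ C : ℝ, 0 ≤ C ∧ ∀ X x,
    -(C * (g.costate Ŵ a b i X ⬝ᵥ g.costate Ŵ a b i X)) ≤ g.value Ŵ a b i X x ∧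
    g.value Ŵ a b i X x ≤ C * (x ⬝ᵥ x) + g.costate Ŵ a b i X ⬝ᵥ g.costate Ŵ a b i X := by
  obtain ⟨l, hl, hQ⟩ := (g.Q_posDef i).exists_pos_le_quadForm
  have hM : ∀ x, l * (x ⬝ᵥ x) ≤ x ⬝ᵥ (g.M i *ᵥ x) := fun x => by
    have h1 : 0 ≤ x ⬝ᵥ (((g.F i)ᵀ * g.R i * g.F i) *ᵥ x) := by
      have h := ((g.R_posDef i).posSemidef.conjTranspose_mul_mul_same (g.F i)).quadForm_nonneg x
      rwa [Matrix.conjTranspose_eq_transpose_of_trivial] at h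
    have h2 := mul_nonneg (g.β_nonneg i)
      ((M_posSemidef hst).quadForm_nonneg ((g.A i + g.B i * g.F i) *ᵥ x))
    rw [M_eq_policyMap hst, policyMap_quadForm, Matrix.add_mulVec, dotProduct_add]
    linarith [hQ x]
  set S := ∑ j, ∑ k, |g.M i j k| with hS
  have hS0 : 0 ≤ S := by positivity
  -- `l⁻¹` serves the lower bound, where `M ≥ Q ≥ l` absorbs the linear term; `2 * S + 1` serves the
  -- upper one.
  refine ⟨l⁻¹ + 2 * S + 1, by positivity, fun X x => ?_⟩
  set p := g.costate Ŵ a b i X with hp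
  have hpp := dotProduct_self_nonneg' p
  have hxx := dotProduct_self_nonneg' x
  have h1 := neg_le_two_mul_dotProduct hl x p
  have h2 := neg_le_two_mul_dotProduct one_pos x (-p)
  have h3 := (le_abs_self _).trans (abs_dotProduct_mulVec_le (g.M i) x x)
  rw [← hS] at h3
  rw [dotProduct_neg, neg_dotProduct, dotProduct_neg] at h2
  rw [value, ← hp, dotProduct_comm p x]
  have hl' := inv_pos.2 hl
  constructor
  · have := mul_nonneg hS0 hpp
    nlinarith [hM x]
  · have := mul_nonneg hl'.le hxx
    nlinarith

variable {ξhat : g.Y} {Ŵ : g.X} {a : ℕ → Matrix (Fin g.ny) g.SIdx ℝ}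
  {b : ℕ → g.Y} {Ω : Type*} [MeasurableSpace Ω] {μ : Measure Ω} [IsProbabilityMeasure μ]
  {N : Matrix g.SIdx (Fin g.ny) ℝ} {Xh : ℕ → Ω → g.X} {ν z : ℕ → Ω → g.Y}
  {w x x' : ℕ → Ω → Fin (g.nx i) → ℝ} {u u' : ℕ → Ω → Fin (g.nu i) → ℝ}
  (E : g.InnovationModel i μ ξhat Ŵ a b N Xh ν z w)
include E

theorem InnovationModel.exists_output_bound :
    ∃ C : ℝ, 0 ≤ C ∧ ∀ t, ∫ ω, z t ω ⬝ᵥ z t ω ∂μ ≤ C := by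
  obtain ⟨c, hc⟩ := E.bounded
  refine ⟨∑ _j : Fin g.ny, |c|, by positivity, fun t => ?_⟩
  have h := E.l2_output t
  have hi : ∀ j, Integrable (fun ω => z t ω j * z t ω j) μ := fun j => (h j).integrable_mul (h j)
  simp only [dotProduct]
  rw [integral_finsetSum _ fun j _ => hi j]
  refine Finset.sum_le_sum fun j _ => (le_trans (le_of_eq ?_) (hc t j)).trans (le_abs_self c)
  simp only [sq]

theorem IsResponse.l2_of_affine (R : g.IsResponse i μ ν z w x u)
    (hdev : ∀ t ω, u t ω = g.F i *ᵥ x t ω + g.Gi a i *ᵥ Xh t ω + g.Hi Ŵ b i) (t : ℕ) :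
    L2Vec μ (x t) ∧ L2Vec μ (u t) := by
  have hu : ∀ t, L2Vec μ (x t) → L2Vec μ (u t) := fun t hx => by
    rw [funext (hdev t)]
    exact ((hx.mulVec _).add ((E.l2_state t).mulVec _)).add (L2Vec.const _)
  suffices h : L2Vec μ (x t) from ⟨h, hu t h⟩
  induction t with
  | zero => exact R.l2_init
  | succ t ih =>
    rw [funext (R.step t)]
    exact (((ih.mulVec _).add ((hu t ih).mulVec _)).add ((E.l2_output t).mulVec _)).add
      (E.l2_disturbance t)

/-- Coercivity turns an integrable cost into square integrability, so that no moment condition has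
to be imposed on competing strategies. -/
theorem l2Vec_of_integrable_stageCost {x : Ω → Fin (g.nx i) → ℝ} {u : Ω → Fin (g.nu i) → ℝ}
    (hx : Measurable x) (hu : Measurable u) (t : ℕ)
    (h : Integrable (fun ω => g.stageCost i (x ω) (u ω) (z t ω)) μ) :
    L2Vec μ x ∧ L2Vec μ u := by
  obtain ⟨l, C, hl, hC, hco⟩ := exists_stageCost_coercive (g := g) (i := i)
  have hz := (E.l2_output t).integrable_dotProduct (E.l2_output t)
  have hf : Integrable (fun ω => l⁻¹ * (g.stageCost i (x ω) (u ω) (z t ω)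
      + C * (z t ω ⬝ᵥ z t ω))) μ := (h.add (hz.const_mul C)).const_mul _
  have key : ∀ ω, x ω ⬝ᵥ x ω + u ω ⬝ᵥ u ω ≤ l⁻¹ * (g.stageCost i (x ω) (u ω) (z t ω)
      + C * (z t ω ⬝ᵥ z t ω)) := fun ω => by
    rw [inv_mul_eq_div, le_div_iff₀ hl]
    linarith [hco (x ω) (u ω) (z t ω)]
  exact ⟨l2Vec_of_integrable_dotProduct hx hf fun ω =>
      (le_add_of_nonneg_right (dotProduct_self_nonneg' (u ω))).trans (key ω),
    l2Vec_of_integrable_dotProduct hu hf fun ω =>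
      (le_add_of_nonneg_left (dotProduct_self_nonneg' (x ω))).trans (key ω)⟩

variable (hst : ∀ i, IsStabilizable (g.A i) (g.B i)) (hsol : g.UniquelySolvable ξhat Ŵ a b)
include hst hsol

/-- Terminal values compare up to a multiple of the second moment of the competing state. -/
theorem InnovationModel.exists_value_sub_le : ∃ C D : ℝ, 0 ≤ C ∧ ∀ t (y y' : Ω → Fin (g.nx i) → ℝ),
    L2Vec μ y → L2Vec μ y' →
    ∫ ω, g.value Ŵ a b i (Xh t ω) (y' ω) ∂μ - ∫ ω, g.value Ŵ a b i (Xh t ω) (y ω) ∂μ ≤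
      C * ∫ ω, y' ω ⬝ᵥ y' ω ∂μ + D := by
  obtain ⟨C, hC, hV⟩ := exists_value_bounds (hst i) Ŵ a b
  obtain ⟨P, hP⟩ := E.exists_costate_bound hst hsol
  refine ⟨C, (C + 1) * P, hC, fun t y y' hy hy' => ?_⟩
  have hp := l2Vec_costate (Ŵ := Ŵ) (a := a) (b := b) (i := i) (E.l2_state t)
  have hpp := hp.integrable_dotProduct hp
  have h1 := integral_mono (hpp.const_mul C).neg (integrable_value (E.l2_state t) hy)
    fun ω => (hV (Xh t ω) (y ω)).1
  have hyy := hy'.integrable_dotProduct hy'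
  have h2 := integral_mono (integrable_value (E.l2_state t) hy') ((hyy.const_mul C).add hpp)
    fun ω => (hV (Xh t ω) (y' ω)).2
  rw [integral_neg', integral_const_mul] at h1
  rw [integral_add' (hyy.const_mul C) hpp, integral_const_mul] at h2
  have h3 := mul_le_mul_of_nonneg_left (hP t) hC
  have := hP t
  linarith

/-- A response with finite cost costs at least as much as the affine one. -/
theorem IsResponse.tsum_integral_le (R : g.IsResponse i μ ν z w x u)
    (R' : g.IsResponse i μ ν z w x' u') (h0 : x 0 = x' 0)
    (hdev : ∀ t ω, u t ω = g.F i *ᵥ x t ω + g.Gi a i *ᵥ Xh t ω + g.Hi Ŵ b i)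
    (hx' : ∀ t, Measurable (x' t)) (hu' : ∀ t, Measurable (u' t))
    (hfin : ∀ t, Integrable (fun ω => g.β i ^ t * g.stageCost i (x' t ω) (u' t ω) (z t ω)) μ)
    (hsum : Summable fun t => ∫ ω, |g.β i ^ t * g.stageCost i (x' t ω) (u' t ω) (z t ω)| ∂μ) :
    (∀ t, Integrable (fun ω => g.β i ^ t * g.stageCost i (x t ω) (u t ω) (z t ω)) μ) ∧
    (Summable fun t => ∫ ω, |g.β i ^ t * g.stageCost i (x t ω) (u t ω) (z t ω)| ∂μ) ∧
    ∑' t, ∫ ω, g.β i ^ t * g.stageCost i (x t ω) (u t ω) (z t ω) ∂μ ≤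
      ∑' t, ∫ ω, g.β i ^ t * g.stageCost i (x' t ω) (u' t ω) (z t ω) ∂μ := by
  have hxu := R.l2_of_affine E hdev
  have hz := E.l2_output
  have hc : ∀ t, Integrable (fun ω => g.stageCost i (x t ω) (u t ω) (z t ω)) μ := fun t =>
    integrable_stageCost (hxu t).1 (hxu t).2 (hz t)
  -- When `β = 0`, the weighted costs after time zero vanish and carry no information on the
  -- competitor.
  have hxu' : ∀ t, g.β i ^ t ≠ 0 → L2Vec μ (x' t) ∧ L2Vec μ (u' t) := fun t ht =>
    l2Vec_of_integrable_stageCost E (hx' t) (hu' t) t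
      (((hfin t).const_mul (g.β i ^ t)⁻¹).congr (ae_of_all _ fun ω =>
        inv_mul_cancel_left₀ ht _))
  refine ⟨fun t => (hc t).const_mul _, ?_⟩
  -- For `β = 0` only the stage `t = 0` counts, as `0 ^ 0 = 1`, and the comparison over the horizon
  -- `1` suffices.
  rcases (g.β_nonneg i).eq_or_lt with hβ | hβ
  · have hzero : ∀ t, t ≠ 0 → g.β i ^ t = 0 := fun t ht => by rw [← hβ, zero_pow ht]
    refine ⟨summable_of_ne_finset_zero (s := {0}) fun t ht => ?_, ?_⟩
    · simp [hzero t (by simpa using ht)]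
    · rw [tsum_eq_single 0 fun t ht => by simp [hzero t ht],
        tsum_eq_single 0 fun t ht => by simp [hzero t ht]]
      have h := R.sum_integral_le hst hsol E R' h0 hdev (T := 1) (fun t _ => (hxu t).2)
        (fun t ht => (hxu' t (by simp [Nat.lt_one_iff.1 ht])).2)
      rw [hzero 1 one_ne_zero] at h
      simpa using h
  · have hβt : ∀ t, 0 < g.β i ^ t := fun t => pow_pos hβ t
    have hl2' := fun t => hxu' t (hβt t).ne'
    obtain ⟨l, C, hl, hC, hco⟩ := exists_stageCost_coercive (g := g) (i := i)
    obtain ⟨Z, hZ0, hZ⟩ := E.exists_output_bound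
    obtain ⟨V, D, hV0, hV⟩ := E.exists_value_sub_le hst hsol
    have hgeo : Summable fun t => g.β i ^ t :=
      summable_geometric_of_lt_one (g.β_nonneg i) (g.β_lt_one i)
    have hzz := fun t => (hz t).integrable_dotProduct (hz t)
    simp only [integral_const_mul] at hsum ⊢
    set c : ℕ → ℝ := fun t => ∫ ω, g.stageCost i (x t ω) (u t ω) (z t ω) ∂μ with hcdef
    set c' : ℕ → ℝ := fun t => ∫ ω, g.stageCost i (x' t ω) (u' t ω) (z t ω) ∂μ with hcdef'
    have hsum' : Summable fun t => g.β i ^ t * c' t := by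
      refine Summable.of_norm_bounded hsum fun t => ?_
      rw [hcdef', ← integral_const_mul]
      exact norm_integral_le_integral_norm _
    have hx2 : ∀ t, l * ∫ ω, x' t ω ⬝ᵥ x' t ω ∂μ ≤ c' t + C * Z := by
      intro t
      have hxx := (hl2' t).1.integrable_dotProduct (hl2' t).1
      have hc' := integrable_stageCost (hl2' t).1 (hl2' t).2 (hz t)
      have h1 := integral_mono (hxx.const_mul l) (hc'.add ((hzz t).const_mul C)) fun ω => by
        have := hco (x' t ω) (u' t ω) (z t ω)
        have := mul_nonneg hl.le (dotProduct_self_nonneg' (u' t ω))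
        simp only [Pi.add_apply]
        linarith
      rw [integral_const_mul, integral_add' hc' ((hzz t).const_mul C), integral_const_mul] at h1
      linarith [mul_le_mul_of_nonneg_left (hZ t) hC]
    -- `δ T` bounds the discounted difference of terminal values. Coercivity bounds the competitor's
    -- second moment by its stage cost, and `β ^ T * c' T` tends to zero as the term of a convergent
    -- series.
    set δ : ℕ → ℝ := fun t =>
      (V * l⁻¹) * (g.β i ^ t * c' t) + (V * l⁻¹ * (C * Z) + D) * g.β i ^ t with hδ
    have hδ0 : Tendsto δ atTop (𝓝 0) := by
      have h := (hsum'.tendsto_atTop_zero.const_mul (V * l⁻¹)).add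
        (hgeo.tendsto_atTop_zero.const_mul (V * l⁻¹ * (C * Z) + D))
      simpa using h
    have hle : ∀ T, ∑ t ∈ Finset.range T, g.β i ^ t * c t ≤
        ∑ t ∈ Finset.range T, g.β i ^ t * c' t + δ T := by
      intro T
      have h1 := R.sum_integral_le hst hsol E R' h0 hdev (T := T) (fun t _ => (hxu t).2)
        (fun t _ => (hl2' t).2)
      have h2 := hV T (x T) (x' T) (hxu T).1 (hl2' T).1
      have h3 : ∫ ω, x' T ω ⬝ᵥ x' T ω ∂μ ≤ l⁻¹ * (c' T + C * Z) := by
        rw [inv_mul_eq_div, le_div_iff₀ hl]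
        linarith [hx2 T]
      have h4 := mul_le_mul_of_nonneg_left
        (h2.trans (add_le_add (mul_le_mul_of_nonneg_left h3 hV0) le_rfl)) (hβt T).le
      have h5 : g.β i ^ T * (V * (l⁻¹ * (c' T + C * Z)) + D) = δ T := by
        rw [hδ]
        ring
      linarith
    have hpart := hsum'.hasSum.tendsto_sum_nat.add hδ0
    -- The stage cost is at least `-C |z|²`, so its absolute value exceeds it by at most `2 C |z|²`.
    -- Absolute summability then follows from bounded partial sums: finiteness of the affine cost is
    -- inferred from that of the competitor.
    have habs : ∀ t, ∫ ω, |g.β i ^ t * g.stageCost i (x t ω) (u t ω) (z t ω)| ∂μ ≤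
        g.β i ^ t * c t + 2 * (C * Z) * g.β i ^ t := by
      intro t
      have h1 : ∀ ω, |g.stageCost i (x t ω) (u t ω) (z t ω)| ≤
          g.stageCost i (x t ω) (u t ω) (z t ω) + 2 * C * (z t ω ⬝ᵥ z t ω) := fun ω => by
        have h2 := hco (x t ω) (u t ω) (z t ω)
        have h3 := mul_nonneg hl.le (add_nonneg (dotProduct_self_nonneg' (x t ω))
          (dotProduct_self_nonneg' (u t ω)))
        have h4 := mul_nonneg hC (dotProduct_self_nonneg' (z t ω))
        exact abs_le.2 ⟨by linarith, by linarith⟩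
      have h5 := integral_mono (hc t).abs ((hc t).add ((hzz t).const_mul (2 * C))) h1
      rw [integral_add' (hc t) ((hzz t).const_mul (2 * C)), integral_const_mul] at h5
      simp only [abs_mul, abs_of_pos (hβt t), integral_const_mul]
      have h6 := mul_le_mul_of_nonneg_left (hZ t) (mul_nonneg zero_le_two hC)
      have h7 := mul_le_mul_of_nonneg_left (h5.trans (add_le_add le_rfl h6)) (hβt t).le
      linarith
    have hs : Summable fun t =>
        ∫ ω, |g.β i ^ t * g.stageCost i (x t ω) (u t ω) (z t ω)| ∂μ := by
      obtain ⟨Bd, hBd⟩ := hpart.bddAbove_range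
      refine summable_of_sum_range_le (fun t => integral_nonneg fun ω => abs_nonneg _)
        (c := Bd + 2 * (C * Z) * ∑' t, g.β i ^ t) fun T => ?_
      refine (Finset.sum_le_sum fun t _ => habs t).trans ?_
      rw [Finset.sum_add_distrib, ← Finset.mul_sum]
      refine add_le_add ((hle T).trans (hBd ⟨T, rfl⟩)) (mul_le_mul_of_nonneg_left
        (hgeo.sum_le_tsum _ fun t _ => (hβt t).le) (by positivity))
    have hsc : Summable fun t => g.β i ^ t * c t := by
      refine Summable.of_norm_bounded hs fun t => ?_
      rw [hcdef, ← integral_const_mul]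
      exact norm_integral_le_integral_norm _
    refine ⟨hs, ?_⟩
    have h := le_of_tendsto_of_tendsto' hsc.hasSum.tendsto_sum_nat hpart hle
    rwa [add_zero] at h

end InfiniteHorizon

end LQGame


/-! ### Independence on product spaces -/

section ProductIndependence

variable {Z Ω α β : Type*} [MeasurableSpace Z] [MeasurableSpace Ω] [MeasurableSpace α]
  [MeasurableSpace β] {ζ : Measure Z} {P : Measure Ω} [IsProbabilityMeasure ζ]
  [IsProbabilityMeasure P]

/-- The law of `B` does not involve the second coordinate, so independence on every section
integrates to independence on the product. -/
theorem indepFun_prod_fst {f : Z × Ω → α} (hf : Measurable f) {B : Z → β} (hB : Measurable B)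
    (h : ∀ ω, IndepFun (fun z => f (z, ω)) B ζ) :
    IndepFun f (fun q => B q.1) (ζ.prod P) := by
  rw [indepFun_iff_measure_inter_preimage_eq_mul]
  intro S T hS hT
  have h1 : (fun q : Z × Ω => B q.1) ⁻¹' T = (B ⁻¹' T) ×ˢ Set.univ := by ext; simp
  rw [h1, Measure.prod_prod, measure_univ, mul_one,
    Measure.prod_apply_symm ((hf hS).inter ((hB hT).prod MeasurableSet.univ)),
    Measure.prod_apply_symm (hf hS), ← lintegral_mul_const _ (measurable_measure_prodMk_right (hf hS))]
  refine lintegral_congr fun ω => ?_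
  have h2 := (indepFun_iff_measure_inter_preimage_eq_mul.1 (h ω)) S T hS hT
  refine Eq.trans (congrArg ζ ?_) h2
  ext z
  simp

theorem indepFun_prod_snd {f : Z × Ω → α} (hf : Measurable f) {B : Ω → β} (hB : Measurable B)
    (h : ∀ z, IndepFun (fun ω => f (z, ω)) B P) :
    IndepFun f (fun q => B q.2) (ζ.prod P) := by
  rw [indepFun_iff_measure_inter_preimage_eq_mul]
  intro S T hS hT
  have h1 : (fun q : Z × Ω => B q.2) ⁻¹' T = Set.univ ×ˢ (B ⁻¹' T) := by ext; simp
  rw [h1, Measure.prod_prod, measure_univ, one_mul,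
    Measure.prod_apply ((hf hS).inter (MeasurableSet.univ.prod (hB hT))),
    Measure.prod_apply (hf hS), ← lintegral_mul_const _ (measurable_measure_prodMk_left (hf hS))]
  refine lintegral_congr fun z => ?_
  have h2 := (indepFun_iff_measure_inter_preimage_eq_mul.1 (h z)) S T hS hT
  refine Eq.trans (congrArg P ?_) h2
  ext ω
  simp

theorem L2Vec.comp_fst {ι : Type} {U : Z → ι → ℝ} (hU : L2Vec ζ U) :
    L2Vec (ζ.prod P) fun q => U q.1 := fun j =>
  (hU j).comp_measurePreserving measurePreserving_fst

theorem L2Vec.comp_snd {ι : Type} {U : Ω → ι → ℝ} (hU : L2Vec P U) :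
    L2Vec (ζ.prod P) fun q => U q.2 := fun j =>
  (hU j).comp_measurePreserving measurePreserving_snd

end ProductIndependence

theorem summable_integral_abs_of_tsum_lintegral {Ω : Type*} [MeasurableSpace Ω] {μ : Measure Ω}
    {f : ℕ → Ω → ℝ} (hf : ∀ t, Measurable (f t))
    (hp : ∑' t, ∫⁻ ω, ENNReal.ofReal (f t ω) ∂μ ≠ ⊤)
    (hn : ∑' t, ∫⁻ ω, ENNReal.ofReal (-(f t ω)) ∂μ ≠ ⊤) :
    (∀ t, Integrable (f t) μ) ∧ Summable fun t => ∫ ω, |f t ω| ∂μ := by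
  have h1 : ∀ t, ∫⁻ ω, ENNReal.ofReal |f t ω| ∂μ ≤
      ∫⁻ ω, ENNReal.ofReal (f t ω) ∂μ + ∫⁻ ω, ENNReal.ofReal (-(f t ω)) ∂μ := fun t => by
    rw [← lintegral_add_left (hf t).ennreal_ofReal]
    refine lintegral_mono fun ω => ?_
    rcases abs_cases (f t ω) with h | h <;> rw [h.1]
    · exact le_self_add
    · exact le_add_self
  have h2 : ∑' t, ∫⁻ ω, ENNReal.ofReal |f t ω| ∂μ ≠ ⊤ := by
    refine ne_top_of_le_ne_top ?_ (ENNReal.tsum_le_tsum h1)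
    rw [ENNReal.tsum_add]
    exact ENNReal.add_ne_top.2 ⟨hp, hn⟩
  have h3 : ∀ t, Integrable (f t) μ := fun t => by
    refine ⟨(hf t).aestronglyMeasurable, ?_⟩
    rw [hasFiniteIntegral_iff_norm]
    exact lt_top_iff_ne_top.2 (ENNReal.ne_top_of_tsum_ne_top h2 t)
  refine ⟨h3, (ENNReal.summable_toReal h2).congr fun t => ?_⟩
  rw [← ofReal_integral_eq_lintegral_ofReal (h3 t).abs (ae_of_all _ fun ω => abs_nonneg _),
    ENNReal.toReal_ofReal (integral_nonneg fun ω => abs_nonneg _)]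

theorem measurable_finSnoc {α β : Type*} [MeasurableSpace α] [MeasurableSpace β] {t : ℕ}
    {f : α → Fin t → β} {h : α → β} (hf : Measurable f) (hh : Measurable h) :
    Measurable fun p => (Fin.snoc (α := fun _ => β) (f p) (h p) : Fin (t + 1) → β) := by
  refine measurable_pi_lambda _ fun k => Fin.lastCases ?_ (fun j => ?_) k
  · simpa only [Fin.snoc_last] using hh
  · simpa only [Fin.snoc_castSucc, Function.comp_def] using (measurable_pi_apply j).comp hf

namespace LQGame

/-! ### Responses to an exogenous sequence -/

section OwnHistory

variable {g : LQGame} {i : Fin g.N} (s : g.Strategy i)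

/-- State of a decision maker using `s` against the exogenous sequence `z`. -/
def ownState (x₀ : Fin (g.nx i) → ℝ) (w : ℕ → Fin (g.nx i) → ℝ) (z : ℕ → g.Y) (t : ℕ) :
    Fin (g.nx i) → ℝ := (ownHist s x₀ w z t).1 (Fin.last t)

/-- Control of a decision maker using `s` against the exogenous sequence `z`. -/
def ownControl (x₀ : Fin (g.nx i) → ℝ) (w : ℕ → Fin (g.nx i) → ℝ) (z : ℕ → g.Y) (t : ℕ) :
    Fin (g.nu i) → ℝ :=
  s.act t (ownHist s x₀ w z t).1 (ownHist s x₀ w z t).2 fun k => z k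

theorem ownState_succ (x₀ : Fin (g.nx i) → ℝ) (w : ℕ → Fin (g.nx i) → ℝ) (z : ℕ → g.Y) (t : ℕ) :
    ownState s x₀ w z (t + 1) = g.A i *ᵥ ownState s x₀ w z t + g.B i *ᵥ ownControl s x₀ w z t
      + g.C i *ᵥ z t + w t := by
  simp only [ownState, ownHist, Fin.snoc_last]
  rfl

/-- Causality. It permits replacing the future of `w` and `z` by zeros, which exhibits states and
controls as measurable functions of finite pasts. -/
theorem ownHist_congr {x₀ : Fin (g.nx i) → ℝ} {w w' : ℕ → Fin (g.nx i) → ℝ} {z z' : ℕ → g.Y}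
    {t : ℕ} (hw : ∀ k < t, w k = w' k) (hz : ∀ k < t, z k = z' k) :
    ownHist s x₀ w z t = ownHist s x₀ w' z' t := by
  induction t with
  | zero => rfl
  | succ t ih =>
    have h1 := ih (fun k hk => hw k (by omega)) fun k hk => hz k (by omega)
    have h2 : (fun k : Fin t => z k) = fun k : Fin t => z' k :=
      funext fun k => hz k (by omega)
    simp only [ownHist]
    rw [h1, h2, hw t (by omega), hz t (by omega)]

theorem measurable_ownHist (t : ℕ) :
    Measurable fun p : (Fin (g.nx i) → ℝ) × (ℕ → Fin (g.nx i) → ℝ) × (ℕ → g.Y) =>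
      ownHist s p.1 p.2.1 p.2.2 t := by
  have hmv : ∀ {p q : Type} [Fintype p] [Fintype q] (M : Matrix p q ℝ)
      {f : (Fin (g.nx i) → ℝ) × (ℕ → Fin (g.nx i) → ℝ) × (ℕ → g.Y) → q → ℝ}, Measurable f →
      Measurable fun z => M *ᵥ f z :=
    fun M f hf => (Continuous.matrix_mulVec continuous_const continuous_id).measurable.comp hf
  induction t with
  | zero =>
    exact (measurable_pi_lambda _ fun _ => measurable_fst).prodMk
      (measurable_pi_lambda _ fun k => k.elim0)
  | succ t ih =>
    have hz : ∀ k, Measurable fun p : (Fin (g.nx i) → ℝ) × (ℕ → Fin (g.nx i) → ℝ) × (ℕ → g.Y) =>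
        p.2.2 k := fun k => (measurable_pi_apply k).comp (measurable_snd.comp measurable_snd)
    have hw : Measurable fun p : (Fin (g.nx i) → ℝ) × (ℕ → Fin (g.nx i) → ℝ) × (ℕ → g.Y) =>
        p.2.1 t := (measurable_pi_apply t).comp (measurable_fst.comp measurable_snd)
    have hu := (s.measurable_act t).comp ((measurable_fst.comp ih).prodMk
      ((measurable_snd.comp ih).prodMk (measurable_pi_lambda _ fun k : Fin t => hz k)))
    exact (measurable_finSnoc (measurable_fst.comp ih)
      ((((hmv _ ((measurable_pi_apply (Fin.last t)).comp (measurable_fst.comp ih))).add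
        (hmv _ hu)).add (hmv _ (hz t))).add hw)).prodMk
      (measurable_finSnoc (measurable_snd.comp ih) hu)

theorem measurable_ownState (t : ℕ) :
    Measurable fun p : (Fin (g.nx i) → ℝ) × (ℕ → Fin (g.nx i) → ℝ) × (ℕ → g.Y) =>
      ownState s p.1 p.2.1 p.2.2 t :=
  (measurable_pi_apply (Fin.last t)).comp (measurable_fst.comp (measurable_ownHist s t))

theorem measurable_ownControl (t : ℕ) :
    Measurable fun p : (Fin (g.nx i) → ℝ) × (ℕ → Fin (g.nx i) → ℝ) × (ℕ → g.Y) =>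
      ownControl s p.1 p.2.1 p.2.2 t :=
  have hz : Measurable fun (p : (Fin (g.nx i) → ℝ) × (ℕ → Fin (g.nx i) → ℝ) × (ℕ → g.Y))
      (k : Fin t) => p.2.2 k := measurable_pi_lambda _ fun k =>
    (measurable_pi_apply (k : ℕ)).comp (measurable_snd.comp measurable_snd)
  (s.measurable_act t).comp ((measurable_fst.comp (measurable_ownHist s t)).prodMk
    ((measurable_snd.comp (measurable_ownHist s t)).prodMk hz))

end OwnHistory

/-- A finite initial segment extended by zeros. -/
def extendZero {E : Type} [Zero E] {t : ℕ} (v : Fin t → E) (k : ℕ) : E :=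
  if h : k < t then v ⟨k, h⟩ else 0

theorem extendZero_apply {E : Type} [Zero E] {t : ℕ} (v : ℕ → E) {k : ℕ} (hk : k < t) :
    extendZero (fun j : Fin t => v j) k = v k := by
  simp [extendZero, hk]

theorem measurable_extendZero {E : Type} [Zero E] [MeasurableSpace E] (t : ℕ) :
    Measurable (extendZero : (Fin t → E) → ℕ → E) := by
  refine measurable_pi_lambda _ fun k => ?_
  by_cases hk : k < t
  · simpa [extendZero, hk] using measurable_pi_apply (⟨k, hk⟩ : Fin t)
  · simp [extendZero, hk]

/-! ### Independence of a disturbance from the past primitives. -/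

section Primitive

variable {g : LQGame} {Ω : Type*} [MeasurableSpace Ω] {P : Measure Ω} [IsProbabilityMeasure P]
  {X₀ : Ω → g.X} {ξ : ℕ → Ω → g.Y} {W : ℕ → Ω → g.X} (hstd : g.StandingAssumptions P X₀ ξ W)
include hstd

/-- Group the independent family into `W t` and everything else; `X₀` and the earlier disturbances
are measurable for the latter. -/
theorem StandingAssumptions.indepFun_past_W (t : ℕ) :
    IndepFun (fun ω => (X₀ ω, fun k : Fin t => W k ω)) (W t) P := by
  set m : Unit ⊕ ℕ ⊕ ℕ → MeasurableSpace Ω :=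
    Sum.elim (fun _ : Unit => MeasurableSpace.comap X₀ inferInstance)
      (Sum.elim (fun t : ℕ => MeasurableSpace.comap (W t) inferInstance)
        (fun t : ℕ => MeasurableSpace.comap (ξ t) inferInstance)) with hm
  have hle : ∀ n, m n ≤ ‹MeasurableSpace Ω› := by
    rintro (_ | _ | _)
    · exact hstd.measurable_X₀.comap_le
    · exact (hstd.measurable_W _).comap_le
    · exact (hstd.measurable_ξ _).comap_le
  set S : Set (Unit ⊕ ℕ ⊕ ℕ) := {n | n ≠ .inr (.inl t)} with hS
  have hST : Disjoint S {.inr (.inl t)} := by simp [hS]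
  have h := indep_iSup_of_disjoint hle hstd.indep hST
  rw [iSup_singleton] at h
  refine (IndepFun_iff_Indep _ _ _).2 (indep_of_indep_of_le_left h ?_)
  have hX : Measurable[⨆ n ∈ S, m n] X₀ :=
    Measurable.mono (comap_measurable X₀) (le_iSup₂_of_le (.inl ()) (by simp [hS]) le_rfl) le_rfl
  have hW : ∀ k : Fin t, Measurable[⨆ n ∈ S, m n] (W k) := fun k =>
    Measurable.mono (comap_measurable (W k))
      (le_iSup₂_of_le (.inr (.inl (k : ℕ))) (by simp [hS, k.2.ne]) le_rfl) le_rfl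
  exact (Measurable.prodMk hX
    (@measurable_pi_lambda _ _ _ (⨆ n ∈ S, m n) _ _ hW)).comap_le

end Primitive

end LQGame


namespace LQGame

/-! ### Optimality of the affine strategy with the filter -/

section Optimality

variable {g : LQGame} {Ω : Type*} [MeasurableSpace Ω] {P : Measure Ω} [IsProbabilityMeasure P]
  {X₀ : Ω → g.X} {ξ : ℕ → Ω → g.Y} {W : ℕ → Ω → g.X} {ζ : Measure (ℕ → g.Y)}
  [IsProbabilityMeasure ζ]

theorem measurable_ownPart (i : Fin g.N) : Measurable (g.ownPart i) :=
  measurable_pi_lambda _ fun _ => measurable_pi_apply _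

/-- State of decision maker `i` on the product of the belief and the primitive probability
space. -/
def responseState (X₀ : Ω → g.X) (W : ℕ → Ω → g.X) {i : Fin g.N} (s : g.Strategy i) (t : ℕ)
    (q : (ℕ → g.Y) × Ω) : Fin (g.nx i) → ℝ :=
  ownState s (g.ownPart i (X₀ q.2)) (fun k => g.ownPart i (W k q.2)) q.1 t

/-- Control of decision maker `i` on the product of the belief and the primitive probability
space. -/
def responseControl (X₀ : Ω → g.X) (W : ℕ → Ω → g.X) {i : Fin g.N} (s : g.Strategy i) (t : ℕ)
    (q : (ℕ → g.Y) × Ω) : Fin (g.nu i) → ℝ :=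
  ownControl s (g.ownPart i (X₀ q.2)) (fun k => g.ownPart i (W k q.2)) q.1 t

theorem costJ_eq {i : Fin g.N} (s : g.Strategy i) : costJ P X₀ W s = fun z =>
    extExp P fun ω => extSum fun t => g.β i ^ t *
      g.stageCost i (responseState X₀ W s t (z, ω)) (responseControl X₀ W s t (z, ω)) (z t) := rfl

theorem measurable_stageCost {α : Type*} [MeasurableSpace α] {i : Fin g.N}
    {x : α → Fin (g.nx i) → ℝ} {u : α → Fin (g.nu i) → ℝ} {z : α → g.Y} (hx : Measurable x)
    (hu : Measurable u) (hz : Measurable z) :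
    Measurable fun q => g.stageCost i (x q) (u q) (z q) := by
  have hc : Continuous fun p : (Fin (g.nx i) → ℝ) × (Fin (g.nu i) → ℝ) × g.Y =>
      g.stageCost i p.1 p.2.1 p.2.2 := by
    unfold stageCost
    fun_prop
  exact hc.measurable.comp (hx.prodMk (hu.prodMk hz))

variable (hstd : g.StandingAssumptions P X₀ ξ W)
include hstd

theorem measurable_responseInput (i : Fin g.N) :
    Measurable fun q : (ℕ → g.Y) × Ω =>
      (g.ownPart i (X₀ q.2), (fun k => g.ownPart i (W k q.2)), q.1) :=
  ((measurable_ownPart i).comp (hstd.measurable_X₀.comp measurable_snd)).prodMk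
    ((measurable_pi_lambda _ fun k =>
      (measurable_ownPart i).comp ((hstd.measurable_W k).comp measurable_snd)).prodMk
    measurable_fst)

theorem measurable_responseState {i : Fin g.N} (s : g.Strategy i) (t : ℕ) :
    Measurable (responseState X₀ W s t) :=
  (measurable_ownState s t).comp (measurable_responseInput hstd i)

theorem measurable_responseControl {i : Fin g.N} (s : g.Strategy i) (t : ℕ) :
    Measurable (responseControl X₀ W s t) :=
  (measurable_ownControl s t).comp (measurable_responseInput hstd i)

/-- In `E^ζ[J]` the sequence `z` is independent of the own primitives, hence the product measure.
With the primitives frozen, state and control depend on the past of `z`, which is independent of the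
innovation; with `z` frozen, they depend on `X₀` and earlier disturbances, which are independent of
`W t`. -/
theorem isResponse_response {i : Fin g.N} (s : g.Strategy i)
    {f : ∀ t, (Fin t → g.Y) → g.Y} (hf : ∀ t, Measurable (f t))
    (hind : ∀ t, IndepFun (fun (z : ℕ → g.Y) (k : Fin t) => z k)
      (fun z => z t - f t fun k => z k) ζ) :
    g.IsResponse i (ζ.prod P) (fun t q => q.1 t - f t fun k => q.1 k) (fun t q => q.1 t)
      (fun t q => g.ownPart i (W t q.2)) (responseState X₀ W s) (responseControl X₀ W s) := by
  have hνm : ∀ t, Measurable fun z : ℕ → g.Y => z t - f t fun k : Fin t => z k := fun t =>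
    (measurable_pi_apply t).sub ((hf t).comp (measurable_pi_lambda _ fun k => measurable_pi_apply _))
  have hwm : ∀ t, Measurable fun ω => g.ownPart i (W t ω) := fun t =>
    (measurable_ownPart i).comp (hstd.measurable_W t)
  have hloc : ∀ (x₀ : Fin (g.nx i) → ℝ) (w : ℕ → Fin (g.nx i) → ℝ) (z : ℕ → g.Y) t,
      ownHist s x₀ w z t = ownHist s x₀ (extendZero fun k : Fin t => w k)
        (extendZero fun k : Fin t => z k) t := fun x₀ w z t =>
    ownHist_congr s (fun k hk => (extendZero_apply w hk).symm)
      fun k hk => (extendZero_apply z hk).symm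
  have hx : ∀ (x₀ : Fin (g.nx i) → ℝ) (w : ℕ → Fin (g.nx i) → ℝ) (z : ℕ → g.Y) t,
      ownState s x₀ w z t = ownState s x₀ (extendZero fun k : Fin t => w k)
        (extendZero fun k : Fin t => z k) t := fun x₀ w z t => by
    rw [ownState, hloc]
    rfl
  have hu : ∀ (x₀ : Fin (g.nx i) → ℝ) (w : ℕ → Fin (g.nx i) → ℝ) (z : ℕ → g.Y) t,
      ownControl s x₀ w z t = ownControl s x₀ (extendZero fun k : Fin t => w k)
        (extendZero fun k : Fin t => z k) t := fun x₀ w z t => by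
    have hz : (fun k : Fin t => z k) = fun k : Fin t => extendZero (fun j : Fin t => z j) k :=
      funext fun k => (extendZero_apply z k.2).symm
    rw [ownControl, hloc, ownControl, ← hz]
  have hsecz : ∀ t ω, Measurable fun v : Fin t → g.Y => (g.ownPart i (X₀ ω),
      (extendZero fun k : Fin t => g.ownPart i (W k ω) : ℕ → Fin (g.nx i) → ℝ),
      (extendZero v : ℕ → g.Y)) := fun t ω =>
    measurable_const.prodMk (measurable_const.prodMk (measurable_extendZero t))
  have hsecω : ∀ t (z : ℕ → g.Y), Measurable fun v : g.X × (Fin t → g.X) => (g.ownPart i v.1,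
      (extendZero fun k : Fin t => g.ownPart i (v.2 k) : ℕ → Fin (g.nx i) → ℝ),
      (extendZero fun k : Fin t => z k : ℕ → g.Y)) := fun t z =>
    ((measurable_ownPart i).comp measurable_fst).prodMk (Measurable.prodMk
      ((measurable_extendZero t).comp (measurable_pi_lambda _ fun k =>
        (measurable_ownPart i).comp ((measurable_pi_apply k).comp measurable_snd)))
      measurable_const)
  refine ⟨fun t q => ownState_succ s _ _ _ t, ?_, fun t => ?_, fun t => ?_, fun t => ?_,
    fun t => ?_⟩
  · exact L2Vec.comp_snd (U := fun ω => g.ownPart i (X₀ ω)) fun j => hstd.memLp_X₀.l2Vec _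
  · refine indepFun_prod_fst (measurable_responseState hstd s t) (hνm t) fun ω => ?_
    exact ((hind t).comp ((measurable_ownState s t).comp (hsecz t ω)) measurable_id).congr
      (ae_of_all _ fun z => (hx _ (fun k => g.ownPart i (W k ω)) z t).symm) (ae_of_all _ fun z => rfl)
  · refine indepFun_prod_fst (measurable_responseControl hstd s t) (hνm t) fun ω => ?_
    exact ((hind t).comp ((measurable_ownControl s t).comp (hsecz t ω)) measurable_id).congr
      (ae_of_all _ fun z => (hu _ (fun k => g.ownPart i (W k ω)) z t).symm) (ae_of_all _ fun z => rfl)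
  · refine indepFun_prod_snd (measurable_responseState hstd s t) (hwm t) fun z => ?_
    exact ((hstd.indepFun_past_W t).comp ((measurable_ownState s t).comp (hsecω t z))
      (measurable_ownPart i)).congr
      (ae_of_all _ fun ω => (hx _ (fun k => g.ownPart i (W k ω)) z t).symm)
      (ae_of_all _ fun ω => rfl)
  · refine indepFun_prod_snd (measurable_responseControl hstd s t) (hwm t) fun z => ?_
    exact ((hstd.indepFun_past_W t).comp ((measurable_ownControl s t).comp (hsecω t z))
      (measurable_ownPart i)).congr
      (ae_of_all _ fun ω => (hu _ (fun k => g.ownPart i (W k ω)) z t).symm)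
      (ae_of_all _ fun ω => rfl)

theorem innovationModel_prod (i : Fin g.N) (m₀ : g.X) (ξhat : g.Y)
    (a : ℕ → Matrix (Fin g.ny) g.SIdx ℝ) (b : ℕ → g.Y) (K : Matrix g.SIdx (Fin g.ny) ℝ)
    (hl2 : ∀ t, L2Vec ζ fun z : ℕ → g.Y => z t)
    (hbd : ∃ c : ℝ, ∀ t j, ∫ z : ℕ → g.Y, z t j ^ 2 ∂ζ ≤ c)
    (hind : ∀ t, IndepFun (fun (z : ℕ → g.Y) (k : Fin t) => z k)
      (fun z => z t - g.predOutput ξhat (meanVec P (W 0)) a b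
        (g.filterState m₀ ξhat (meanVec P (W 0)) a b K t fun k => z k)) ζ)
    (hmean : ∀ t, meanVec ζ (fun z : ℕ → g.Y => z t - g.predOutput ξhat (meanVec P (W 0)) a b
        (g.filterState m₀ ξhat (meanVec P (W 0)) a b K t fun k => z k)) = 0) :
    g.InnovationModel i (ζ.prod P) ξhat (meanVec P (W 0)) a b (g.Cc + K)
      (fun t q => g.filterState m₀ ξhat (meanVec P (W 0)) a b K t fun k => q.1 k)
      (fun t q => q.1 t - g.predOutput ξhat (meanVec P (W 0)) a b
        (g.filterState m₀ ξhat (meanVec P (W 0)) a b K t fun k => q.1 k))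
      (fun t q => q.1 t) (fun t q => g.ownPart i (W t q.2)) := by
  have hX := l2Vec_filterState m₀ ξhat (meanVec P (W 0)) a b K hl2
  have hν : ∀ t, L2Vec ζ fun z : ℕ → g.Y => z t - g.predOutput ξhat (meanVec P (W 0)) a b
      (g.filterState m₀ ξhat (meanVec P (W 0)) a b K t fun k => z k) := fun t =>
    (hl2 t).sub ((((hX t).mulVec _).add (L2Vec.const _)).add (L2Vec.const _))
  have hfm := fun t => (g.continuous_filterState m₀ ξhat (meanVec P (W 0)) a b K t).measurable
  have hpast : ∀ t, Measurable fun (z : ℕ → g.Y) (k : Fin t) => z k := fun t =>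
    measurable_pi_lambda _ fun k => measurable_pi_apply _
  refine ⟨fun t q => (add_sub_cancel _ _).symm, fun t q => ?_, fun t => (hX t).comp_fst,
    fun t => (hν t).comp_fst, fun t => ?_, fun t => ?_, fun t => ?_, fun t => ?_, ?_⟩
  · rw [← filterStep_eq]
    rfl
  · exact L2Vec.comp_snd (U := fun ω => g.ownPart i (W t ω)) fun j => (hstd.memLp_W t).l2Vec _
  · rw [← hmean t]
    funext j
    simp only [meanVec]
    rw [integral_fun_fst (μ := ζ) (ν := P)
      (fun z : ℕ → g.Y => (z t - g.predOutput ξhat (meanVec P (W 0)) a b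
        (g.filterState m₀ ξhat (meanVec P (W 0)) a b K t fun k => z k)) j)]
    simp
  · funext j
    simp only [meanVec]
    rw [integral_fun_snd (μ := ζ) (ν := P) (fun ω => g.ownPart i (W t ω) j)]
    have h := ((hstd.identDistrib_W t).comp (measurable_pi_apply (Sum.inr ⟨i, j⟩))).integral_eq
    simpa [ownPart, meanVec] using h
  · have hν' : Measurable fun z : ℕ → g.Y => z t - g.predOutput ξhat (meanVec P (W 0)) a b
        (g.filterState m₀ ξhat (meanVec P (W 0)) a b K t fun k => z k) :=
      (measurable_pi_apply t).sub (((Continuous.matrix_mulVec continuous_const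
        continuous_id).measurable.comp ((hfm t).comp (hpast t))).add_const _ |>.add_const _)
    exact indepFun_prod_fst (f := fun q : (ℕ → g.Y) × Ω =>
        g.filterState m₀ ξhat (meanVec P (W 0)) a b K t fun k => q.1 k)
      ((hfm t).comp ((hpast t).comp measurable_fst)) hν'
      fun ω => (hind t).comp (hfm t) measurable_id
  · obtain ⟨c, hc⟩ := hbd
    refine ⟨c, fun t j => (le_of_eq ?_).trans (hc t j)⟩
    rw [integral_fun_fst (μ := ζ) (ν := P) (fun z : ℕ → g.Y => z t j ^ 2)]
    simp

/-- The affine strategy combined with the filter is optimal against a belief for which the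
innovations of the filter are centred and independent of the past. -/
theorem extExp_costJ_le (i : Fin g.N) (m₀ : g.X) {ξhat : g.Y}
    {a : ℕ → Matrix (Fin g.ny) g.SIdx ℝ} {b : ℕ → g.Y}
    (hsol : g.UniquelySolvable ξhat (meanVec P (W 0)) a b) (K : Matrix g.SIdx (Fin g.ny) ℝ)
    (hl2 : ∀ t, L2Vec ζ fun z : ℕ → g.Y => z t)
    (hbd : ∃ c : ℝ, ∀ t j, ∫ z : ℕ → g.Y, z t j ^ 2 ∂ζ ≤ c)
    (hind : ∀ t, IndepFun (fun (z : ℕ → g.Y) (k : Fin t) => z k)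
      (fun z => z t - g.predOutput ξhat (meanVec P (W 0)) a b
        (g.filterState m₀ ξhat (meanVec P (W 0)) a b K t fun k => z k)) ζ)
    (hmean : ∀ t, meanVec ζ (fun z : ℕ → g.Y => z t - g.predOutput ξhat (meanVec P (W 0)) a b
        (g.filterState m₀ ξhat (meanVec P (W 0)) a b K t fun k => z k)) = 0)
    (s' : g.Strategy i) :
    extExp ζ (costJ P X₀ W (g.affineStrategy (meanVec P (W 0)) a b
      (g.filterMap m₀ ξhat (meanVec P (W 0)) a b K) i)) ≤ extExp ζ (costJ P X₀ W s') := by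
  set s := g.affineStrategy (meanVec P (W 0)) a b
    (g.filterMap m₀ ξhat (meanVec P (W 0)) a b K) i with hs
  rcases eq_or_ne (extExp ζ (costJ P X₀ W s')) ⊤ with htop | htop
  · rw [htop]
    exact le_top
  have E := innovationModel_prod hstd i m₀ ξhat a b K hl2 hbd hind hmean
  have hf : ∀ t, Measurable fun v => g.predOutput ξhat (meanVec P (W 0)) a b
      (g.filterState m₀ ξhat (meanVec P (W 0)) a b K t v) := fun t =>
    ((Continuous.matrix_mulVec continuous_const continuous_id).measurable.comp
      (g.continuous_filterState m₀ ξhat (meanVec P (W 0)) a b K t).measurable).add_const _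
      |>.add_const _
  have R := isResponse_response hstd s hf hind
  have R' := isResponse_response hstd s' hf hind
  have hx' := measurable_responseState hstd s'
  have hu' := measurable_responseControl hstd s'
  obtain ⟨l, C, hl, hC, hco⟩ := exists_stageCost_coercive (g := g) (i := i)
  obtain ⟨Z, hZ0, hZ⟩ := E.exists_output_bound
  have hmc : ∀ t, Measurable fun q : (ℕ → g.Y) × Ω => g.β i ^ t *
      g.stageCost i (responseState X₀ W s' t q) (responseControl X₀ W s' t q) (q.1 t) := fun t =>
    (measurable_stageCost (hx' t) (hu' t)
      ((measurable_pi_apply t).comp measurable_fst)).const_mul _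
  -- Coercivity dominates the negative parts by discounted multiples of `|z|²` that do not depend on
  -- the strategy; this excludes `∞ - ∞` for the competitor.
  have hlow : ∀ t (q : (ℕ → g.Y) × Ω), -(g.β i ^ t *
      g.stageCost i (responseState X₀ W s' t q) (responseControl X₀ W s' t q) (q.1 t)) ≤
      g.β i ^ t * (C * (q.1 t ⬝ᵥ q.1 t)) := fun t q => by
    rw [← mul_neg]
    refine mul_le_mul_of_nonneg_left ?_ (pow_nonneg (g.β_nonneg i) t)
    have h1 := hco (responseState X₀ W s' t q) (responseControl X₀ W s' t q) (q.1 t)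
    have h2 := mul_nonneg hl.le (add_nonneg (dotProduct_self_nonneg' (responseState X₀ W s' t q))
      (dotProduct_self_nonneg' (responseControl X₀ W s' t q)))
    linarith
  have hdotm : ∀ t, Measurable fun z : ℕ → g.Y => z t ⬝ᵥ z t := fun t => by
    have hc : Continuous fun y : g.Y => y ⬝ᵥ y := by fun_prop
    exact hc.measurable.comp (measurable_pi_apply t)
  have hnsum : ∑' t, ∫⁻ z : ℕ → g.Y, ENNReal.ofReal (g.β i ^ t * (C * (z t ⬝ᵥ z t))) ∂ζ ≠ ⊤ := by
    have hgeo : Summable fun t => g.β i ^ t * (C * Z) :=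
      (summable_geometric_of_lt_one (g.β_nonneg i) (g.β_lt_one i)).mul_right _
    refine ne_top_of_le_ne_top (hgeo.tsum_ofReal_ne_top) (ENNReal.tsum_le_tsum fun t => ?_)
    have hint : Integrable (fun z : ℕ → g.Y => z t ⬝ᵥ z t) ζ := (hl2 t).integrable_dotProduct (hl2 t)
    rw [← ofReal_integral_eq_lintegral_ofReal ((hint.const_mul C).const_mul _)
      (ae_of_all _ fun z => mul_nonneg (pow_nonneg (g.β_nonneg i) t)
        (mul_nonneg hC (dotProduct_self_nonneg' (z t)))), integral_const_mul, integral_const_mul]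
    refine ENNReal.ofReal_le_ofReal (mul_le_mul_of_nonneg_left
      (mul_le_mul_of_nonneg_left ?_ hC) (pow_nonneg (g.β_nonneg i) t))
    have h := hZ t
    rw [integral_fun_fst (μ := ζ) (ν := P) (fun z : ℕ → g.Y => z t ⬝ᵥ z t)] at h
    simpa using h
  have hpos := tsum_lintegral_ofReal_ne_top (P := P) hmc
    (fun t => (((hdotm t).const_mul C).const_mul (g.β i ^ t)).ennreal_ofReal)
    (fun t z ω => ENNReal.ofReal_le_ofReal (hlow t (z, ω))) hnsum htop
  have hneg : ∑' t, ∫⁻ q, ENNReal.ofReal (-(g.β i ^ t *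
      g.stageCost i (responseState X₀ W s' t q) (responseControl X₀ W s' t q) (q.1 t)))
        ∂ζ.prod P ≠ ⊤ := by
    refine ne_top_of_le_ne_top hnsum (ENNReal.tsum_le_tsum fun t => ?_)
    refine (lintegral_mono fun q => ENNReal.ofReal_le_ofReal (hlow t q)).trans (le_of_eq ?_)
    exact measurePreserving_fst.lintegral_comp
      (((hdotm t).const_mul C).const_mul (g.β i ^ t)).ennreal_ofReal
  obtain ⟨hfin', hsum'⟩ := summable_integral_abs_of_tsum_lintegral hmc hpos hneg
  obtain ⟨hfin, hsum, hle⟩ := R.tsum_integral_le E hstd.stabilizable hsol R' rfl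
    (fun t q => rfl) hx' hu' hfin' hsum'
  -- Both iterated extended expectations are now ordinary convergent series of integrals on the
  -- product space.
  rw [costJ_eq, costJ_eq, extExp_extExp_extSum hfin hsum, extExp_extExp_extSum hfin' hsum']
  exact EReal.coe_le_coe_iff.2 hle

end Optimality

end LQGame


namespace LQGame

/-! ### Change of version of the estimator. -/

section Equilibrium

variable {g : LQGame}

theorem ownHist_affineStrategy_congr {Ŵ : g.X} {a : ℕ → Matrix (Fin g.ny) g.SIdx ℝ}
    {b : ℕ → g.Y} {e e' : g.EstimatorMap} (i : Fin g.N) (x₀ : Fin (g.nx i) → ℝ)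
    (w : ℕ → Fin (g.nx i) → ℝ) {z : ℕ → g.Y}
    (h : ∀ t, (e.map t fun k => z k) = e'.map t fun k => z k) (t : ℕ) :
    ownHist (g.affineStrategy Ŵ a b e i) x₀ w z t =
      ownHist (g.affineStrategy Ŵ a b e' i) x₀ w z t := by
  induction t with
  | zero => rfl
  | succ t ih =>
    simp only [ownHist]
    rw [ih]
    simp only [affineStrategy, h t]

variable {Ω Ωbar : Type*} [MeasurableSpace Ω] [MeasurableSpace Ωbar]
  {P : Measure Ω} {Pbar : Measure Ωbar} {X₀ : Ω → g.X} {ξ : ℕ → Ω → g.Y} {W : ℕ → Ω → g.X}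

/-- The cost against a fixed sequence reads the estimator only along that sequence, so versions that
agree almost everywhere under the belief have equal expected costs. -/
theorem costJ_affineStrategy_congr {Ŵ : g.X} {a : ℕ → Matrix (Fin g.ny) g.SIdx ℝ}
    {b : ℕ → g.Y} {e e' : g.EstimatorMap} (i : Fin g.N) {z : ℕ → g.Y}
    (h : ∀ t, (e.map t fun k => z k) = e'.map t fun k => z k) :
    costJ P X₀ W (g.affineStrategy Ŵ a b e i) z =
      costJ P X₀ W (g.affineStrategy Ŵ a b e' i) z := by
  simp only [costJ, pathCost, ownHist_affineStrategy_congr i _ _ h]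
  simp only [affineStrategy, h]

/-- Two versions of the state estimator agree on almost every realization of the replica. -/
theorem ae_map_eq_of_isStateEstimator {Xbar : ℕ → Ωbar → g.X} {ybar : ℕ → Ωbar → g.Y}
    (hy : ∀ t, Measurable (ybar t)) {e e' : g.EstimatorMap}
    (he : g.IsStateEstimator Pbar Xbar ybar e) (he' : g.IsStateEstimator Pbar Xbar ybar e') :
    ∀ᵐ z ∂Pbar.map (fun ω t => ybar t ω), ∀ t, (e.map t fun k => z k) = e'.map t fun k => z k := by
  have hpast : ∀ t, Measurable fun (z : ℕ → g.Y) (k : Fin t) => z k := fun t =>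
    measurable_pi_lambda _ fun k => measurable_pi_apply _
  refine ae_all_iff.2 fun t => ?_
  have hms : MeasurableSet {z : ℕ → g.Y | (e.map t fun k => z k) = e'.map t fun k => z k} :=
    measurableSet_eq_fun ((e.measurable_map t).comp (hpast t))
      ((e'.measurable_map t).comp (hpast t))
  exact (ae_map_iff (measurable_pi_lambda _ hy).aemeasurable hms).2 ((he t).trans (he' t).symm)

end Equilibrium

end LQGame

end

/-! ### Assembly of the equilibrium. -/

theorem corollary1 {Ω Ωbar : Type*} [MeasurableSpace Ω] [MeasurableSpace Ωbar]
    (P : Measure Ω) [IsProbabilityMeasure P] (Pbar : Measure Ωbar) [IsProbabilityMeasure Pbar]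
    (g : LQGame)
    -- the primitive random variables of the game
    (X₀ : Ω → g.X) (ξ : ℕ → Ω → g.Y) (W : ℕ → Ω → g.X)
    (hstd : g.StandingAssumptions P X₀ ξ W)
    -- unique solvability of the infinite linear system
    (a : ℕ → Matrix (Fin g.ny) g.SIdx ℝ) (b : ℕ → g.Y)
    (hsol : g.UniquelySolvable (meanVec P (ξ 0)) (meanVec P (W 0)) a b)
    -- the exogenous replica, with environment variables of uniformly bounded second moment
    (X₀bar : Ωbar → g.X) (ξbar : ℕ → Ωbar → g.Y) (Wbar : ℕ → Ωbar → g.X)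
    (hlaw : IdentDistrib
      (fun ω => (X₀bar ω, (fun t => ξbar t ω : ℕ → g.Y), (fun t => Wbar t ω : ℕ → g.X)))
      (fun ω => (X₀ ω, (fun t => ξ t ω : ℕ → g.Y), (fun t => W t ω : ℕ → g.X))) Pbar P)
    (Xbar : ℕ → Ωbar → g.X) (ybar : ℕ → Ωbar → g.Y)
    (hrep : g.IsReplica Pbar (meanVec P (W 0)) a b X₀bar ξbar Wbar Xbar ybar)
    (hbdd : ∃ c : ℝ≥0, ∀ t, ∫⁻ ω, ENNReal.ofReal (ybar t ω ⬝ᵥ ybar t ω) ∂Pbar ≤ c)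
    -- the additional hypotheses
    (hgauss : g.IsJointlyGaussian P X₀ ξ W)
    (Sig : Matrix g.SIdx g.SIdx ℝ)
    (hinv : IsUnit (g.Dc * Sig * g.Dcᵀ + covMat P (ξ 0)))
    (hcov : covMat P X₀ = Sig)
    (hric : g.IsSteadyState (covMat P (ξ 0)) (covMat P (W 0)) Sig) :
    let ltiFilter : g.EstimatorMap :=
      g.filterMap (meanVec P X₀) (meanVec P (ξ 0)) (meanVec P (W 0)) a b
        (g.kalmanGain Sig (covMat P (ξ 0)))
    let strat : g.EstimatorMap → ∀ i, g.Strategy i := g.affineStrategy (meanVec P (W 0)) a b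
    -- the filter is a version of the state estimator mapping `Ȳₜ₋₁ ↦ E[X̄ₜ | Ȳₜ₋₁]`
    g.IsStateEstimator Pbar Xbar ybar ltiFilter ∧
    -- the affine feedback combined with the filter is an SEBEU
    LQGame.IsSEBEU P X₀ ξ W (strat ltiFilter) ∧
    -- whichever version of the estimator mapping defines the affine strategy, the latter is an
    -- SEBEU, and almost surely all the decisions it generates are those of the LTI system driven
    -- by the observed environment variables
    ∀ e : g.EstimatorMap, g.IsStateEstimator Pbar Xbar ybar e →
      LQGame.IsSEBEU P X₀ ξ W (strat e) ∧
      ∀ᵐ ω ∂P, ∀ (t : ℕ) (i : Fin g.N),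
        let h := LQGame.hist (strat e) (X₀ ω) (fun k => ξ k ω) (fun k => W k ω) t
        LQGame.control (strat e) h i =
          g.F i *ᵥ h.x i (Fin.last t) + g.Gi a i *ᵥ ltiFilter.map t h.y
            + g.Hi (meanVec P (W 0)) b i := by
  intro ltiFilter strat
  set V := covMat P (ξ 0) with hV
  set K := g.kalmanGain Sig V with hKdef
  have hdet : IsUnit (g.Dc * Sig * g.Dcᵀ + V).det := (Matrix.isUnit_iff_isUnit_det _).1 hinv
  -- The covariance arguments use the gain only through this equation and `hric'`.
  have hK : K * (g.Dc * Sig * g.Dcᵀ + V) = g.Ac * Sig * g.Dcᵀ := by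
    rw [hKdef, LQGame.kalmanGain, Matrix.nonsing_inv_mul_cancel_right _ _ hdet]
  have hric' : Sig = g.Ac * Sig * g.Acᵀ - K * g.Dc * Sig * g.Acᵀ + covMat P (W 0) := by
    refine Eq.trans hric ?_
    rw [hKdef, LQGame.kalmanGain]
    simp only [Matrix.mul_sub, Matrix.sub_mul, Matrix.mul_assoc]
  have hst := hstd.stabilizable
  have ha := hsol.bounded_a
  have hb := hsol.bounded_b
  obtain ⟨c, hc⟩ := hbdd
  have hy2 : ∀ t, L2Vec Pbar (ybar t) := fun t =>
    LQGame.l2Vec_of_lintegral_le (hrep.measurable_y t) (hc t)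
  have hfilter : g.IsStateEstimator Pbar Xbar ybar ltiFilter :=
    LQGame.isStateEstimator_filterMap hstd hgauss hK hcov hric' hlaw hrep hy2
  have hinnov := LQGame.innovation_indepFun hstd hgauss hK hcov hric' hlaw hrep hy2
  have hym : Measurable fun ω => (fun t => ybar t ω : ℕ → g.Y) :=
    measurable_pi_lambda _ hrep.measurable_y
  -- The common belief of all decision makers.
  set ζ : Measure (ℕ → g.Y) := Pbar.map fun ω t => ybar t ω with hζ
  have hζp : IsProbabilityMeasure ζ := Measure.isProbabilityMeasure_map hym.aemeasurable
  have hid : IdentDistrib (fun ω => (fun t => ybar t ω : ℕ → g.Y)) (fun z => z) Pbar ζ :=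
    ⟨hym.aemeasurable, aemeasurable_id, Measure.map_id.symm⟩
  have hpast : ∀ t, Measurable fun (z : ℕ → g.Y) (k : Fin t) => z k := fun t =>
    measurable_pi_lambda _ fun k => measurable_pi_apply _
  have hνm : ∀ t, Measurable fun z : ℕ → g.Y =>
      z t - g.predOutput (meanVec P (ξ 0)) (meanVec P (W 0)) a b (g.filterState (meanVec P X₀)
        (meanVec P (ξ 0)) (meanVec P (W 0)) a b K t fun k => z k) := fun t =>
    (measurable_pi_apply t).sub (((Continuous.matrix_mulVec continuous_const
      continuous_id).measurable.comp ((g.continuous_filterState _ _ _ a b K t).measurable.comp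
        (hpast t))).add_const _ |>.add_const _)
  have hcoord : ∀ t j, Measurable fun z : ℕ → g.Y => z t j := fun t j =>
    (measurable_pi_apply j).comp (measurable_pi_apply t)
  have hbd : ∃ c : ℝ, ∀ t j, ∫ z : ℕ → g.Y, z t j ^ 2 ∂ζ ≤ c := by
    refine ⟨c, fun t j => ?_⟩
    have h1 : ∫ z : ℕ → g.Y, z t j ^ 2 ∂ζ = ∫ ω, ybar t ω j ^ 2 ∂Pbar :=
      (hid.comp ((hcoord t j).pow_const 2)).integral_eq.symm
    rw [h1, integral_eq_lintegral_of_nonneg_ae (ae_of_all _ fun ω => sq_nonneg _)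
      (hy2 t j).integrable_sq.aestronglyMeasurable]
    refine ENNReal.toReal_le_coe_of_le_coe ((lintegral_mono fun ω => ?_).trans (hc t))
    exact ENNReal.ofReal_le_ofReal (sq_le_dotProduct_self _ j)
  -- Under `ζ` the coordinate process is distributed as ȳ, so moments and innovation properties
  -- transfer from the replica to sequence space.
  have hopt : ∀ i (s' : g.Strategy i), extExp ζ (LQGame.costJ P X₀ W (strat ltiFilter i)) ≤
      extExp ζ (LQGame.costJ P X₀ W s') := fun i s' =>
    LQGame.extExp_costJ_le hstd i (meanVec P X₀) hsol K
      (fun t j => (hid.comp (hcoord t j)).memLp_iff.1 (hy2 t j)) hbd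
      (fun t => indepFun_of_identDistrib_pair (hinnov t).1 (hid.comp ((hpast t).prodMk (hνm t))))
      (fun t => funext fun j => ((hid.comp ((measurable_pi_apply j).comp
        (hνm t))).integral_eq.symm.trans ((hinnov t).2 j))) s'
  have hmain : ∀ e : g.EstimatorMap, g.IsStateEstimator Pbar Xbar ybar e →
      LQGame.IsSEBEU P X₀ ξ W (strat e) ∧
      ∀ᵐ ω ∂P, ∀ (t : ℕ) (i : Fin g.N),
        LQGame.control (strat e)
            (LQGame.hist (strat e) (X₀ ω) (fun k => ξ k ω) (fun k => W k ω) t) i =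
          g.F i *ᵥ (LQGame.hist (strat e) (X₀ ω) (fun k => ξ k ω) (fun k => W k ω) t).x i
              (Fin.last t)
            + g.Gi a i *ᵥ ltiFilter.map t
              (LQGame.hist (strat e) (X₀ ω) (fun k => ξ k ω) (fun k => W k ω) t).y
            + g.Hi (meanVec P (W 0)) b i := by
    intro e he
    -- Every version generates the same law, so one belief is consistent for all of them.
    have henv : ζ = LQGame.envLaw P X₀ ξ W (strat e) :=
      hrep.map_eq_envLaw hst (meanVec P (W 0)) ha hb he hlaw
    have hae : ∀ᵐ z ∂ζ, ∀ t, (e.map t fun k => z k) = ltiFilter.map t fun k => z k :=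
      LQGame.ae_map_eq_of_isStateEstimator hrep.measurable_y he hfilter
    refine ⟨⟨fun _ => ⟨ζ, hζp⟩, fun i s' => ?_, fun _ => henv⟩, ?_⟩
    · refine (extExp_congr (hae.mono fun z hz => ?_)).trans_le (hopt i s')
      exact LQGame.costJ_affineStrategy_congr i hz
    · have hm := LQGame.measurable_envVar hst (meanVec P (W 0)) ha hb e
      -- As `ζ` is also the law of the generated outputs, almost everywhere agreement under `ζ`
      -- becomes almost sure agreement along the actual play.
      rw [henv] at hae
      have h1 := ae_of_ae_map (hm.comp_aemeasurable hlaw.aemeasurable_snd) hae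
      filter_upwards [h1] with ω hω t i
      have h2 := hω t
      simp only [LQGame.control]
      rw [LQGame.hist_y]
      exact congrArg (fun v => g.F i *ᵥ _ + g.Gi a i *ᵥ v + g.Hi (meanVec P (W 0)) b i) h2
  exact ⟨hfilter, (hmain _ hfilter).1, hmain⟩
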